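/- Let $m\ge 1$ and $n\ge 0$ be integers. Let $\Lambda_{2n}$ be the real Grassmann algebra generated by $\grave x_1,\dots,\grave x_{2n}$, let $\mathcal{O}(\mathbb{R}^{m|2n})=C^\infty(\mathbb{R}^m)\otimes\Lambda_{2n}$ and $\mathcal{O}(\mathbb{R}_0^{m|2n})=C^\infty(\mathbb{R}^m\setminus\{0\})\otimes\Lambda_{2n}$, and let $\mathbb{R}^+=(0,\infty)$. Write $(X_1,\dots,X_{m+2n})=(x_1,\dots,x_m,\grave x_1,\dots,\grave x_{2n})$, with parity $[i]=0$ for $i\le m$ and $[i]=1$ for $i>m$. Let $g=\mathrm{diag}(I_m,J)$, where $J$ is block diagonal with $n$ blocks $\tfrac12\begin{pmatrix}0&-1\\1&0\end{pmatrix}$, and put $$r^2=\sum_{i=1}^m x_i^2,\qquad \theta^2=-\sum_{j=1}^n \grave x_{2j-1}\grave x_{2j},\qquad R^2=\sum_{i,j}X_i\,g^{ij}X_j=r^2+\theta^2 .$$ Let $X^j=\sum_i X_i g^{ij}$ and $L_{ij}=X_i\partial_{X^j}-(-1)^{[i][j]}X_j\partial_{X^i}$. These operators span the Lie superalgebra $\mathfrak{osp}(m|2n)$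 acting on $\mathcal{O}(\mathbb{R}^{m|2n})$. Let $Sp(2n)=\{B: B^TJB=J\}$. The group $O(m)\times Sp(2n)$ acts by $f(\mathbf{x})\mapsto f(S^{-1}\mathbf{x})$. A linear map $T$ on $\mathcal{O}(\mathbb{R}^{m|2n})$ is called $SOSp(m|2n)$-invariant if it is invariant under the Lie supergroup with Harish-Chandra pair $(SO(m)\times Sp(2n),\mathfrak{osp}(m|2n))$: for all $S\in SO(m)\times Sp(2n)$, all $k\ge 0$, all $Z_1,\dots,Z_k\in\mathfrak{osp}(m|2n)$ and all $f$, the value $T(S\cdot Z_1\cdots Z_kf)$ is $T(f)$ if $k=0$ and $0$ if $k\ge 1$. It is called $OSp(m|2n)$-invariant if the same holds with $O(m)$ in place of $SO(m)$. Define $\phi^\sharp$ by $$\phi^\sharp=\sum_{j=0}^n\frac{(-1)^j\theta^{2j}}{j!}\Big(\frac{\partial}{\partial r^2}\Big)^j\quad\text{on }\mathcal{O}(\mathbb{R}_0^{m|2n}),\qquad \frac{\partial}{\partial r^2}=\frac1{2r^2}\sum_{i=1}^m x_i\partial_{x_i},$$ and on $\mathcal{O}(\mathbb{R}^{m|2n})$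 by first restricting to $\mathbb{R}^m\setminus\{0\}$. Let $\int_B=\pi^{-n}\partial_{\grave x_{2n}}\cdots\partial_{\grave x_1}$ be the Berezin integral, let $(1-\theta^2/r^2)^{m/2-1}$ be defined by its finite Taylor expansion in the nilpotent $\theta^2/r^2$, and let $\int_{\mathbb{S}^{m-1}(L)}$ be the integral over the sphere of radius $L$ for the surface measure, which has total mass $\frac{2\pi^{m/2}}{\Gamma(m/2)}L^{m-1}$. **Theorem.** (i) The formulas $$\int_{\mathbb{S}^{m-1|2n}(L)}f=\int_{\mathbb{S}^{m-1}(L)}\int_B\Big(1-\frac{\theta^2}{r^2}\Big)^{\frac m2-1}\phi^\sharp(f)=\frac1{L^{m-2}}\int_{\mathbb{S}^{m-1}(L)}\int_B\phi^\sharp\big(r^{m-2}f\big)\qquad(L>0)$$ agree and define a linear map $\mathcal{O}(\mathbb{R}^{m|2n})\to C^\infty(\mathbb{R}^+)$. This map is $SOSp(m|2n)$-invariant and satisfies $T[R^2f](L)=L^2\,T[f](L)$ for all $f$ and $L$. (ii) If $m\ge 2$, it is the only such map up to a multiplicative function: a linear map $T:\mathcal{O}(\mathbb{R}^{m|2n})\to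 C^\infty(\mathbb{R}^+)$ is $SOSp(m|2n)$-invariant and satisfies $T[R^2f](L)=L^2\,T[f](L)$ for all $f$ and $L$ if and only if there is a unique $\alpha\in C^\infty(\mathbb{R}^+)$ with $T[f](L)=\alpha(L)\int_{\mathbb{S}^{m-1|2n}(L)}f$ for all $f$ and $L$. (iii) If $m=1$, the same equivalence holds with $OSp(1|2n)$-invariance in place of $SOSp(1|2n)$-invariance. -/

import Mathlib

open scoped TensorProduct ContDiff

noncomputable section

namespace Superspace

/-! ### Smooth functions on an open set -/

/-- Extension by zero of a function on an open set `U`. -/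
def extendZero {E : Type*} [TopologicalSpace E] (U : TopologicalSpace.Opens E) (h : U → ℝ) : E → ℝ :=
  Function.extend Subtype.val h 0

theorem extendZero_apply {E : Type*} [TopologicalSpace E] (U : TopologicalSpace.Opens E)
    (h : U → ℝ) (x : U) : extendZero U h x = h x :=
  Subtype.val_injective.extend_apply h 0 x

section Smooth

variable {E : Type*} [NormedAddCommGroup E] [NormedSpace ℝ E]

theorem contDiffOn_extendZero (U : TopologicalSpace.Opens E) (h : U → ℝ) (f : E → ℝ)
    (hf : ContDiffOn ℝ ∞ f U) (hh : ∀ x : U, h x = f x) :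
    ContDiffOn ℝ ∞ (extendZero U h) U :=
  hf.congr fun x hx => (extendZero_apply U h ⟨x, hx⟩).trans (hh ⟨x, hx⟩)

/-- The algebra `C^∞(U)` of real-valued smooth functions on the open set `U`. -/
def Smooth (U : TopologicalSpace.Opens E) : Subalgebra ℝ (U → ℝ) where
  carrier := {h | ContDiffOn ℝ ∞ (extendZero U h) U}
  mul_mem' {a b} ha hb := contDiffOn_extendZero U _ _ (ContDiffOn.mul ha hb) fun x => by
    simp [extendZero_apply]
  add_mem' {a b} ha hb := contDiffOn_extendZero U _ _ (ContDiffOn.add ha hb) fun x => by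
    simp [extendZero_apply]
  algebraMap_mem' c := contDiffOn_extendZero U _ (fun _ => c) contDiffOn_const fun x => by
    simp

/-- The smooth function on `U` obtained from a function on `E` that is smooth on `U`. -/
def Smooth.mk (U : TopologicalSpace.Opens E) (f : E → ℝ) (hf : ContDiffOn ℝ ∞ f U) : Smooth U :=
  ⟨fun x => f x, contDiffOn_extendZero U _ f hf fun _ => rfl⟩

/-- Restriction of smooth functions to a smaller open set. -/
def Smooth.restrict {U V : TopologicalSpace.Opens E} (hVU : V ≤ U) : Smooth U →ₗ[ℝ] Smooth V where
  toFun h := Smooth.mk V (extendZero U h.1) (h.2.mono hVU)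
  map_add' h k := by
    ext x
    have hx := extendZero_apply U
    simp only [Smooth.mk]
    exact ((hx (h.1 + k.1) ⟨x, hVU x.2⟩).trans
      (congrArg₂ (· + ·) (hx h.1 ⟨x, hVU x.2⟩) (hx k.1 ⟨x, hVU x.2⟩)).symm)
  map_smul' c h := by
    ext x
    have hx := extendZero_apply U
    simp only [Smooth.mk]
    exact ((hx (c • h.1) ⟨x, hVU x.2⟩).trans
      (congrArg (c * ·) (hx h.1 ⟨x, hVU x.2⟩)).symm)

theorem Smooth.hasFDerivAt {U : TopologicalSpace.Opens E} (h : Smooth U) (x : U) :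
    HasFDerivAt (extendZero U h.1) (fderiv ℝ (extendZero U h.1) x) x :=
  ((h.2.contDiffAt (U.isOpen.mem_nhds x.2)).differentiableAt (by simp)).hasFDerivAt

/-- Directional derivative `∂_v` on `C^∞(U)`. -/
def Smooth.deriv (U : TopologicalSpace.Opens E) (v : E) : Smooth U →ₗ[ℝ] Smooth U where
  toFun h := Smooth.mk U (fun x => fderiv ℝ (extendZero U h.1) x v)
    ((h.2.fderiv_of_isOpen U.isOpen (by simp)).clm_apply contDiffOn_const)
  map_add' h k := by
    ext x
    have e : extendZero U (h + k).1 =ᶠ[nhds x.1] extendZero U h.1 + extendZero U k.1 := by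
      filter_upwards [U.isOpen.mem_nhds x.2] with y hy
      have hx := extendZero_apply U
      exact (hx (h.1 + k.1) ⟨y, hy⟩).trans
        (congrArg₂ (· + ·) (hx h.1 ⟨y, hy⟩) (hx k.1 ⟨y, hy⟩)).symm
    have := (((Smooth.hasFDerivAt h x).add (Smooth.hasFDerivAt k x)).congr_of_eventuallyEq e).fderiv
    exact congrArg (fun D => D v) this
  map_smul' c h := by
    ext x
    have e : extendZero U (c • h).1 =ᶠ[nhds x.1] c • extendZero U h.1 := by
      filter_upwards [U.isOpen.mem_nhds x.2] with y hy
      have hx := extendZero_apply U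
      exact (hx (c • h.1) ⟨y, hy⟩).trans (congrArg (c * ·) (hx h.1 ⟨y, hy⟩)).symm
    have := (((Smooth.hasFDerivAt h x).const_smul c).congr_of_eventuallyEq e).fderiv
    exact congrArg (fun D => D v) this

end Smooth

/-! ### The superspace `ℝ^{m|2n}` -/

/-- Bosonic space `ℝ^m`. -/
abbrev Bos (m : ℕ) : Type := EuclideanSpace ℝ (Fin m)

/-- Index set of the `2n` Grassmann variables; `(j, 0)` and `(j, 1)` (with `j = 0, …, n - 1`) stand
for the usual indices `2j + 1` and `2j + 2`. -/
abbrev FermIdx (n : ℕ) : Type := Fin n × Fin 2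

/-- Index set of the coordinates `X_1, …, X_{m+2n}`. -/
abbrev Idx (m n : ℕ) : Type := Fin m ⊕ FermIdx n

/-- The Grassmann algebra `Λ_{2n}`. -/
abbrev Grass (n : ℕ) : Type := ExteriorAlgebra ℝ (FermIdx n → ℝ)

/-- The superalgebra `C^∞(U) ⊗ Λ_{2n}` of superfunctions on the open set `U`. The first factor is
purely even, so the product is `(f ⊗ a) (h ⊗ b) = f h ⊗ a b`. -/
def SuperFun {m : ℕ} (n : ℕ) (U : TopologicalSpace.Opens (Bos m)) : Type :=
  Smooth U ⊗[ℝ] Grass n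

instance {m : ℕ} (n : ℕ) (U : TopologicalSpace.Opens (Bos m)) : Ring (SuperFun n U) :=
  inferInstanceAs (Ring (Smooth U ⊗[ℝ] Grass n))

instance {m : ℕ} (n : ℕ) (U : TopologicalSpace.Opens (Bos m)) : Algebra ℝ (SuperFun n U) :=
  inferInstanceAs (Algebra ℝ (Smooth U ⊗[ℝ] Grass n))

/-- The identification of `O(U)` with `C^∞(U) ⊗ Λ_{2n}`. -/
def SuperFun.equiv {m : ℕ} (n : ℕ) (U : TopologicalSpace.Opens (Bos m)) :
    SuperFun n U ≃ₐ[ℝ] Smooth U ⊗[ℝ] Grass n :=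
  AlgEquiv.refl

/-- The superfunction `f a = f ⊗ a`. -/
def SuperFun.tmul {m n : ℕ} {U : TopologicalSpace.Opens (Bos m)} (f : Smooth U) (a : Grass n) :
    SuperFun n U :=
  (SuperFun.equiv n U).symm (f ⊗ₜ[ℝ] a)

/-- The operator `D ⊗ E` on superfunctions. -/
def SuperFun.map {m n : ℕ} {U V : TopologicalSpace.Opens (Bos m)}
    (D : Smooth U →ₗ[ℝ] Smooth V) (E : Grass n →ₗ[ℝ] Grass n) : SuperFun n U →ₗ[ℝ] SuperFun n V :=
  (SuperFun.equiv n V).symm.toLinearMap ∘ₗ TensorProduct.map D E ∘ₗ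
    (SuperFun.equiv n U).toLinearMap

/-- `ℝ^m_0 = ℝ^m \ {0}`. -/
def punctured (m : ℕ) : TopologicalSpace.Opens (Bos m) := ⟨{0}ᶜ, isOpen_compl_singleton⟩

/-- `ℝ⁺ = (0, ∞)`. -/
def posReals : TopologicalSpace.Opens ℝ := ⟨Set.Ioi 0, isOpen_Ioi⟩

section

variable (m n : ℕ)

/-- The symplectic block `J`, block diagonal with `n` blocks `½ (0, -1; 1, 0)`. -/
def symplecticJ : Matrix (FermIdx n) (FermIdx n) ℝ :=
  Matrix.kronecker (1 : Matrix (Fin n) (Fin n) ℝ) ((1 / 2 : ℝ) • !![0, -1; 1, 0])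

/-- The orthosymplectic metric `g = diag(I_m, J)`. -/
def superMetric : Matrix (Idx m n) (Idx m n) ℝ :=
  Matrix.fromBlocks 1 0 0 (symplecticJ n)

variable {m}

/-- The bosonic coordinate function `x_i`. -/
def bosCoord (U : TopologicalSpace.Opens (Bos m)) (i : Fin m) : Smooth U :=
  Smooth.mk U (fun x => x i) (by fun_prop)

/-- The partial derivative `∂_{x_i}` on smooth functions. -/
def bosDeriv (U : TopologicalSpace.Opens (Bos m)) (i : Fin m) : Smooth U →ₗ[ℝ] Smooth U :=
  Smooth.deriv U (EuclideanSpace.single i 1)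

variable {n}

/-- The generator `x̀_a` of `Λ_{2n}`. -/
def grassGen (a : FermIdx n) : Grass n := ExteriorAlgebra.ι ℝ (Pi.single a 1)

/-- The (left) Grassmann derivative `∂_{x̀_a}`: the odd superderivation of `Λ_{2n}`
with `∂_{x̀_a} x̀_b = δ_{ab}`. -/
def grassDeriv (a : FermIdx n) : Grass n →ₗ[ℝ] Grass n :=
  CliffordAlgebra.contractLeft (LinearMap.proj a : (FermIdx n → ℝ) →ₗ[ℝ] ℝ)

variable (n)

/-- `θ² = ∑ x̀_a J^{ab} x̀_b = - ∑ x̀_{2j-1} x̀_{2j}`. -/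
def thetaSq : Grass n := ∑ a, ∑ b, symplecticJ n a b • (grassGen a * grassGen b)

variable {n}

/-- The supercoordinate `X_i`. -/
def coord (U : TopologicalSpace.Opens (Bos m)) : Idx m n → SuperFun n U
  | .inl i => SuperFun.tmul (bosCoord U i) 1
  | .inr a => SuperFun.tmul 1 (grassGen a)

/-- The derivative `∂_{X_i}` on superfunctions. -/
def partialD (U : TopologicalSpace.Opens (Bos m)) : Idx m n → Module.End ℝ (SuperFun n U)
  | .inl i => SuperFun.map (bosDeriv U i) LinearMap.id
  | .inr a => SuperFun.map LinearMap.id (grassDeriv a)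

/-- The derivative `∂_{X^j}` with respect to `X^j = ∑ X_i g^{ij}`, i.e. `∑ (g⁻¹)_{ji} ∂_{X_i}`. -/
def partialUp (U : TopologicalSpace.Opens (Bos m)) (j : Idx m n) : Module.End ℝ (SuperFun n U) :=
  ∑ i, (superMetric m n)⁻¹ j i • partialD U i

/-- The sign `(-1)^{[i][j]}`. -/
def paritySign : Idx m n → Idx m n → ℝ
  | .inr _, .inr _ => -1
  | _, _ => 1

/-- `L_{ij} = X_i ∂_{X^j} - (-1)^{[i][j]} X_j ∂_{X^i}`, acting on `O(ℝ^{m|2n})`. -/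
def ospGen (i j : Idx m n) : Module.End ℝ (SuperFun n (⊤ : TopologicalSpace.Opens (Bos m))) :=
  LinearMap.mulLeft ℝ (coord ⊤ i) * partialUp ⊤ j -
    paritySign i j • (LinearMap.mulLeft ℝ (coord ⊤ j) * partialUp ⊤ i)

variable (m n)

/-- The Lie superalgebra `osp(m|2n)` in its realization by vector fields on `ℝ^{m|2n}`. -/
def osp : Submodule ℝ (Module.End ℝ (SuperFun n (⊤ : TopologicalSpace.Opens (Bos m)))) :=
  Submodule.span ℝ (Set.range fun p : Idx m n × Idx m n => ospGen p.1 p.2)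

/-- `R² = ∑ X_i g^{ij} X_j = r² + θ²`. -/
def RSq : SuperFun n (⊤ : TopologicalSpace.Opens (Bos m)) :=
  ∑ i, ∑ j, superMetric m n i j • (coord ⊤ i * coord ⊤ j)

/-- The symplectic group `Sp(2n) = {B | Bᵀ J B = J}`. -/
def Sp : Set (Matrix (FermIdx n) (FermIdx n) ℝ) :=
  {B | B.transpose * symplecticJ n * B = symplecticJ n}

variable {m n}

/-- The linear substitution `f ↦ f(A x)` on `C^∞(ℝ^m)`. -/
def bosPullback (A : Matrix (Fin m) (Fin m) ℝ) :
    Smooth (⊤ : TopologicalSpace.Opens (Bos m)) →ₗ[ℝ]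
      Smooth (⊤ : TopologicalSpace.Opens (Bos m)) where
  toFun h := Smooth.mk ⊤ (fun x => extendZero ⊤ h.1 (Matrix.toEuclideanCLM (𝕜 := ℝ) A x))
    (h.2.comp (by fun_prop) fun _ _ => trivial)
  map_add' h k := by
    ext x
    have hx := extendZero_apply (⊤ : TopologicalSpace.Opens (Bos m))
    exact (hx (h.1 + k.1) ⟨_, trivial⟩).trans
      (congrArg₂ (· + ·) (hx h.1 ⟨_, trivial⟩) (hx k.1 ⟨_, trivial⟩)).symm
  map_smul' c h := by
    ext x
    have hx := extendZero_apply (⊤ : TopologicalSpace.Opens (Bos m))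
    exact (hx (c • h.1) ⟨_, trivial⟩).trans (congrArg (c * ·) (hx h.1 ⟨_, trivial⟩)).symm

/-- The substitution `x̀_a ↦ ∑_b B_{ab} x̀_b` on `Λ_{2n}`. -/
def grassPullback (B : Matrix (FermIdx n) (FermIdx n) ℝ) : Grass n →ₐ[ℝ] Grass n :=
  ExteriorAlgebra.map B.vecMulLinear

/-- The action `f(x) ↦ f(S⁻¹ x)` of `S = diag(A, B)` on superfunctions. -/
def groupAct (A : Matrix (Fin m) (Fin m) ℝ) (B : Matrix (FermIdx n) (FermIdx n) ℝ) :
    Module.End ℝ (SuperFun n (⊤ : TopologicalSpace.Opens (Bos m))) :=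
  SuperFun.map (bosPullback A⁻¹) (grassPullback B⁻¹).toLinearMap

/-- Invariance of a linear map `T : O(ℝ^{m|2n}) → V` under the Lie supergroup `G` with Harish-Chandra
pair `(K × Sp(2n), osp(m|2n))`, where `K` is a group of orthogonal matrices.

A superfunction on `G` with values in `V` is determined by its values under the functionals
`δ_g ∘ Z`, `g` in the underlying group and `Z` a product `X_1 ⋯ X_k` in the enveloping algebra.
Applied to `(id × T) ∘ ψ^♯` these give `T(g · X_1 ⋯ X_k f)`, applied to `1 × T` they give `T(f)` if
`k = 0` and `0` if `k ≥ 1`. The definition says that both superfunctions on `G` agree for all `f`. -/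
def IsInvariant {V : Type*} [AddCommGroup V] [Module ℝ V]
    (K : Set (Matrix (Fin m) (Fin m) ℝ))
    (T : SuperFun n (⊤ : TopologicalSpace.Opens (Bos m)) →ₗ[ℝ] V) : Prop :=
  ∀ A ∈ K, ∀ B ∈ Sp n,
    ∀ w : List (Module.End ℝ (SuperFun n (⊤ : TopologicalSpace.Opens (Bos m)))),
      (∀ X ∈ w, X ∈ osp m n) → ∀ f, T (groupAct A B (w.prod f)) = if w = [] then T f else 0

/-- Invariance under `SOSp(m|2n) = (SO(m) × Sp(2n), osp(m|2n))`. -/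
def IsSOSpInvariant {V : Type*} [AddCommGroup V] [Module ℝ V]
    (T : SuperFun n (⊤ : TopologicalSpace.Opens (Bos m)) →ₗ[ℝ] V) : Prop :=
  IsInvariant (Matrix.specialOrthogonalGroup (Fin m) ℝ : Set (Matrix (Fin m) (Fin m) ℝ)) T

/-- Invariance under `OSp(m|2n) = (O(m) × Sp(2n), osp(m|2n))`. -/
def IsOSpInvariant {V : Type*} [AddCommGroup V] [Module ℝ V]
    (T : SuperFun n (⊤ : TopologicalSpace.Opens (Bos m)) →ₗ[ℝ] V) : Prop :=
  IsInvariant (Matrix.orthogonalGroup (Fin m) ℝ : Set (Matrix (Fin m) (Fin m) ℝ)) T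

/-- The property `T[R² f](L) = L² T[f](L)`. -/
def IsModRSq (T : SuperFun n (⊤ : TopologicalSpace.Opens (Bos m)) →ₗ[ℝ] Smooth posReals) : Prop :=
  ∀ f, ∀ L : posReals, (T (RSq m n * f)).1 L = (L : ℝ) ^ 2 * (T f).1 L

/-! ### The morphism `φ^♯` and the supersphere integral -/

/-- The function `r^p` on `ℝ^m_0`. -/
def rPow (m : ℕ) (p : ℤ) : Smooth (punctured m) :=
  Smooth.mk (punctured m) (fun x => ‖x‖ ^ p) fun x hx =>
    (by
      have h : ContDiffAt ℝ ∞ (fun y : Bos m => ‖y‖) x := contDiffAt_norm ℝ hx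
      cases p with
      | ofNat k => simpa using h.pow k
      | negSucc k =>
        simp only [zpow_negSucc]
        exact (h.pow (k + 1)).inv (pow_ne_zero _ (norm_ne_zero_iff.2 hx)) :
      ContDiffAt ℝ ∞ (fun y : Bos m => ‖y‖ ^ p) x).contDiffWithinAt

/-- `∂/∂r² = (1 / (2 r²)) ∑ x_i ∂_{x_i}` on `C^∞(ℝ^m_0)`. -/
def derivRSq (m : ℕ) : Module.End ℝ (Smooth (punctured m)) :=
  (1 / 2 : ℝ) • (LinearMap.mulLeft ℝ (rPow m (-2)) *
    ∑ i, LinearMap.mulLeft ℝ (bosCoord (punctured m) i) * bosDeriv (punctured m) i)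

/-- `φ^♯ = ∑_{j ≤ n} ((-1)^j θ^{2j} / j!) (∂/∂r²)^j` on `O(ℝ^{m|2n}_0)`. -/
def phiSharp (m n : ℕ) : Module.End ℝ (SuperFun n (punctured m)) :=
  ∑ j ∈ Finset.range (n + 1), ((-1 : ℝ) ^ j / (j.factorial : ℝ)) •
    SuperFun.map (derivRSq m ^ j) (LinearMap.mulLeft ℝ (thetaSq n ^ j))

/-- Restriction `O(ℝ^{m|2n}) → O(ℝ^{m|2n}_0)`. -/
def toPunctured (m n : ℕ) :
    SuperFun n (⊤ : TopologicalSpace.Opens (Bos m)) →ₗ[ℝ] SuperFun n (punctured m) :=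
  SuperFun.map (Smooth.restrict le_top) LinearMap.id

/-- `F(c + N)` for a nilpotent even superfunction `N` (`N^{n+1} = 0`), as a finite Taylor
expansion of `F` at the real number `c`. -/
def taylorSubst {U : TopologicalSpace.Opens (Bos m)} (F : ℝ → ℝ) (c : ℝ) (N : SuperFun n U) :
    SuperFun n U :=
  ∑ k ∈ Finset.range (n + 1), (iteratedDeriv k F c / (k.factorial : ℝ)) • N ^ k

/-- The even superfunction `(1 - θ² / r²)^{m/2 - 1}`. -/
def weight (m n : ℕ) : SuperFun n (punctured m) :=
  taylorSubst (fun t => t ^ ((m : ℝ) / 2 - 1)) 1 (-SuperFun.tmul (rPow m (-2)) (thetaSq n))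

/-- The Berezin integral `∫_B = π^{-n} ∂_{x̀_{2n}} ⋯ ∂_{x̀_1}` on `Λ_{2n}`. -/
def berezin (n : ℕ) : Grass n →ₗ[ℝ] ℝ :=
  (Real.pi ^ n)⁻¹ • (ExteriorAlgebra.algebraMapInv.toLinearMap ∘ₗ
    (((List.finRange n).reverse.map fun j => grassDeriv (j, 1) * grassDeriv (j, 0)).prod :
      Module.End ℝ (Grass n)))

/-- The Berezin integral on superfunctions, with values in the smooth functions. -/
def berezinFun (n : ℕ) (U : TopologicalSpace.Opens (Bos m)) : SuperFun n U →ₗ[ℝ] Smooth U :=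
  (TensorProduct.rid ℝ (Smooth U)).toLinearMap ∘ₗ TensorProduct.map LinearMap.id (berezin n) ∘ₗ
    (SuperFun.equiv n U).toLinearMap

/-- `∫_{S^{m-1}(L)} F = L^{m-1} ∫_{S^{m-1}} F(L η) dσ(η)` for `F ∈ C^∞(ℝ^m_0)`, with `dσ` the
surface measure on the unit sphere. -/
def sphereIntegral (F : Smooth (punctured m)) (L : posReals) : ℝ :=
  (L : ℝ) ^ (m - 1) *
    ∫ η : Metric.sphere (0 : Bos m) 1, extendZero (punctured m) F.1 ((L : ℝ) • (η : Bos m))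
      ∂(MeasureTheory.volume : MeasureTheory.Measure (Bos m)).toSphere

/-- `∫_{S^{m-1|2n}(L)} f = ∫_{S^{m-1}(L)} ∫_B (1 - θ²/r²)^{m/2-1} φ^♯(f)`. -/
def supersphereIntegral (f : SuperFun n (⊤ : TopologicalSpace.Opens (Bos m)))
    (L : posReals) : ℝ :=
  sphereIntegral (berezinFun n _ (weight m n * phiSharp m n (toPunctured m n f))) L

/-- `L^{-(m-2)} ∫_{S^{m-1}(L)} ∫_B φ^♯(r^{m-2} f)`. -/
def supersphereIntegral' (f : SuperFun n (⊤ : TopologicalSpace.Opens (Bos m)))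
    (L : posReals) : ℝ :=
  (1 / (L : ℝ) ^ ((m : ℤ) - 2)) * sphereIntegral (berezinFun n _
    (phiSharp m n (SuperFun.tmul (rPow m ((m : ℤ) - 2)) 1 * toPunctured m n f))) L

end

end Superspace

end

open scoped TensorProduct ContDiff

noncomputable section

namespace Superspace

/-! ### Integrals depending smoothly on a parameter -/

section ParametricIntegral

open MeasureTheory

variable {P V E F : Type} [MeasurableSpace P]
  [NormedAddCommGroup V] [MeasurableSpace V] [BorelSpace V]
  [NormedAddCommGroup E] [NormedSpace ℝ E] [FiniteDimensional ℝ E]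
  [NormedAddCommGroup F] [NormedSpace ℝ F] [FiniteDimensional ℝ F]

/-! Write `D = ∂/∂r²`, let `M` send `F` to `L ↦ ∫ F(Lη) dσ(η)` over the unit sphere, and let `c_j(b)
= (-1)^j/j! ∫_B θ^{2j} b`. On a product `h ⊗ b` the supersphere integral is `L ∑_j c_j(b)
M(D^j(r^{m-2} h))` (`superInt_tmul`), so the bosonic and the Grassmann variables separate.
Smoothness in `L` is smoothness of parameter integrals (`contDiffOn_integral_param`).

The two formulas agree because `φ^♯` is the exponential of `-θ² D`, cut off where `θ²` becomes
nilpotent. As `D` is a derivation, `φ^♯` is multiplicative in ordinary function factors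
(`phiSharp_tmul_mul`), and it sends `r^{m-2}` to `r^{m-2} (1 - θ²/r²)^{m/2-1}` (`rPow_mul_weight`).

For invariance, `M` kills rotation fields, and its kernel is stable under `D` and under powers of
`r` (`sphereMean_bosRot`, `sphereMean_derivRSq`). The mixed generators are handled by two matching
identities: the divergence theorem `M(r^{m-2} ∂_i g) = 2 M(D(r^{m-2} x_i g))`
(`sphereMean_bosDeriv`) and Berezin integration by parts `c_{j+1}(∂^a b) = 2 c_j(x̀_a b)`
(`berezinCoeff_succ_grassDerivUp`). Together they make the sum over `j` telescope. Compatibility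
with `R²` is a similar cancellation (`superInt_RSq_mul`).

For uniqueness, fix `L` and let `N` be the common kernel of `T[·](L)` and the integral at `L`. It
contains the images of `osp(m|2n)` and of `R² - L²`, and the claim is that `N` has codimension at
most one (`exists_sub_smul_thetaSq_pow_mem`). Since every smooth function is an `∂_i`-derivative,
the mixed generators remove Grassmann letters one at a time, so modulo `N` only ordinary functions
remain (`exists_sub_tmul_one_mem`). For `m ≥ 2` averaging over rotations makes these radial
(`exists_radial_sub_mem`); for `m = 1` the reflection does so. No continuity of `T` is assumed, so
the difference between a function and its average must be an exact finite sum of images of rotation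
fields; the fundamental theorem of calculus along plane rotations supplies it
(`smul_sub_average_mem`).

Put `s = r² - L²`, which acts as `-θ²` modulo `N`, so that `s^{n+1}` times any function lies in `N`.
Repeated division of a radial function by `s` leaves a combination of `1, s, …, s^n`, and
`sphereEq_pow_recursion` reduces these to `s^n`, that is, to `θ^{2n}` up to sign. The supersphere
integral does not vanish on `θ^{2n}` (`superInt_thetaSq_pow`), so `α` is the quotient of the two
values there. -/

theorem stronglyMeasurable_comp_of_continuousOn {ι : P → V} (hι : Measurable ι) {C : Set V}
    (hC : IsCompact C) (hιC : ∀ p, ι p ∈ C) {f : V → F} (hf : ContinuousOn f C) :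
    StronglyMeasurable fun p => f (ι p) := by
  classical
  borelize F
  have h1 : Measurable (C.piecewise f (fun _ => (0 : F))) :=
    hf.measurable_piecewise continuousOn_const hC.isClosed.measurableSet
  have : (fun p => f (ι p)) = (C.piecewise f (fun _ => (0 : F))) ∘ ι := by
    ext p
    simp [Set.piecewise, hιC p]
  rw [this]
  have : ProperSpace F := FiniteDimensional.proper ℝ F
  exact (h1.comp hι).stronglyMeasurable

theorem integrable_comp_of_continuousOn (μ : Measure P) [IsFiniteMeasure μ]
    {ι : P → V} (hι : Measurable ι) {C : Set V}
    (hC : IsCompact C) (hιC : ∀ p, ι p ∈ C) {f : V → F} (hf : ContinuousOn f C) :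
    Integrable (fun p => f (ι p)) μ := by
  obtain ⟨B, hB⟩ := hC.exists_bound_of_continuousOn hf
  exact Integrable.of_bound (stronglyMeasurable_comp_of_continuousOn hι hC hιC hf).aestronglyMeasurable
    B (Filter.Eventually.of_forall fun p => hB _ (hιC p))

variable [NormedSpace ℝ V] (μ : Measure P) [IsFiniteMeasure μ] {ι : P → V} (hι : Measurable ι) {C : Set V}
  (hC : IsCompact C) (hιC : ∀ p, ι p ∈ C) {U : Set E} (hU : IsOpen U) {W : Set (V × E)}
  (hW : IsOpen W) (hCU : C ×ˢ U ⊆ W)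

include hι hC hιC hU hW hCU

/-- The derivative in the parameter is continuous, hence bounded by a constant on the product of `C`
with a small closed ball; a constant dominates because the measure is finite. -/
theorem hasFDerivAt_integral_param {H : V × E → F} (hH : ContDiffOn ℝ 1 H W) {x : E} (hx : x ∈ U) :
    HasFDerivAt (fun x => ∫ p, H (ι p, x) ∂μ)
      (∫ p, (fderiv ℝ H (ι p, x)).comp (ContinuousLinearMap.inr ℝ V E) ∂μ) x := by
  have : ProperSpace E := FiniteDimensional.proper ℝ E
  obtain ⟨ε, hε, hεU⟩ := Metric.nhds_basis_closedBall.mem_iff.1 (hU.mem_nhds hx)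
  have hcd : ContinuousOn (fun z => (fderiv ℝ H z).comp (ContinuousLinearMap.inr ℝ V E)) W :=
    (hH.continuousOn_fderiv_of_isOpen hW le_rfl).clm_comp continuousOn_const
  obtain ⟨B, hB⟩ := (hC.prod (isCompact_closedBall x ε)).exists_bound_of_continuousOn
    (hcd.mono ((Set.prod_mono le_rfl hεU).trans hCU))
  have hslice : ∀ y ∈ U, ContinuousOn (fun v => H (v, y)) C := fun y hy =>
    hH.continuousOn.comp (by fun_prop) fun v hv => hCU ⟨hv, hy⟩
  refine hasFDerivAt_integral_of_dominated_of_fderiv_le (bound := fun _ => B)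
    (F' := fun y p => (fderiv ℝ H (ι p, y)).comp (ContinuousLinearMap.inr ℝ V E))
    (Metric.closedBall_mem_nhds x hε) ?_ ?_ ?_ ?_ (integrable_const _) ?_
  · filter_upwards [hU.mem_nhds hx] with y hy
    exact (stronglyMeasurable_comp_of_continuousOn hι hC hιC (hslice y hy)).aestronglyMeasurable
  · exact integrable_comp_of_continuousOn μ hι hC hιC (hslice x hx)
  · exact (stronglyMeasurable_comp_of_continuousOn hι hC hιC
      (f := fun v => (fderiv ℝ H (v, x)).comp (ContinuousLinearMap.inr ℝ V E))
      (hcd.comp (by fun_prop) fun v hv => hCU ⟨hv, hx⟩)).aestronglyMeasurable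
  · exact Filter.Eventually.of_forall fun p y hy => hB (ι p, y) ⟨hιC p, hy⟩
  · refine Filter.Eventually.of_forall fun p y hy => ?_
    have h1 : HasFDerivAt H (fderiv ℝ H (ι p, y)) (ι p, y) :=
      ((hH.contDiffAt (hW.mem_nhds (hCU ⟨hιC p, hεU hy⟩))).differentiableAt (by simp)).hasFDerivAt
    exact h1.comp y (hasFDerivAt_prodMk_right (ι p) y)

/-- The derivative is again a parameter integral, with values in `E →L[ℝ] F`, so the induction on
the order must let the target space vary. -/
theorem contDiffOn_integral_param {H : V × E → F} (hH : ContDiffOn ℝ ∞ H W) :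
    ContDiffOn ℝ ∞ (fun x => ∫ p, H (ι p, x) ∂μ) U := by
  rw [contDiffOn_infty]
  intro k
  induction k generalizing F with
  | zero =>
    rw [Nat.cast_zero, contDiffOn_zero]
    exact fun x hx => (hasFDerivAt_integral_param μ hι hC hιC hU hW hCU
      (hH.of_le (by simp)) hx).continuousAt.continuousWithinAt
  | succ k ih =>
    have hd := fun x hx => hasFDerivAt_integral_param μ hι hC hιC hU hW hCU
      (hH.of_le (m := 1) (by simp)) (x := x) hx
    rw [Nat.cast_succ, contDiffOn_succ_iff_fderiv_of_isOpen hU]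
    refine ⟨fun x hx => (hd x hx).differentiableAt.differentiableWithinAt, by simp, ?_⟩
    exact (ih (F := E →L[ℝ] F)
      ((hH.fderiv_of_isOpen hW (by simp)).clm_comp contDiffOn_const)).congr
        fun x hx => (hd x hx).fderiv

end ParametricIntegral

/-! ### Smooth functions and their derivatives -/

section SmoothBasic

variable {E : Type*} [NormedAddCommGroup E] [NormedSpace ℝ E] {U : TopologicalSpace.Opens E}

theorem Smooth.mk_apply {f : E → ℝ} (hf : ContDiffOn ℝ ∞ f U) (x : U) :
    (Smooth.mk U f hf).1 x = f x := rfl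

theorem Smooth.extendZero_mk_eventuallyEq {f : E → ℝ} (hf : ContDiffOn ℝ ∞ f U) {x : E}
    (hx : x ∈ U) : extendZero U (Smooth.mk U f hf).1 =ᶠ[nhds x] f := by
  filter_upwards [U.isOpen.mem_nhds hx] with y hy
  exact extendZero_apply U _ ⟨y, hy⟩

theorem Smooth.ext_extendZero {g h : Smooth U}
    (H : ∀ x ∈ U, extendZero U g.1 x = extendZero U h.1 x) : g = h := by
  refine Subtype.ext (funext fun x => ?_)
  rw [← extendZero_apply U g.1 x, ← extendZero_apply U h.1 x]
  exact H x x.2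

theorem extendZero_mul (g h : Smooth U) :
    extendZero U (g * h).1 = fun x => extendZero U g.1 x * extendZero U h.1 x := by
  funext x
  by_cases hx : x ∈ U
  · lift x to U using hx
    simp [extendZero_apply]
  · simp [extendZero, Function.extend_apply', hx]

theorem extendZero_add (g h : Smooth U) :
    extendZero U (g + h).1 = fun x => extendZero U g.1 x + extendZero U h.1 x := by
  funext x
  by_cases hx : x ∈ U
  · lift x to U using hx
    simp [extendZero_apply]
  · simp [extendZero, Function.extend_apply', hx]

theorem extendZero_smul (c : ℝ) (h : Smooth U) :
    extendZero U (c • h).1 = fun x => c * extendZero U h.1 x := by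
  funext x
  by_cases hx : x ∈ U
  · lift x to U using hx
    simp [extendZero_apply]
  · simp [extendZero, Function.extend_apply', hx]

theorem Smooth.deriv_apply (v : E) (h : Smooth U) (x : U) :
    (Smooth.deriv U v h).1 x = fderiv ℝ (extendZero U h.1) x v := rfl

theorem Smooth.deriv_mk_apply (v : E) {f : E → ℝ} (hf : ContDiffOn ℝ ∞ f U) (x : U) :
    (Smooth.deriv U v (Smooth.mk U f hf)).1 x = fderiv ℝ f x v := by
  rw [Smooth.deriv_apply, (Smooth.extendZero_mk_eventuallyEq hf x.2).fderiv_eq]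

theorem Smooth.deriv_mul (v : E) (g h : Smooth U) :
    Smooth.deriv U v (g * h) = Smooth.deriv U v g * h + g * Smooth.deriv U v h := by
  ext x
  have := ((Smooth.hasFDerivAt g x).mul (Smooth.hasFDerivAt h x)).fderiv
  rw [Smooth.deriv_apply, extendZero_mul]
  refine (congrArg (fun D => D v) this).trans ?_
  simp only [Subalgebra.coe_add, Subalgebra.coe_mul, Pi.add_apply, Pi.mul_apply,
    Smooth.deriv_apply, extendZero_apply, add_apply,
    smul_apply, smul_eq_mul]
  ring

theorem Smooth.deriv_one (v : E) : Smooth.deriv U v (1 : Smooth U) = 0 := by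
  have h := Smooth.deriv_mul v (1 : Smooth U) 1
  simpa using h

end SmoothBasic

section Bosonic

variable {m : ℕ} {U : TopologicalSpace.Opens (Bos m)}

theorem bosDeriv_mk_apply (i : Fin m) {f : Bos m → ℝ} (hf : ContDiffOn ℝ ∞ f U) (x : U) :
    (bosDeriv U i (Smooth.mk U f hf)).1 x = fderiv ℝ f x (EuclideanSpace.single i 1) :=
  Smooth.deriv_mk_apply _ hf x

theorem bosDeriv_mul (i : Fin m) (g h : Smooth U) :
    bosDeriv U i (g * h) = bosDeriv U i g * h + g * bosDeriv U i h :=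
  Smooth.deriv_mul _ g h

theorem bosDeriv_bosCoord (i j : Fin m) :
    bosDeriv U i (bosCoord U j) = if i = j then 1 else 0 := by
  ext x
  rw [bosCoord, bosDeriv_mk_apply]
  have : fderiv ℝ (fun x : Bos m => x j) (x : Bos m) =
      (EuclideanSpace.proj j : Bos m →L[ℝ] ℝ) :=
    (EuclideanSpace.proj j : Bos m →L[ℝ] ℝ).fderiv
  rw [this]
  by_cases h : i = j
  · subst h; simp
  · simp [h, Ne.symm h]

/-- The bosonic square `r²`. -/
def bosSq (U : TopologicalSpace.Opens (Bos m)) : Smooth U := ∑ i, bosCoord U i * bosCoord U i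

theorem bosSq_apply (x : U) : (bosSq U).1 x = ‖(x : Bos m)‖ ^ 2 := by
  rw [EuclideanSpace.norm_sq_eq, bosSq]
  rw [AddSubmonoidClass.coe_finsetSum, Finset.sum_apply]
  refine Finset.sum_congr rfl fun i _ => ?_
  simp [bosCoord, Smooth.mk, sq]

theorem bosDeriv_bosSq (i : Fin m) : bosDeriv U i (bosSq U) = (2 : ℝ) • bosCoord U i := by
  simp [bosSq, bosDeriv_mul, bosDeriv_bosCoord, Finset.sum_add_distrib, two_smul]

/-- The rotation field `x_i ∂_j - x_j ∂_i`. -/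
def bosRot (U : TopologicalSpace.Opens (Bos m)) (i j : Fin m) : Module.End ℝ (Smooth U) :=
  LinearMap.mulLeft ℝ (bosCoord U i) * bosDeriv U j -
    LinearMap.mulLeft ℝ (bosCoord U j) * bosDeriv U i

theorem bosRot_apply (i j : Fin m) (h : Smooth U) :
    bosRot U i j h = bosCoord U i * bosDeriv U j h - bosCoord U j * bosDeriv U i h := rfl

end Bosonic

/-! ### Superfunctions as sums of products -/

namespace SuperFun

variable {m n : ℕ} {U V : TopologicalSpace.Opens (Bos m)}

theorem tmul_mul_tmul (f g : Smooth U) (a b : Grass n) :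
    tmul f a * tmul g b = tmul (f * g) (a * b) :=
  Algebra.TensorProduct.tmul_mul_tmul f g a b

theorem map_tmul (D : Smooth U →ₗ[ℝ] Smooth V) (E : Grass n →ₗ[ℝ] Grass n) (f : Smooth U)
    (a : Grass n) : map D E (tmul f a) = tmul (D f) (E a) := rfl

theorem one_def : (1 : SuperFun n U) = tmul 1 1 := rfl

theorem add_tmul (f g : Smooth U) (a : Grass n) : tmul (f + g) a = tmul f a + tmul g a :=
  TensorProduct.add_tmul f g a

theorem tmul_add (f : Smooth U) (a b : Grass n) : tmul f (a + b) = tmul f a + tmul f b :=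
  TensorProduct.tmul_add f a b

theorem smul_tmul (c : ℝ) (f : Smooth U) (a : Grass n) : tmul (c • f) a = c • tmul f a := rfl

theorem tmul_smul (c : ℝ) (f : Smooth U) (a : Grass n) : tmul f (c • a) = c • tmul f a :=
  TensorProduct.tmul_smul c f a

/-- `f ⊗ a` as a bilinear map. -/
def tmulₗ (n : ℕ) (U : TopologicalSpace.Opens (Bos m)) :
    Smooth U →ₗ[ℝ] Grass n →ₗ[ℝ] SuperFun n U :=
  LinearMap.mk₂ ℝ tmul add_tmul smul_tmul tmul_add tmul_smul

theorem sub_tmul (f g : Smooth U) (a : Grass n) : tmul (f - g) a = tmul f a - tmul g a :=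
  TensorProduct.sub_tmul f g a

theorem tmul_zero (f : Smooth U) : tmul f (0 : Grass n) = 0 := TensorProduct.tmul_zero _ f

theorem sum_tmul {ι : Type*} (s : Finset ι) (f : ι → Smooth U) (a : Grass n) :
    tmul (∑ i ∈ s, f i) a = ∑ i ∈ s, tmul (f i) a := TensorProduct.sum_tmul s f a

theorem tmul_sum {ι : Type*} (s : Finset ι) (f : Smooth U) (a : ι → Grass n) :
    tmul f (∑ i ∈ s, a i) = ∑ i ∈ s, tmul f (a i) := TensorProduct.tmul_sum f s a

@[elab_as_elim]
theorem induction {motive : SuperFun n U → Prop} (h0 : motive 0)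
    (ht : ∀ f a, motive (tmul f a)) (ha : ∀ x y, motive x → motive y → motive (x + y))
    (x : SuperFun n U) : motive x :=
  TensorProduct.induction_on (motive := motive) x h0 ht ha

theorem linearMap_ext {M : Type*} [AddCommGroup M] [Module ℝ M] {S T : SuperFun n U →ₗ[ℝ] M}
    (h : ∀ f a, S (tmul f a) = T (tmul f a)) : S = T :=
  TensorProduct.ext' h

end SuperFun

/-! ### The generators of `osp(m|2n)` -/

/-- The inverse of the symplectic block `J`. -/
def symplecticJInv (n : ℕ) : Matrix (FermIdx n) (FermIdx n) ℝ :=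
  Matrix.kronecker (1 : Matrix (Fin n) (Fin n) ℝ) ((2 : ℝ) • !![0, 1; -1, 0])

theorem symplecticJ_mul_inv (n : ℕ) : symplecticJ n * symplecticJInv n = 1 := by
  rw [symplecticJ, symplecticJInv]
  have := Matrix.mul_kronecker_mul (1 : Matrix (Fin n) (Fin n) ℝ) (1 : Matrix (Fin n) (Fin n) ℝ)
    ((1 / 2 : ℝ) • !![0, -1; 1, 0]) ((2 : ℝ) • !![0, 1; -1, 0])
  refine this.symm.trans ?_
  have h2 : ((1 / 2 : ℝ) • !![(0 : ℝ), -1; 1, 0]) * ((2 : ℝ) • !![0, 1; -1, 0]) = 1 := by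
    ext i j
    fin_cases i <;> fin_cases j <;> simp
  rw [h2, one_mul]
  exact Matrix.one_kronecker_one

theorem superMetric_inv (m n : ℕ) :
    (superMetric m n)⁻¹ = Matrix.fromBlocks 1 0 0 (symplecticJInv n) := by
  refine Matrix.inv_eq_right_inv ?_
  rw [superMetric, Matrix.fromBlocks_multiply]
  simp [symplecticJ_mul_inv]

section Generators

variable {m n : ℕ} {U : TopologicalSpace.Opens (Bos m)}

/-- The Grassmann derivative `∂_{X^a}` with raised index. -/
def grassDerivUp (a : FermIdx n) : Grass n →ₗ[ℝ] Grass n :=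
  ∑ c, symplecticJInv n a c • grassDeriv c

theorem partialUp_inl (i : Fin m) (f : Smooth U) (b : Grass n) :
    partialUp U (.inl i) (SuperFun.tmul f b) = SuperFun.tmul (bosDeriv U i f) b := by
  rw [partialUp, superMetric_inv]
  simp [Fintype.sum_sum_type, Matrix.one_apply, partialD, SuperFun.map_tmul]

theorem partialUp_inr (a : FermIdx n) (f : Smooth U) (b : Grass n) :
    partialUp U (.inr a) (SuperFun.tmul f b) = SuperFun.tmul f (grassDerivUp a b) := by
  rw [partialUp, superMetric_inv]
  simp [Fintype.sum_sum_type, partialD, SuperFun.map_tmul, grassDerivUp, SuperFun.tmul_sum,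
    SuperFun.tmul_smul]

theorem ospGen_inl_inl (i j : Fin m) (f : Smooth (⊤ : TopologicalSpace.Opens (Bos m)))
    (b : Grass n) :
    ospGen (.inl i) (.inl j) (SuperFun.tmul f b) = SuperFun.tmul (bosRot ⊤ i j f) b := by
  simp only [ospGen, paritySign, one_smul, LinearMap.sub_apply, Module.End.mul_apply,
    partialUp_inl, LinearMap.mulLeft_apply, coord, SuperFun.tmul_mul_tmul, one_mul, bosRot_apply,
    SuperFun.sub_tmul]

theorem ospGen_inl_inr (i : Fin m) (a : FermIdx n)
    (f : Smooth (⊤ : TopologicalSpace.Opens (Bos m))) (b : Grass n) :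
    ospGen (.inl i) (.inr a) (SuperFun.tmul f b) =
      SuperFun.tmul (bosCoord ⊤ i * f) (grassDerivUp a b) -
        SuperFun.tmul (bosDeriv ⊤ i f) (grassGen a * b) := by
  simp only [ospGen, paritySign, one_smul, LinearMap.sub_apply, Module.End.mul_apply,
    partialUp_inl, partialUp_inr, LinearMap.mulLeft_apply, coord, SuperFun.tmul_mul_tmul, one_mul]

theorem ospGen_inr_inl (i : Fin m) (a : FermIdx n) :
    (ospGen (.inr a) (.inl i) : Module.End ℝ (SuperFun n (⊤ : TopologicalSpace.Opens (Bos m)))) =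
      -ospGen (.inl i) (.inr a) := by
  simp [ospGen, paritySign]

theorem ospGen_inr_inr (a c : FermIdx n)
    (f : Smooth (⊤ : TopologicalSpace.Opens (Bos m))) (b : Grass n) :
    ospGen (.inr a) (.inr c) (SuperFun.tmul f b) =
      SuperFun.tmul f (grassGen a * grassDerivUp c b + grassGen c * grassDerivUp a b) := by
  simp only [ospGen, paritySign, LinearMap.sub_apply, Module.End.mul_apply, LinearMap.smul_apply,
    partialUp_inr, LinearMap.mulLeft_apply, coord, SuperFun.tmul_mul_tmul, one_mul,
    SuperFun.tmul_add]
  simp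

theorem RSq_eq (m n : ℕ) :
    RSq m n = SuperFun.tmul (bosSq ⊤) 1 + SuperFun.tmul 1 (thetaSq n) := by
  simp [RSq, Fintype.sum_sum_type, superMetric, coord, SuperFun.tmul_mul_tmul, Matrix.one_apply,
    bosSq, thetaSq, SuperFun.sum_tmul, SuperFun.tmul_sum, SuperFun.tmul_smul]

end Generators

/-! ### Contractions on the Grassmann algebra -/

section Grassmann

variable {n : ℕ}

/-- Left contraction of `Λ_{2n}` with a covector. -/
def grassContract (d : Module.Dual ℝ (FermIdx n → ℝ)) : Grass n →ₗ[ℝ] Grass n :=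
  CliffordAlgebra.contractLeft d

theorem grassContract_ι_mul (d : Module.Dual ℝ (FermIdx n → ℝ)) (v : FermIdx n → ℝ)
    (b : Grass n) : grassContract d (ExteriorAlgebra.ι ℝ v * b) =
      d v • b - ExteriorAlgebra.ι ℝ v * grassContract d b :=
  CliffordAlgebra.contractLeft_ι_mul _ v b

theorem grassContract_gen_mul (d : Module.Dual ℝ (FermIdx n → ℝ)) (a : FermIdx n)
    (b : Grass n) : grassContract d (grassGen a * b) =
      d (Pi.single a 1) • b - grassGen a * grassContract d b :=
  grassContract_ι_mul d _ b

theorem grassContract_one (d : Module.Dual ℝ (FermIdx n → ℝ)) :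
    grassContract d (1 : Grass n) = 0 :=
  CliffordAlgebra.contractLeft_one _ d

theorem grassContract_self (d : Module.Dual ℝ (FermIdx n → ℝ)) (b : Grass n) :
    grassContract d (grassContract d b) = 0 :=
  CliffordAlgebra.contractLeft_contractLeft d b

theorem grassContract_comm (d d' : Module.Dual ℝ (FermIdx n → ℝ)) (b : Grass n) :
    grassContract d (grassContract d' b) = -grassContract d' (grassContract d b) :=
  CliffordAlgebra.contractLeft_comm d d' b

theorem grassDeriv_eq (a : FermIdx n) : grassDeriv a = grassContract (LinearMap.proj a) := rfl

theorem grassContract_eq_sum (d : Module.Dual ℝ (FermIdx n → ℝ)) :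
    grassContract d = ∑ a, d (Pi.single a 1) • grassDeriv a := by
  have : d = ∑ a, d (Pi.single a 1) • (LinearMap.proj a : (FermIdx n → ℝ) →ₗ[ℝ] ℝ) := by
    refine LinearMap.pi_ext' fun a => LinearMap.ext_ring ?_
    simp [Pi.single_apply]
  conv_lhs => rw [this]
  simp [grassContract, grassDeriv]

/-- The covector whose contraction is the derivative with raised index. -/
def upCovector (a : FermIdx n) : Module.Dual ℝ (FermIdx n → ℝ) :=
  ∑ c, symplecticJInv n a c • LinearMap.proj c

theorem grassDerivUp_eq (a : FermIdx n) : grassDerivUp a = grassContract (upCovector a) := by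
  simp [grassDerivUp, grassContract, upCovector, grassDeriv]

theorem upCovector_single (a c : FermIdx n) :
    upCovector a (Pi.single c 1) = symplecticJInv n a c := by
  simp [upCovector, Pi.single_apply]

theorem grassGen_mul_self (a : FermIdx n) : grassGen a * grassGen a = (0 : Grass n) :=
  ExteriorAlgebra.ι_sq_zero _

theorem grassGen_mul_comm (a b : FermIdx n) :
    (grassGen a * grassGen b : Grass n) = -(grassGen b * grassGen a) :=
  eq_neg_of_add_eq_zero_left (ExteriorAlgebra.ι_add_mul_swap _ _)

theorem ι_eq_sum (v : FermIdx n → ℝ) : ExteriorAlgebra.ι ℝ v = ∑ a, v a • grassGen (n := n) a := by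
  have : v = ∑ a, v a • (Pi.single a 1 : FermIdx n → ℝ) := by
    simpa [← Pi.single_smul] using (Finset.univ_sum_single v).symm
  conv_lhs => rw [this]
  simp [grassGen]

theorem grass_left_induction {p : Submodule ℝ (Grass n)} (h1 : 1 ∈ p)
    (hmul : ∀ a, ∀ b ∈ p, grassGen a * b ∈ p) (b : Grass n) : b ∈ p := by
  induction b using CliffordAlgebra.left_induction with
  | algebraMap r => rw [Algebra.algebraMap_eq_smul_one]; exact p.smul_mem r h1
  | add x y hx hy => exact p.add_mem hx hy
  | ι_mul x v hx =>
    change ExteriorAlgebra.ι ℝ v * x ∈ p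
    rw [ι_eq_sum, Finset.sum_mul]
    exact p.sum_mem fun a _ => by
      rw [smul_mul_assoc]
      exact p.smul_mem _ (hmul a _ hx)

/-! ### Words in the generators -/

/-- The product of a list of generators. -/
def grassWord (l : List (FermIdx n)) : Grass n := (l.map grassGen).prod

theorem grassWord_cons (a : FermIdx n) (l : List (FermIdx n)) :
    grassWord (a :: l) = grassGen a * grassWord l := by
  simp [grassWord]

theorem grassWord_induction {p : Submodule ℝ (Grass n)} (h : ∀ l, grassWord l ∈ p)
    (b : Grass n) : b ∈ p := by
  have : b ∈ Submodule.span ℝ (Set.range (grassWord (n := n))) := by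
    refine grass_left_induction (Submodule.subset_span (Set.mem_range.2 ⟨[], by simp [grassWord]⟩)) ?_ b
    intro a b hb
    refine Submodule.span_induction (p := fun b _ => grassGen a * b ∈ _) ?_ ?_ ?_ ?_ hb
    · rintro _ ⟨l, rfl⟩
      exact Submodule.subset_span ⟨a :: l, grassWord_cons a l⟩
    · simp
    · intro x y _ _ hx hy
      rw [mul_add]
      exact Submodule.add_mem _ hx hy
    · intro r x _ hx
      rw [mul_smul_comm]
      exact Submodule.smul_mem _ _ hx
  exact Submodule.span_le.2 (by rintro _ ⟨l, rfl⟩; exact h l) this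

theorem grassGen_mul_word_eq_zero {a : FermIdx n} {l : List (FermIdx n)} (h : a ∈ l) :
    grassGen a * grassWord l = 0 := by
  induction l with
  | nil => simp at h
  | cons b l ih =>
    rw [grassWord_cons, ← mul_assoc]
    by_cases hab : a = b
    · rw [hab, grassGen_mul_self, zero_mul]
    · have hl : a ∈ l := by simpa [hab] using h
      rw [grassGen_mul_comm, neg_mul, mul_assoc, ih hl, mul_zero, neg_zero]

theorem grassWord_eq_zero {l : List (FermIdx n)} (h : ¬ l.Nodup) : grassWord l = 0 := by
  induction l with
  | nil => simp at h
  | cons a l ih =>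
    rw [grassWord_cons]
    by_cases ha : a ∈ l
    · exact grassGen_mul_word_eq_zero ha
    · rw [ih (by simpa [ha] using h), mul_zero]

theorem grassWord_perm {l l' : List (FermIdx n)} (h : l.Perm l') :
    ∃ c : ℝ, grassWord l = c • grassWord l' := by
  induction h with
  | nil => exact ⟨1, by simp⟩
  | cons a _ ih =>
    obtain ⟨c, hc⟩ := ih
    exact ⟨c, by rw [grassWord_cons, grassWord_cons, hc, mul_smul_comm]⟩
  | swap a b l =>
    refine ⟨-1, ?_⟩
    simp only [grassWord_cons, ← mul_assoc]
    rw [grassGen_mul_comm b a]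
    simp
  | trans _ _ ih1 ih2 =>
    obtain ⟨c, hc⟩ := ih1
    obtain ⟨d, hd⟩ := ih2
    exact ⟨c * d, by rw [hc, hd, smul_smul]⟩

theorem grassDeriv_gen_mul (a c : FermIdx n) (b : Grass n) :
    grassDeriv a (grassGen c * b) = (if a = c then b else 0) - grassGen c * grassDeriv a b := by
  rw [grassDeriv_eq, grassContract_gen_mul]
  by_cases h : a = c
  · subst h; simp
  · simp [h]

theorem grassDeriv_word_eq_zero {a : FermIdx n} {l : List (FermIdx n)} (h : a ∉ l) :
    grassDeriv a (grassWord l) = 0 := by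
  induction l with
  | nil => exact grassContract_one _
  | cons b l ih =>
    simp only [List.mem_cons, not_or] at h
    rw [grassWord_cons, grassDeriv_gen_mul, ih h.2, if_neg h.1, mul_zero, sub_zero]

/-- Modulo derivatives, the Grassmann algebra is spanned by the top monomial. -/
theorem exists_sub_smul_mem_iSup_range_grassDeriv (b : Grass n) :
    ∃ c : ℝ, b - c • grassWord (Finset.univ : Finset (FermIdx n)).toList ∈
      ⨆ a, LinearMap.range (grassDeriv (n := n) a) := by
  have hword : ∀ l : List (FermIdx n), grassWord l ∈
      (ℝ ∙ grassWord (Finset.univ : Finset (FermIdx n)).toList) ⊔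
        ⨆ a, LinearMap.range (grassDeriv (n := n) a) := by
    intro l
    by_cases hl : ∃ a, a ∉ l
    · obtain ⟨a, ha⟩ := hl
      -- A word without the letter `a` is the `a`-derivative of `x̀_a` times itself.
      refine Submodule.mem_sup_right (Submodule.mem_iSup_of_mem a ⟨grassGen a * grassWord l, ?_⟩)
      rw [grassDeriv_gen_mul, if_pos rfl, grassDeriv_word_eq_zero ha, mul_zero, sub_zero]
    · push Not at hl
      by_cases hd : l.Nodup
      · have hp : l.Perm (Finset.univ : Finset (FermIdx n)).toList :=
          (List.perm_ext_iff_of_nodup hd (Finset.nodup_toList _)).2 fun a => by simp [hl a]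
        obtain ⟨c, hc⟩ := grassWord_perm hp
        rw [hc]
        exact Submodule.mem_sup_left (Submodule.smul_mem _ _ (Submodule.mem_span_singleton_self _))
      · rw [grassWord_eq_zero hd]
        exact Submodule.zero_mem _
  obtain ⟨y, hy, z, hz, hyz⟩ := Submodule.mem_sup.1 (grassWord_induction hword b)
  obtain ⟨c, rfl⟩ := Submodule.mem_span_singleton.1 hy
  exact ⟨c, by rw [← hyz]; simpa using hz⟩

/-- Functionals that vanish on derivatives are proportional. -/
theorem mul_eq_mul_of_forall_grassDeriv {φ ψ : Grass n →ₗ[ℝ] ℝ}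
    (hφ : ∀ a b, φ (grassDeriv a b) = 0) (hψ : ∀ a b, ψ (grassDeriv a b) = 0) (b b' : Grass n) :
    φ b * ψ b' = ψ b * φ b' := by
  have key : ∀ χ : Grass n →ₗ[ℝ] ℝ, (∀ a b, χ (grassDeriv a b) = 0) →
      ∀ y ∈ ⨆ a, LinearMap.range (grassDeriv (n := n) a), χ y = 0 := fun χ hχ y hy => by
    have : ⨆ a, LinearMap.range (grassDeriv (n := n) a) ≤ LinearMap.ker χ :=
      iSup_le fun a => by rintro _ ⟨b, rfl⟩; exact hχ a b
    exact this hy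
  obtain ⟨c, hc⟩ := exists_sub_smul_mem_iSup_range_grassDeriv b
  obtain ⟨c', hc'⟩ := exists_sub_smul_mem_iSup_range_grassDeriv b'
  have e1 := key φ hφ _ hc
  have e2 := key φ hφ _ hc'
  have e3 := key ψ hψ _ hc
  have e4 := key ψ hψ _ hc'
  simp only [map_sub, map_smul, smul_eq_mul, sub_eq_zero] at e1 e2 e3 e4
  rw [e1, e2, e3, e4]
  ring

/-! ### The even element `θ²` -/

/-- The product `x̀_{2j-1} x̀_{2j}`. -/
def grassPair (j : Fin n) : Grass n := grassGen (j, 0) * grassGen (j, 1)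

/-- In each block the two off-diagonal entries `∓1/2` of `J` contribute equally, because the two
generators anticommute. -/
theorem thetaSq_eq : thetaSq n = -((List.finRange n).map grassPair).sum := by
  rw [← List.sum_toFinset _ (List.nodup_finRange n), List.toFinset_finRange]
  have h : ∀ a b : FermIdx n, symplecticJ n a b =
      if a.1 = b.1 then ((1 / 2 : ℝ) • !![(0 : ℝ), -1; 1, 0]) a.2 b.2 else 0 := fun a b => by
    have : symplecticJ n a b = (1 : Matrix (Fin n) (Fin n) ℝ) a.1 b.1 *
      ((1 / 2 : ℝ) • !![(0 : ℝ), -1; 1, 0]) a.2 b.2 := rfl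
    rw [this, Matrix.one_apply, ite_mul, one_mul, zero_mul]
  rw [thetaSq, ← Finset.sum_neg_distrib, Fintype.sum_prod_type]
  refine Finset.sum_congr rfl fun j _ => ?_
  simp only [h, Fintype.sum_prod_type, Fin.sum_univ_two]
  simp only [ite_smul, zero_smul, Finset.sum_add_distrib, Finset.sum_ite_eq, Finset.mem_univ,
    if_true]
  simp only [Matrix.smul_apply, Matrix.of_apply, Matrix.cons_val', Matrix.cons_val_zero,
    Matrix.cons_val_one, Matrix.cons_val_fin_one, smul_eq_mul]
  rw [grassGen_mul_comm (j, 1) (j, 0), grassPair]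
  module

theorem grassPair_mul_comm (j : Fin n) (b : Grass n) : grassPair j * b = b * grassPair j := by
  suffices b ∈ LinearMap.ker (LinearMap.mulLeft ℝ (grassPair j) -
      LinearMap.mulRight ℝ (grassPair j)) by
    simpa [sub_eq_zero] using this
  refine grass_left_induction (by simp) (fun a b hb => ?_) b
  have hb' : grassPair j * b = b * grassPair j := by simpa [sub_eq_zero] using hb
  have hc : grassPair j * grassGen a = grassGen a * grassPair j := by
    rw [grassPair, mul_assoc, grassGen_mul_comm (j, 1) a, mul_neg, ← mul_assoc,
      grassGen_mul_comm (j, 0) a, neg_mul, neg_neg, mul_assoc]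
  simp only [LinearMap.mem_ker, LinearMap.sub_apply, LinearMap.mulLeft_apply,
    LinearMap.mulRight_apply]
  rw [← mul_assoc, hc, mul_assoc, hb', mul_assoc, sub_self]

theorem grassPair_mul_self (j : Fin n) : grassPair j * grassPair j = (0 : Grass n) := by
  rw [grassPair, mul_assoc, ← mul_assoc (grassGen (j, 1)), grassGen_mul_comm (j, 1) (j, 0), neg_mul,
    mul_assoc (grassGen (j, 0)), grassGen_mul_self, mul_zero, neg_zero, mul_zero]

theorem sum_grassPair_mul_comm (s : List (Fin n)) (b : Grass n) :
    (s.map grassPair).sum * b = b * (s.map grassPair).sum := by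
  induction s with
  | nil => simp
  | cons j s ih => simp [add_mul, mul_add, ih, grassPair_mul_comm]

theorem thetaSq_mul_comm (b : Grass n) : thetaSq n * b = b * thetaSq n := by
  rw [thetaSq_eq, neg_mul, mul_neg, sum_grassPair_mul_comm]

theorem thetaSq_pow_mul_comm (k : ℕ) (b : Grass n) : thetaSq n ^ k * b = b * thetaSq n ^ k :=
  (Commute.pow_left (thetaSq_mul_comm b) k)

/-- The binomial theorem for commuting elements, where `a² = 0` leaves only two terms. It drives the
induction for the powers of `θ²`, a sum of commuting square-zero pairs. -/
theorem add_pow_succ_of_mul_self_eq_zero {A : Type*} [Ring A] {a w : A} (ha : a * a = 0)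
    (haw : w * a = a * w) (k : ℕ) : (a + w) ^ (k + 1) = w ^ (k + 1) + (k + 1) • (a * w ^ k) := by
  induction k with
  | zero => simp [add_comm]
  | succ k ih =>
    have h1 : w ^ (k + 1) * a = a * w ^ (k + 1) := Commute.pow_left haw _
    have h2 : w ^ k * a = a * w ^ k := Commute.pow_left haw _
    rw [pow_succ, ih, add_mul, mul_add, mul_add, h1, smul_mul_assoc, smul_mul_assoc, mul_assoc a _ a,
      h2, ← mul_assoc a a, ha, zero_mul, smul_zero, zero_add, mul_assoc, ← pow_succ, ← pow_succ,
      succ_nsmul _ (k + 1)]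
    abel

theorem sum_grassPair_pow (s : List (Fin n)) :
    (s.map grassPair).sum ^ s.length = s.length.factorial • (s.map grassPair).prod ∧
      (s.map grassPair).sum ^ (s.length + 1) = 0 := by
  induction s with
  | nil => simp
  | cons j s ih =>
    have h := add_pow_succ_of_mul_self_eq_zero (grassPair_mul_self j)
      (sum_grassPair_mul_comm s (grassPair j))
    simp only [List.map_cons, List.sum_cons, List.length_cons, List.prod_cons]
    refine ⟨?_, ?_⟩
    · rw [h, ih.2, zero_add, ih.1, mul_smul_comm, smul_smul, Nat.factorial_succ]
    · rw [h, ih.2, pow_succ, ih.2, zero_mul, mul_zero, smul_zero, zero_add]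

theorem thetaSq_pow_succ_eq_zero : thetaSq n ^ (n + 1) = 0 := by
  have h := (sum_grassPair_pow (List.finRange n)).2
  rw [List.length_finRange] at h
  rw [thetaSq_eq, neg_pow, h, mul_zero]

theorem thetaSq_pow_eq_zero {k : ℕ} (hk : n < k) : thetaSq n ^ k = 0 :=
  pow_eq_zero_of_le hk thetaSq_pow_succ_eq_zero

theorem thetaSq_pow_eq : thetaSq n ^ n =
    ((-1 : ℝ) ^ n * n.factorial) • ((List.finRange n).map grassPair).prod := by
  have h := (sum_grassPair_pow (List.finRange n)).1
  rw [List.length_finRange] at h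
  rw [thetaSq_eq, ← neg_one_smul ℝ, smul_pow, h, mul_smul, Nat.cast_smul_eq_nsmul]

/-- A contraction is an odd derivation and each pair is even, so the Leibniz rule has no sign in its
second term. -/
theorem grassContract_sum_grassPair_mul (d : Module.Dual ℝ (FermIdx n → ℝ)) (s : List (Fin n))
    (b : Grass n) : grassContract d ((s.map grassPair).sum * b) =
      (s.map fun j => d (Pi.single (j, 0) 1) • grassGen (j, 1) -
        d (Pi.single (j, 1) 1) • grassGen (j, 0)).sum * b +
      (s.map grassPair).sum * grassContract d b := by
  induction s with
  | nil => simp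
  | cons j s ih =>
    simp only [List.map_cons, List.sum_cons, add_mul, map_add, ih]
    rw [grassPair, mul_assoc, grassContract_gen_mul, grassContract_gen_mul, mul_sub, sub_mul,
      smul_mul_assoc, smul_mul_assoc, mul_smul_comm, mul_assoc]
    abel

/-- The Leibniz rule together with `∂^a θ² = 2 x̀_a`, in which the raised index cancels the matrix
`J` in `θ²`. -/
theorem grassDerivUp_thetaSq_mul (a : FermIdx n) (b : Grass n) :
    grassDerivUp a (thetaSq n * b) = (2 : ℝ) • (grassGen a * b) + thetaSq n * grassDerivUp a b := by
  rw [grassDerivUp_eq, thetaSq_eq, neg_mul, map_neg, grassContract_sum_grassPair_mul, neg_add,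
    neg_mul, ← neg_mul, ← smul_mul_assoc]
  congr 2
  rw [← List.sum_toFinset _ (List.nodup_finRange n), List.toFinset_finRange]
  have h : ∀ b : FermIdx n, upCovector a (Pi.single b 1) =
      if a.1 = b.1 then ((2 : ℝ) • !![(0 : ℝ), 1; -1, 0]) a.2 b.2 else 0 := fun b => by
    rw [upCovector_single]
    have : symplecticJInv n a b = (1 : Matrix (Fin n) (Fin n) ℝ) a.1 b.1 *
      ((2 : ℝ) • !![(0 : ℝ), 1; -1, 0]) a.2 b.2 := rfl
    rw [this, Matrix.one_apply, ite_mul, one_mul, zero_mul]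
  simp only [h, ite_smul, zero_smul, Finset.sum_sub_distrib, Finset.sum_ite_eq, Finset.mem_univ,
    if_true]
  obtain ⟨j, e⟩ := a
  fin_cases e <;> simp

theorem grassDerivUp_thetaSq_pow_mul (a : FermIdx n) (k : ℕ) (b : Grass n) :
    grassDerivUp a (thetaSq n ^ (k + 1) * b) =
      (2 * (k + 1) : ℝ) • (thetaSq n ^ k * (grassGen a * b)) +
        thetaSq n ^ (k + 1) * grassDerivUp a b := by
  induction k with
  | zero => simp [grassDerivUp_thetaSq_mul]
  | succ k ih =>
    have h1 : grassGen a * (thetaSq n ^ (k + 1) * b) = thetaSq n ^ (k + 1) * (grassGen a * b) := by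
      rw [← mul_assoc, ← thetaSq_pow_mul_comm, mul_assoc]
    rw [pow_succ', mul_assoc, grassDerivUp_thetaSq_mul, ih, mul_add, mul_smul_comm, h1,
      ← mul_assoc (thetaSq n), ← mul_assoc (thetaSq n), ← pow_succ', ← pow_succ', ← add_assoc,
      ← add_smul]
    congr 2
    push_cast
    ring

/-! ### The Berezin integral -/

theorem grassDeriv_comm_pair (a : FermIdx n) (j : Fin n) :
    (grassDeriv (j, 1) * grassDeriv (j, 0) : Module.End ℝ (Grass n)) * grassDeriv a =
      grassDeriv a * (grassDeriv (j, 1) * grassDeriv (j, 0)) := by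
  refine LinearMap.ext fun b => ?_
  simp only [Module.End.mul_apply, grassDeriv_eq]
  rw [grassContract_comm _ (LinearMap.proj a), map_neg, grassContract_comm _ (LinearMap.proj a),
    neg_neg]

theorem prod_pair_mul_grassDeriv (a : FermIdx n) (s : List (Fin n)) :
    (s.map fun j => (grassDeriv (j, 1) * grassDeriv (j, 0) : Module.End ℝ (Grass n))).prod *
        grassDeriv a =
      grassDeriv a *
        (s.map fun j => (grassDeriv (j, 1) * grassDeriv (j, 0) : Module.End ℝ (Grass n))).prod := by
  induction s with
  | nil => simp
  | cons j s ih => rw [List.map_cons, List.prod_cons, mul_assoc, ih, ← mul_assoc,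
      grassDeriv_comm_pair, mul_assoc]

/-- The product already contains `∂_a`, and Grassmann derivatives anticommute and square to zero.
This is why the Berezin integral kills derivatives. -/
theorem prod_pair_mul_grassDeriv_eq_zero (a : FermIdx n) (s : List (Fin n)) (h : a.1 ∈ s) :
    (s.map fun j => (grassDeriv (j, 1) * grassDeriv (j, 0) : Module.End ℝ (Grass n))).prod *
        grassDeriv a = 0 := by
  induction s with
  | nil => simp at h
  | cons j s ih =>
    rw [List.map_cons, List.prod_cons]
    by_cases hs : a.1 ∈ s
    · rw [mul_assoc, ih hs, mul_zero]
    · have hj : a.1 = j := by simpa [hs] using h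
      rw [mul_assoc, prod_pair_mul_grassDeriv, ← mul_assoc]
      convert zero_mul _
      refine LinearMap.ext fun b => ?_
      obtain ⟨i, e⟩ := a
      simp only at hj
      subst hj
      simp only [Module.End.mul_apply, grassDeriv_eq, LinearMap.zero_apply]
      fin_cases e
      · simp [grassContract_self]
      · rw [grassContract_comm]
        simp [grassContract_self]

theorem berezin_grassDeriv (a : FermIdx n) (b : Grass n) : berezin n (grassDeriv a b) = 0 := by
  have h := prod_pair_mul_grassDeriv_eq_zero a (List.finRange n).reverse (by simp)
  have h' := congrArg (fun D => D b) h
  simp only [Module.End.mul_apply, LinearMap.zero_apply] at h'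
  simp only [berezin, LinearMap.smul_apply, LinearMap.comp_apply, h', map_zero, smul_zero]

theorem berezin_grassContract (d : Module.Dual ℝ (FermIdx n → ℝ)) (b : Grass n) :
    berezin n (grassContract d b) = 0 := by
  rw [grassContract_eq_sum, LinearMap.sum_apply, map_sum]
  exact Finset.sum_eq_zero fun a _ => by
    rw [LinearMap.smul_apply, map_smul, berezin_grassDeriv, smul_zero]

theorem berezin_grassDerivUp (a : FermIdx n) (b : Grass n) : berezin n (grassDerivUp a b) = 0 := by
  rw [grassDerivUp_eq, berezin_grassContract]

theorem grassDeriv_prod_grassPair (a : FermIdx n) (s : List (Fin n)) (h : a.1 ∉ s) :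
    grassDeriv a (s.map grassPair).prod = 0 := by
  induction s with
  | nil => exact grassContract_one _
  | cons j s ih =>
    simp only [List.mem_cons, not_or] at h
    rw [List.map_cons, List.prod_cons, grassPair, mul_assoc, grassDeriv_gen_mul, grassDeriv_gen_mul,
      ih h.2, if_neg (fun e => h.1 (congrArg Prod.fst e)), if_neg (fun e => h.1 (congrArg Prod.fst e))]
    simp

theorem prod_pair_prod_grassPair (s : List (Fin n)) (hs : s.Nodup) :
    (s.reverse.map fun j => (grassDeriv (j, 1) * grassDeriv (j, 0) : Module.End ℝ (Grass n))).prod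
      (s.map grassPair).prod = 1 := by
  induction s with
  | nil => simp
  | cons j s ih =>
    rw [List.nodup_cons] at hs
    have h0 := grassDeriv_prod_grassPair (j, 0) s hs.1
    have h1 := grassDeriv_prod_grassPair (j, 1) s hs.1
    rw [List.reverse_cons, List.map_append, List.prod_append, List.map_cons, List.prod_cons,
      List.map_cons, List.prod_cons, Module.End.mul_apply]
    convert ih hs.2
    simp [grassPair, mul_assoc, grassDeriv_gen_mul, h0, h1]

theorem berezin_thetaSq_pow_ne_zero : berezin n (thetaSq n ^ n) ≠ 0 := by
  have h := prod_pair_prod_grassPair (List.finRange n) (List.nodup_finRange n)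
  rw [thetaSq_pow_eq, map_smul, berezin]
  simp only [LinearMap.smul_apply, LinearMap.comp_apply, h]
  have := Real.pi_ne_zero
  simp [Nat.factorial_ne_zero]

/-! ### Symplectic substitutions -/

theorem grassPullback_ι (B : Matrix (FermIdx n) (FermIdx n) ℝ) (v : FermIdx n → ℝ) :
    grassPullback B (ExteriorAlgebra.ι ℝ v) = ExteriorAlgebra.ι ℝ (Matrix.vecMul v B) :=
  ExteriorAlgebra.map_apply_ι _ _

/-- The chain rule for linear substitutions, with the covector transported along `B`. -/
theorem grassContract_grassPullback (B : Matrix (FermIdx n) (FermIdx n) ℝ)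
    (d : Module.Dual ℝ (FermIdx n → ℝ)) (b : Grass n) :
    grassContract d (grassPullback B b) = grassPullback B (grassContract (d ∘ₗ B.vecMulLinear) b) := by
  induction b using CliffordAlgebra.left_induction with
  | algebraMap r =>
    rw [AlgHom.commutes]
    simp [grassContract, CliffordAlgebra.contractLeft_algebraMap]
  | add x y hx hy => simp only [map_add, hx, hy]
  | ι_mul x v hx =>
    change grassContract d (grassPullback B (ExteriorAlgebra.ι ℝ v * x)) =
      grassPullback B (grassContract _ (ExteriorAlgebra.ι ℝ v * x))
    rw [map_mul, grassPullback_ι, grassContract_ι_mul, grassContract_ι_mul, hx, map_sub, map_smul,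
      map_mul, grassPullback_ι]
    rfl

theorem grassPullback_thetaSq {B : Matrix (FermIdx n) (FermIdx n) ℝ} (hB : B ∈ Sp n) :
    grassPullback B (thetaSq n) = thetaSq n := by
  have hgen : ∀ a, grassPullback B (grassGen a) = ∑ c, B a c • grassGen (n := n) c := fun a => by
    rw [grassGen, grassPullback_ι, ι_eq_sum]
    simp
  have hJ : ∀ c d, symplecticJ n c d = ∑ a, ∑ b, symplecticJ n a b * (B a c * B b d) := by
    intro c d
    have h := congrFun (congrFun hB c) d
    rw [← h, Matrix.mul_apply, Finset.sum_comm]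
    refine Finset.sum_congr rfl fun b _ => ?_
    rw [Matrix.mul_apply, Finset.sum_mul]
    refine Finset.sum_congr rfl fun a _ => ?_
    rw [Matrix.transpose_apply]
    ring
  have hθ : thetaSq n = ∑ c, ∑ d, (∑ a, ∑ b, symplecticJ n a b * (B a c * B b d)) •
      (grassGen (n := n) c * grassGen d) :=
    Finset.sum_congr rfl fun c _ => Finset.sum_congr rfl fun d _ => by rw [← hJ]
  conv_rhs => rw [hθ]
  rw [thetaSq]
  simp only [map_sum, map_smul, map_mul, hgen, Finset.sum_mul, Finset.mul_sum, smul_mul_assoc,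
    mul_smul_comm, Finset.smul_sum, smul_smul, Finset.sum_smul]
  calc _ = ∑ a, ∑ b, ∑ c, ∑ d, (symplecticJ n a b * (B a c * B b d)) •
        (grassGen (n := n) c * grassGen d) := by
        refine Finset.sum_congr rfl fun a _ => Finset.sum_congr rfl fun b _ => ?_
        rw [Finset.sum_comm]
        simp only [mul_comm (B b _)]
    _ = ∑ a, ∑ c, ∑ b, ∑ d, (symplecticJ n a b * (B a c * B b d)) •
        (grassGen (n := n) c * grassGen d) :=
        Finset.sum_congr rfl fun a _ => Finset.sum_comm
    _ = ∑ c, ∑ a, ∑ b, ∑ d, (symplecticJ n a b * (B a c * B b d)) •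
        (grassGen (n := n) c * grassGen d) := Finset.sum_comm
    _ = ∑ c, ∑ a, ∑ d, ∑ b, (symplecticJ n a b * (B a c * B b d)) •
        (grassGen (n := n) c * grassGen d) :=
        Finset.sum_congr rfl fun a _ => Finset.sum_congr rfl fun c _ => Finset.sum_comm
    _ = _ := Finset.sum_congr rfl fun c _ => Finset.sum_comm

theorem Sp.isUnit_det {B : Matrix (FermIdx n) (FermIdx n) ℝ} (hB : B ∈ Sp n) : IsUnit B.det := by
  have hJ : IsUnit (symplecticJ n).det :=
    Matrix.isUnit_det_of_right_inverse (symplecticJ_mul_inv n)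
  have h := congrArg Matrix.det hB
  rw [Matrix.det_mul, Matrix.det_mul] at h
  rw [← h] at hJ
  exact isUnit_of_mul_isUnit_right hJ

theorem Sp.inv_mem {B : Matrix (FermIdx n) (FermIdx n) ℝ} (hB : B ∈ Sp n) : B⁻¹ ∈ Sp n := by
  have hd := Sp.isUnit_det hB
  have hB' : B.transpose * symplecticJ n * B = symplecticJ n := hB
  change B⁻¹.transpose * symplecticJ n * B⁻¹ = symplecticJ n
  conv_lhs => rw [← hB']
  rw [Matrix.mul_assoc, Matrix.mul_assoc, Matrix.mul_nonsing_inv _ hd, Matrix.mul_one,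
    ← Matrix.mul_assoc, ← Matrix.transpose_mul, Matrix.mul_nonsing_inv _ hd, Matrix.transpose_one,
    Matrix.one_mul]

/-- Both sides vanish on derivatives, so they are proportional. The factor is read off at `θ^{2n}`,
which `B` fixes and on which the Berezin integral is nonzero, so `det B = 1` is never needed. -/
theorem berezin_grassPullback {B : Matrix (FermIdx n) (FermIdx n) ℝ} (hB : B ∈ Sp n) (b : Grass n) :
    berezin n (grassPullback B b) = berezin n b := by
  have hd := Sp.isUnit_det hB
  have h := mul_eq_mul_of_forall_grassDeriv (φ := berezin n ∘ₗ (grassPullback B).toLinearMap)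
    (ψ := berezin n) (fun a b => ?_) berezin_grassDeriv b (thetaSq n ^ n)
  · simp only [LinearMap.comp_apply, AlgHom.toLinearMap_apply, map_pow,
      grassPullback_thetaSq hB] at h
    exact mul_right_cancel₀ berezin_thetaSq_pow_ne_zero h
  · have e : (LinearMap.proj a : (FermIdx n → ℝ) →ₗ[ℝ] ℝ) =
        (LinearMap.proj a ∘ₗ B⁻¹.vecMulLinear) ∘ₗ B.vecMulLinear := by
      refine LinearMap.ext fun v => ?_
      simp [Matrix.vecMul_vecMul, Matrix.mul_nonsing_inv _ hd]
    rw [LinearMap.comp_apply, AlgHom.toLinearMap_apply, grassDeriv_eq, e,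
      ← grassContract_grassPullback, berezin_grassContract]

end Grassmann

/-! ### Directional derivatives under the integral sign -/

section ParametricDerivative

open MeasureTheory

variable {P V E F : Type} [MeasurableSpace P]
  [NormedAddCommGroup V] [NormedSpace ℝ V] [MeasurableSpace V] [BorelSpace V]
  [NormedAddCommGroup E] [NormedSpace ℝ E] [FiniteDimensional ℝ E]
  [NormedAddCommGroup F] [NormedSpace ℝ F] [FiniteDimensional ℝ F]

theorem fderiv_integral_param_apply (μ : Measure P) [IsFiniteMeasure μ] {ι : P → V}
    (hι : Measurable ι) {C : Set V} (hC : IsCompact C) (hιC : ∀ p, ι p ∈ C) {U : Set E}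
    (hU : IsOpen U) {W : Set (V × E)} (hW : IsOpen W) (hCU : C ×ˢ U ⊆ W) {H : V × E → F}
    (hH : ContDiffOn ℝ 1 H W) {x : E} (hx : x ∈ U) (v : E) :
    fderiv ℝ (fun x => ∫ p, H (ι p, x) ∂μ) x v =
      ∫ p, fderiv ℝ (fun y => H (ι p, y)) x v ∂μ := by
  rw [(hasFDerivAt_integral_param μ hι hC hιC hU hW hCU hH hx).fderiv,
    ContinuousLinearMap.integral_apply]
  · refine integral_congr_ae (Filter.Eventually.of_forall fun p => ?_)
    have h1 : HasFDerivAt H (fderiv ℝ H (ι p, x)) (ι p, x) :=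
      ((hH.contDiffAt (hW.mem_nhds (hCU ⟨hιC p, hx⟩))).differentiableAt (by simp)).hasFDerivAt
    have h2 : HasFDerivAt (fun y => H (ι p, y)) _ x := h1.comp x (hasFDerivAt_prodMk_right (ι p) x)
    simp only [h2.fderiv]
  · have hcd : ContinuousOn (fun z => (fderiv ℝ H z).comp (ContinuousLinearMap.inr ℝ V E)) W :=
      (hH.continuousOn_fderiv_of_isOpen hW le_rfl).clm_comp continuousOn_const
    exact integrable_comp_of_continuousOn μ hι hC hιC
      (f := fun v => (fderiv ℝ H (v, x)).comp (ContinuousLinearMap.inr ℝ V E))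
      (hcd.comp (by fun_prop) fun v hv => hCU ⟨hv, hx⟩)

end ParametricDerivative

/-! ### Rotations in a plane -/

section PlaneRot

variable {X : Type*} [NormedAddCommGroup X] [InnerProductSpace ℝ X]

open scoped InnerProductSpace

/-- The rotation by the angle `θ` in the plane spanned by the orthonormal vectors `e`, `w`. -/
def planeRot (e w : X) (θ : ℝ) : X →ₗ[ℝ] X :=
  LinearMap.id + (Real.cos θ - 1) • ((innerₛₗ ℝ e).smulRight e + (innerₛₗ ℝ w).smulRight w) +
    Real.sin θ • ((innerₛₗ ℝ e).smulRight w - (innerₛₗ ℝ w).smulRight e)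

theorem planeRot_apply (e w : X) (θ : ℝ) (x : X) :
    planeRot e w θ x = x + (Real.cos θ - 1) • (⟪e, x⟫_ℝ • e + ⟪w, x⟫_ℝ • w) +
      Real.sin θ • (⟪e, x⟫_ℝ • w - ⟪w, x⟫_ℝ • e) := rfl

theorem planeRot_zero (e w x : X) : planeRot e w 0 x = x := by
  simp [planeRot_apply]

variable {e w : X} (he : ‖e‖ = 1) (hw : ‖w‖ = 1) (hew : ⟪e, w⟫_ℝ = 0)

include he hew in
theorem inner_left_planeRot (θ : ℝ) (x : X) :
    ⟪e, planeRot e w θ x⟫_ℝ = Real.cos θ * ⟪e, x⟫_ℝ - Real.sin θ * ⟪w, x⟫_ℝ := by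
  simp only [planeRot_apply, inner_add_right, inner_smul_right, inner_sub_right, hew,
    real_inner_self_eq_norm_sq, he]
  ring

include hw hew in
theorem inner_right_planeRot (θ : ℝ) (x : X) :
    ⟪w, planeRot e w θ x⟫_ℝ = Real.sin θ * ⟪e, x⟫_ℝ + Real.cos θ * ⟪w, x⟫_ℝ := by
  have hwe : ⟪w, e⟫_ℝ = 0 := by rw [real_inner_comm, hew]
  simp only [planeRot_apply, inner_add_right, inner_smul_right, inner_sub_right, hwe,
    real_inner_self_eq_norm_sq, hw]
  ring

include he hw hew in
theorem planeRot_planeRot (θ φ : ℝ) (x : X) :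
    planeRot e w θ (planeRot e w φ x) = planeRot e w (θ + φ) x := by
  rw [planeRot_apply e w θ, inner_left_planeRot he hew, inner_right_planeRot hw hew,
    planeRot_apply e w φ, planeRot_apply e w (θ + φ), Real.cos_add, Real.sin_add]
  module

include he hw hew in
theorem norm_planeRot (θ : ℝ) (x : X) : ‖planeRot e w θ x‖ = ‖x‖ := by
  have key : ‖planeRot e w θ x‖ ^ 2 = ‖x‖ ^ 2 := by
    have hx : ⟪x, planeRot e w θ x⟫_ℝ =
        ‖x‖ ^ 2 + (Real.cos θ - 1) * (⟪e, x⟫_ℝ ^ 2 + ⟪w, x⟫_ℝ ^ 2) := by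
      simp only [planeRot_apply, inner_add_right, inner_smul_right, inner_sub_right,
        real_inner_self_eq_norm_sq, real_inner_comm e x, real_inner_comm w x]
      ring
    rw [← real_inner_self_eq_norm_sq (planeRot e w θ x)]
    conv_lhs => arg 2; rw [planeRot_apply]
    simp only [inner_add_left, inner_smul_left, inner_sub_left, hx, inner_left_planeRot he hew,
      inner_right_planeRot hw hew, RCLike.conj_to_real]
    nlinarith [Real.sin_sq_add_cos_sq θ]
  exact (sq_eq_sq₀ (norm_nonneg _) (norm_nonneg _)).1 key

theorem hasDerivAt_planeRot_zero (x : X) :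
    HasDerivAt (fun θ => planeRot e w θ x) (⟪e, x⟫_ℝ • w - ⟪w, x⟫_ℝ • e) 0 := by
  simp only [planeRot_apply]
  have h1 := ((Real.hasDerivAt_cos 0).sub_const 1).smul_const (⟪e, x⟫_ℝ • e + ⟪w, x⟫_ℝ • w)
  have h2 := (Real.hasDerivAt_sin 0).smul_const (⟪e, x⟫_ℝ • w - ⟪w, x⟫_ℝ • e)
  exact ((h1.const_add x).add h2).congr_deriv (by simp)

/-- Plane rotations depend smoothly on all data. -/
theorem contDiff_planeRot {Y : Type*} [NormedAddCommGroup Y] [NormedSpace ℝ Y] {e w x : Y → X}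
    {θ : Y → ℝ} (he : ContDiff ℝ ∞ e) (hw : ContDiff ℝ ∞ w) (hθ : ContDiff ℝ ∞ θ)
    (hx : ContDiff ℝ ∞ x) : ContDiff ℝ ∞ fun y => planeRot (e y) (w y) (θ y) (x y) := by
  simp only [planeRot_apply]
  have h1 := he.inner ℝ hx
  have h2 := hw.inner ℝ hx
  fun_prop

include he hw hew in
-- The rotation commutes with its generator, so the velocity can be written as the rotation applied
-- to the generator at the starting point. In this form it becomes a vector field acting on the
-- rotated function.
theorem hasDerivAt_planeRot (θ : ℝ) (x : X) :
    HasDerivAt (fun θ => planeRot e w θ x) (planeRot e w θ (⟪e, x⟫_ℝ • w - ⟪w, x⟫_ℝ • e)) θ := by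
  simp only [planeRot_apply]
  have h1 := ((Real.hasDerivAt_cos θ).sub_const 1).smul_const (⟪e, x⟫_ℝ • e + ⟪w, x⟫_ℝ • w)
  have h2 := (Real.hasDerivAt_sin θ).smul_const (⟪e, x⟫_ℝ • w - ⟪w, x⟫_ℝ • e)
  refine ((h1.const_add x).add h2).congr_deriv ?_
  have hwe : ⟪w, e⟫_ℝ = 0 := by rw [real_inner_comm, hew]
  simp only [inner_sub_right, inner_smul_right, hew, hwe, real_inner_self_eq_norm_sq, he, hw]
  module

/-- The rotation in a plane as a linear isometry. -/
def planeRotIsometry (he : ‖e‖ = 1) (hw : ‖w‖ = 1) (hew : ⟪e, w⟫_ℝ = 0) (θ : ℝ) : X ≃ₗᵢ[ℝ] X where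
  toFun := planeRot e w θ
  map_add' := map_add _
  map_smul' := map_smul _
  invFun := planeRot e w (-θ)
  left_inv x := by rw [planeRot_planeRot he hw hew, neg_add_cancel, planeRot_zero]
  right_inv x := by rw [planeRot_planeRot he hw hew, add_neg_cancel, planeRot_zero]
  norm_map' := norm_planeRot he hw hew θ

end PlaneRot

/-! ### Integration over spheres -/

section Sphere

open MeasureTheory

variable {m : ℕ}

/-- A linear isometry acting on the unit sphere. -/
def sphereMap (e : Bos m ≃ₗᵢ[ℝ] Bos m) (η : Metric.sphere (0 : Bos m) 1) :
    Metric.sphere (0 : Bos m) 1 := ⟨e η, by simp⟩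

theorem continuous_sphereMap (e : Bos m ≃ₗᵢ[ℝ] Bos m) : Continuous (sphereMap e) :=
  (e.continuous.comp continuous_subtype_val).subtype_mk _

open scoped Pointwise in
-- The surface measure of a set is a multiple of the volume of the cone over it, and a linear
-- isometry maps cones to cones and preserves volume.
theorem measurePreserving_sphereMap (e : Bos m ≃ₗᵢ[ℝ] Bos m) :
    MeasurePreserving (sphereMap e) (volume : Measure (Bos m)).toSphere
      (volume : Measure (Bos m)).toSphere := by
  refine ⟨(continuous_sphereMap e).measurable, ?_⟩
  ext s hs
  rw [Measure.map_apply (continuous_sphereMap e).measurable hs,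
    Measure.toSphere_apply' _ ((continuous_sphereMap e).measurable hs), Measure.toSphere_apply' _ hs]
  congr 1
  have : (Set.Ioo (0 : ℝ) 1 • (Subtype.val '' (sphereMap e ⁻¹' s)) : Set (Bos m)) =
      e ⁻¹' (Set.Ioo (0 : ℝ) 1 • (Subtype.val '' s) : Set (Bos m)) := by
    ext x
    simp only [Set.mem_smul, Set.mem_preimage, Set.mem_image]
    constructor
    · rintro ⟨t, ht, _, ⟨η, hη, rfl⟩, rfl⟩
      exact ⟨t, ht, e η, ⟨sphereMap e η, hη, rfl⟩, by simp⟩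
    · rintro ⟨t, ht, _, ⟨η, hη, rfl⟩, h⟩
      refine ⟨t, ht, e.symm η, ⟨sphereMap e.symm η, ?_, rfl⟩, ?_⟩
      · convert hη
        exact Subtype.ext (e.apply_symm_apply _)
      · rw [← map_smul, h, e.symm_apply_apply]
  rw [this]
  exact e.measurePreserving.measure_preimage_equiv (f := e.toHomeomorph.toMeasurableEquiv) _

theorem integral_sphere_comp_isometry (e : Bos m ≃ₗᵢ[ℝ] Bos m) (g : Bos m → ℝ) :
    ∫ η : Metric.sphere (0 : Bos m) 1, g (e η) ∂(volume : Measure (Bos m)).toSphere =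
      ∫ η : Metric.sphere (0 : Bos m) 1, g η ∂(volume : Measure (Bos m)).toSphere := by
  have he : MeasurableEmbedding (sphereMap e) :=
    ((continuous_sphereMap e).isClosedEmbedding fun x y h =>
      Subtype.ext (e.injective (congrArg Subtype.val h))).measurableEmbedding
  exact (measurePreserving_sphereMap e).integral_comp he fun η => g η

theorem ne_zero_of_mem_sphere_one {v : Bos m} (hv : v ∈ Metric.sphere (0 : Bos m) 1) : v ≠ 0 := by
  rintro rfl
  simp at hv

theorem Smooth.contDiffOn_smul (F : Smooth (punctured m)) :
    ContDiffOn ℝ ∞ (fun z : Bos m × ℝ => extendZero (punctured m) F.1 (z.2 • z.1))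
      {z : Bos m × ℝ | z.2 • z.1 ≠ 0} :=
  F.2.comp (by fun_prop) fun _ hz => hz

/-- The function `L ↦ ∫_{S^{m-1}} F(L η) dσ(η)`. -/
def sphereMean (m : ℕ) : Smooth (punctured m) →ₗ[ℝ] Smooth posReals where
  toFun F := Smooth.mk posReals
    (fun L => ∫ η : Metric.sphere (0 : Bos m) 1, extendZero (punctured m) F.1 (L • (η : Bos m))
      ∂(volume : Measure (Bos m)).toSphere)
    (contDiffOn_integral_param _ (ι := ((↑) : Metric.sphere (0 : Bos m) 1 → Bos m))
      measurable_subtype_coe (isCompact_sphere 0 1) (fun p => p.2) posReals.isOpen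
      (W := {z : Bos m × ℝ | z.2 • z.1 ≠ 0}) (isOpen_ne_fun (by fun_prop) (by fun_prop))
      (fun z hz => smul_ne_zero (ne_of_gt hz.2) (ne_zero_of_mem_sphere_one hz.1))
      (H := fun z => extendZero (punctured m) F.1 (z.2 • z.1))
      (Smooth.contDiffOn_smul F))
  map_add' F G := by
    ext L
    simp only [Smooth.mk_apply, Subalgebra.coe_add, Pi.add_apply]
    rw [← integral_add]
    · simp only [← Subalgebra.coe_add, extendZero_add]
    all_goals
      refine integrable_comp_of_continuousOn _ measurable_subtype_coe (isCompact_sphere 0 1)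
        (fun p => p.2) (f := fun v => extendZero (punctured m) _ ((L : ℝ) • v)) ?_
      refine (Subtype.property (_ : Smooth (punctured m))).continuousOn.comp (by fun_prop)
        fun v hv => smul_ne_zero (ne_of_gt L.2) (ne_zero_of_mem_sphere_one hv)
  map_smul' c F := by
    ext L
    simp only [Smooth.mk_apply, extendZero_smul, integral_const_mul]
    rfl

theorem sphereMean_apply (F : Smooth (punctured m)) (L : posReals) :
    (sphereMean m F).1 L = ∫ η : Metric.sphere (0 : Bos m) 1,
      extendZero (punctured m) F.1 ((L : ℝ) • (η : Bos m)) ∂(volume : Measure (Bos m)).toSphere := rfl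

theorem rPow_apply (p : ℤ) (x : punctured m) : (rPow m p).1 x = ‖(x : Bos m)‖ ^ p := rfl

theorem sphereMean_rPow_mul (p : ℤ) (F : Smooth (punctured m)) (L : posReals) :
    (sphereMean m (rPow m p * F)).1 L = (L : ℝ) ^ p * (sphereMean m F).1 L := by
  rw [sphereMean_apply, sphereMean_apply, ← integral_const_mul]
  refine integral_congr_ae (Filter.Eventually.of_forall fun η => ?_)
  have hL : (0 : ℝ) < L := L.2
  have hx : (L : ℝ) • (η : Bos m) ∈ (punctured m : Set (Bos m)) :=
    smul_ne_zero hL.ne' (ne_zero_of_mem_sphere_one η.2)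
  have h1 := extendZero_apply (punctured m) (rPow m p).1 ⟨_, hx⟩
  simp only [extendZero_mul]
  rw [h1, rPow_apply, norm_smul, norm_eq_of_mem_sphere η, mul_one, Real.norm_of_nonneg hL.le]

theorem sum_bosCoord_mul_bosDeriv_apply {U : TopologicalSpace.Opens (Bos m)} (F : Smooth U) (x : U) :
    (∑ i, bosCoord U i * bosDeriv U i F).1 x = fderiv ℝ (extendZero U F.1) x x := by
  have hx : (x : Bos m) = ∑ i, (x : Bos m) i • EuclideanSpace.single i (1 : ℝ) := by
    ext j
    simp [Finset.sum_apply, Pi.single_apply]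
  conv_rhs => rw [hx, map_sum]
  rw [AddSubmonoidClass.coe_finsetSum, Finset.sum_apply, ← hx]
  refine Finset.sum_congr rfl fun i _ => ?_
  rw [map_smul]
  rfl

theorem derivRSq_eq (F : Smooth (punctured m)) : derivRSq m F = (1 / 2 : ℝ) •
    (rPow m (-2) * ∑ i, bosCoord (punctured m) i * bosDeriv (punctured m) i F) := by
  simp [derivRSq, Finset.mul_sum]

/-- On the sphere of radius `L` the Euler field is `L d/dL`, and a mean that vanishes for every
radius has vanishing derivative. -/
theorem sphereMean_derivRSq {F : Smooth (punctured m)} (hF : sphereMean m F = 0) :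
    sphereMean m (derivRSq m F) = 0 := by
  ext L
  have hL : (0 : ℝ) < L := L.2
  rw [derivRSq_eq, map_smul]
  suffices h : (sphereMean m (∑ i, bosCoord (punctured m) i * bosDeriv (punctured m) i F)).1 L = 0 by
    have h2 := sphereMean_rPow_mul (-2)
      (∑ i, bosCoord (punctured m) i * bosDeriv (punctured m) i F) L
    rw [h, mul_zero] at h2
    simp only [SetLike.val_smul, Pi.smul_apply, h2, smul_zero]
    rfl
  -- The mean is differentiated at `L` in the direction `L`, which produces the Euler field without
  -- a further factor.
  have hd := fderiv_integral_param_apply (volume : Measure (Bos m)).toSphere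
    (ι := ((↑) : Metric.sphere (0 : Bos m) 1 → Bos m))
      measurable_subtype_coe (isCompact_sphere 0 1) (fun p => p.2) posReals.isOpen
      (W := {z : Bos m × ℝ | z.2 • z.1 ≠ 0}) (isOpen_ne_fun (by fun_prop) (by fun_prop))
      (fun z hz => smul_ne_zero (ne_of_gt hz.2) (ne_zero_of_mem_sphere_one hz.1))
      (H := fun z => extendZero (punctured m) F.1 (z.2 • z.1))
      ((Smooth.contDiffOn_smul F).of_le (by simp)) L.2 (L : ℝ)
  have h0 : (fun x : ℝ => ∫ η : Metric.sphere (0 : Bos m) 1,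
      extendZero (punctured m) F.1 (x • (η : Bos m)) ∂(volume : Measure (Bos m)).toSphere)
      =ᶠ[nhds (L : ℝ)] fun _ => 0 := by
    filter_upwards [posReals.isOpen.mem_nhds L.2] with x hx
    exact congrFun (congrArg Subtype.val hF) ⟨x, hx⟩
  rw [h0.fderiv_eq, fderiv_const_apply, zero_apply] at hd
  rw [sphereMean_apply, hd]
  refine integral_congr_ae (Filter.Eventually.of_forall fun η => ?_)
  have hx : (L : ℝ) • (η : Bos m) ∈ (punctured m : Set (Bos m)) :=
    smul_ne_zero hL.ne' (ne_zero_of_mem_sphere_one η.2)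
  have h1 := extendZero_apply (punctured m)
    (∑ i, bosCoord (punctured m) i * bosDeriv (punctured m) i F).1 ⟨_, hx⟩
  simp only at h1 ⊢
  rw [h1, sum_bosCoord_mul_bosDeriv_apply]
  have h2 : HasFDerivAt (fun y : ℝ => y • (η : Bos m))
      ((ContinuousLinearMap.id ℝ ℝ).smulRight (η : Bos m)) (L : ℝ) :=
    (hasFDerivAt_id (L : ℝ)).smul_const _
  have h3 := ((Smooth.hasFDerivAt F ⟨_, hx⟩).comp (L : ℝ) h2).fderiv
  simp only [Function.comp_def] at h3
  rw [h3]
  simp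

theorem sphereMean_derivRSq_pow {F : Smooth (punctured m)} (hF : sphereMean m F = 0) (k : ℕ) :
    sphereMean m ((derivRSq m ^ k) F) = 0 := by
  induction k with
  | zero => simpa using hF
  | succ k ih => rw [pow_succ', Module.End.mul_apply]; exact sphereMean_derivRSq ih

theorem bosRot_apply_point {U : TopologicalSpace.Opens (Bos m)} (i j : Fin m) (F : Smooth U)
    (x : U) : (bosRot U i j F).1 x = fderiv ℝ (extendZero U F.1) x
      ((x : Bos m) i • EuclideanSpace.single j 1 - (x : Bos m) j • EuclideanSpace.single i 1) := by
  rw [map_sub, map_smul, map_smul]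
  rfl

/-- The mean of the rotated function does not depend on the angle; its derivative at angle zero is
the mean of the rotation field applied to `F`. -/
theorem sphereMean_bosRot (i j : Fin m) (F : Smooth (punctured m)) :
    sphereMean m (bosRot (punctured m) i j F) = 0 := by
  by_cases hij : i = j
  · subst hij
    simp [bosRot]
  ext L
  have hL : (0 : ℝ) < L := L.2
  set e : Bos m := EuclideanSpace.single i 1
  set w : Bos m := EuclideanSpace.single j 1
  have he : ‖e‖ = 1 := by simp [e]
  have hw : ‖w‖ = 1 := by simp [w]
  have hew : inner ℝ e w = 0 := by
    simp [e, w, EuclideanSpace.inner_single_left, hij]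
  have hin : ∀ x : Bos m, inner ℝ e x = x i ∧ inner ℝ w x = x j := fun x => by
    simp [e, w, EuclideanSpace.inner_single_left]
  have hne : ∀ (v : Bos m) (θ : ℝ), v ≠ 0 → (L : ℝ) • planeRot e w θ v ≠ 0 := fun v θ hv =>
    smul_ne_zero hL.ne' fun h => hv (norm_eq_zero.1 (by rw [← norm_planeRot he hw hew θ, h, norm_zero]))
  have hsm : ContDiff ℝ ∞ fun z : Bos m × ℝ => (L : ℝ) • planeRot e w z.2 z.1 :=
    (contDiff_planeRot contDiff_const contDiff_const contDiff_snd contDiff_fst).const_smul _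
  have hd := fderiv_integral_param_apply (volume : Measure (Bos m)).toSphere
    (ι := ((↑) : Metric.sphere (0 : Bos m) 1 → Bos m))
      measurable_subtype_coe (isCompact_sphere 0 1) (fun p => p.2) (isOpen_univ (X := ℝ))
      (W := {z : Bos m × ℝ | z.1 ≠ 0}) (isOpen_ne_fun (by fun_prop) (by fun_prop))
      (fun z hz => ne_zero_of_mem_sphere_one hz.1)
      (H := fun z => extendZero (punctured m) F.1 ((L : ℝ) • planeRot e w z.2 z.1))
      ((F.2.comp hsm.contDiffOn fun z hz => hne z.1 z.2 hz).of_le (by simp)) (Set.mem_univ 0) 1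
  have h0 : (fun x : ℝ => ∫ η : Metric.sphere (0 : Bos m) 1,
      extendZero (punctured m) F.1 ((L : ℝ) • planeRot e w x (η : Bos m))
        ∂(volume : Measure (Bos m)).toSphere) =
      fun _ => ∫ η : Metric.sphere (0 : Bos m) 1,
        extendZero (punctured m) F.1 ((L : ℝ) • (η : Bos m))
          ∂(volume : Measure (Bos m)).toSphere := by
    funext θ
    exact integral_sphere_comp_isometry (planeRotIsometry he hw hew θ)
      fun x => extendZero (punctured m) F.1 ((L : ℝ) • x)
  rw [h0, fderiv_const_apply, zero_apply] at hd
  rw [sphereMean_apply]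
  refine Eq.trans ?_ hd.symm
  refine integral_congr_ae (Filter.Eventually.of_forall fun η => ?_)
  have hx : (L : ℝ) • (η : Bos m) ∈ (punctured m : Set (Bos m)) :=
    smul_ne_zero hL.ne' (ne_zero_of_mem_sphere_one η.2)
  have h1 := extendZero_apply (punctured m) (bosRot (punctured m) i j F).1 ⟨_, hx⟩
  simp only at h1 ⊢
  rw [h1, bosRot_apply_point]
  have h2 : HasDerivAt (fun θ : ℝ => (L : ℝ) • planeRot e w θ (η : Bos m)) _ 0 :=
    (hasDerivAt_planeRot_zero (e := e) (w := w) (η : Bos m)).const_smul (L : ℝ)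
  have h4 : HasFDerivAt (extendZero (punctured m) F.1)
      (fderiv ℝ (extendZero (punctured m) F.1) ((L : ℝ) • (η : Bos m)))
      ((L : ℝ) • planeRot e w 0 (η : Bos m)) := by
    rw [planeRot_zero]
    exact Smooth.hasFDerivAt F ⟨_, hx⟩
  have h3 := (h4.comp_hasDerivAt 0 h2).deriv
  rw [Function.comp_def] at h3
  rw [fderiv_apply_one_eq_deriv, h3, (hin _).1, (hin _).2]
  congr 1
  simp [smul_sub, smul_smul, e, w]

end Sphere

/-! ### Powers of the radius -/

section Radius

variable {m : ℕ}

theorem rPow_mul (p q : ℤ) : rPow m p * rPow m q = rPow m (p + q) := by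
  ext x
  exact (zpow_add₀ (norm_ne_zero_iff.2 x.2) p q).symm

theorem rPow_zero : rPow m 0 = 1 := by
  ext x
  exact zpow_zero _

theorem rPow_two : rPow m 2 = bosSq (punctured m) := by
  ext x
  rw [bosSq_apply, rPow_apply]
  norm_cast

theorem sum_bosCoord_mul_self {U : TopologicalSpace.Opens (Bos m)} :
    ∑ i, bosCoord U i * bosCoord U i = bosSq U := rfl

theorem bosDeriv_rPow_one (i : Fin m) :
    bosDeriv (punctured m) i (rPow m 1) = bosCoord (punctured m) i * rPow m (-1) := by
  have h1 : bosDeriv (punctured m) i (rPow m 1 * rPow m 1) =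
      (2 : ℝ) • bosCoord (punctured m) i := by
    rw [rPow_mul, ← bosDeriv_bosSq, ← rPow_two]
    norm_num
  rw [bosDeriv_mul, mul_comm (bosDeriv _ i _), ← two_smul ℝ] at h1
  have h2 : rPow m 1 * bosDeriv (punctured m) i (rPow m 1) = bosCoord (punctured m) i :=
    smul_right_injective _ (two_ne_zero' ℝ) h1
  rw [← h2, mul_right_comm, rPow_mul, add_neg_cancel, rPow_zero, one_mul]

theorem bosDeriv_rPow_neg_one (i : Fin m) :
    bosDeriv (punctured m) i (rPow m (-1)) =
      (-1 : ℝ) • (bosCoord (punctured m) i * rPow m (-3)) := by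
  have h1 : bosDeriv (punctured m) i (rPow m (-1) * rPow m 1) = 0 := by
    rw [rPow_mul, neg_add_cancel, rPow_zero]
    exact Smooth.deriv_one _
  rw [bosDeriv_mul, bosDeriv_rPow_one] at h1
  have h2 : rPow m 1 * rPow m (-1) = 1 := by rw [rPow_mul, add_neg_cancel, rPow_zero]
  have h3 : rPow m (-3) = rPow m (-1) * rPow m (-1) * rPow m (-1) := by
    rw [rPow_mul, rPow_mul]
    norm_num
  rw [neg_one_smul, h3]
  linear_combination rPow m (-1) * h1 - bosDeriv (punctured m) i (rPow m (-1)) * h2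

theorem bosDeriv_rPow (i : Fin m) (p : ℤ) :
    bosDeriv (punctured m) i (rPow m p) =
      (p : ℝ) • (bosCoord (punctured m) i * rPow m (p - 2)) := by
  induction p using Int.induction_on with
  | zero =>
    rw [rPow_zero, Int.cast_zero, zero_smul]
    exact Smooth.deriv_one _
  | succ k ih =>
    rw [← rPow_mul, bosDeriv_mul, ih, bosDeriv_rPow_one, smul_mul_assoc, mul_assoc, rPow_mul,
      mul_left_comm, rPow_mul, show (k : ℤ) - 2 + 1 = k + 1 - 2 by ring,
      show (k : ℤ) + -1 = k + 1 - 2 by ring]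
    push_cast
    module
  | pred k ih =>
    rw [sub_eq_add_neg (-(k : ℤ)) 1, ← rPow_mul, bosDeriv_mul, ih, bosDeriv_rPow_neg_one,
      smul_mul_assoc, mul_assoc, rPow_mul, mul_smul_comm, mul_left_comm, rPow_mul,
      show -(k : ℤ) - 2 + -1 = -k + -1 - 2 by ring, show -(k : ℤ) + -3 = -k + -1 - 2 by ring]
    push_cast
    module

theorem derivRSq_mul (f g : Smooth (punctured m)) :
    derivRSq m (f * g) = derivRSq m f * g + f * derivRSq m g := by
  have h : ∑ i, bosCoord (punctured m) i * bosDeriv (punctured m) i (f * g) =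
      (∑ i, bosCoord (punctured m) i * bosDeriv (punctured m) i f) * g +
        f * ∑ i, bosCoord (punctured m) i * bosDeriv (punctured m) i g := by
    rw [Finset.sum_mul, Finset.mul_sum, ← Finset.sum_add_distrib]
    refine Finset.sum_congr rfl fun i _ => ?_
    rw [bosDeriv_mul]
    ring
  rw [derivRSq_eq, derivRSq_eq, derivRSq_eq, h, smul_mul_assoc, mul_smul_comm, ← smul_add]
  congr 1
  ring

theorem derivRSq_rPow (p : ℤ) : derivRSq m (rPow m p) = ((p : ℝ) / 2) • rPow m (p - 2) := by
  rw [derivRSq_eq]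
  simp only [bosDeriv_rPow, mul_smul_comm, ← Finset.smul_sum, ← mul_assoc]
  rw [← Finset.sum_mul, sum_bosCoord_mul_self, ← rPow_two, ← mul_assoc, rPow_mul, smul_smul]
  simp only [Int.reduceNeg, neg_add_cancel, rPow_zero, one_mul]
  congr 1
  ring

theorem derivRSq_bosCoord (i : Fin m) : derivRSq m (bosCoord (punctured m) i) =
    (1 / 2 : ℝ) • (rPow m (-2) * bosCoord (punctured m) i) := by
  rw [derivRSq_eq]
  simp [bosDeriv_bosCoord]

/-- As a function of `t = r²`, `r^p` is `t^{p/2}`. Stating the coefficient as an iterated derivative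
at `1` matches it with the Taylor expansion that defines `weight`. -/
theorem derivRSq_pow_rPow (p : ℤ) (k : ℕ) :
    (derivRSq m ^ k) (rPow m p) =
      (iteratedDeriv k (fun t : ℝ => t ^ ((p : ℝ) / 2)) 1) • rPow m (p - 2 * k) := by
  have key : ∀ k : ℕ, iteratedDeriv (k + 1) (fun t : ℝ => t ^ ((p : ℝ) / 2)) 1 =
      ((p : ℝ) / 2 - k) * iteratedDeriv k (fun t : ℝ => t ^ ((p : ℝ) / 2)) 1 := fun k => by
    simp only [iteratedDeriv_eq_iterate, Real.iter_deriv_rpow_const]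
    simp [descPochhammer_succ_right, Polynomial.eval_mul, mul_comm]
  induction k with
  | zero => simp
  | succ k ih =>
    rw [pow_succ', Module.End.mul_apply, ih, map_smul, derivRSq_rPow, smul_smul, key, mul_comm]
    congr 2
    · push_cast; ring
    · push_cast; ring

/-- The Leibniz rule for powers of a derivation. -/
theorem pow_apply_mul_of_leibniz {A : Type*} [CommRing A] [Algebra ℝ A] {D : Module.End ℝ A}
    (hD : ∀ f g, D (f * g) = D f * g + f * D g) (f g : A) (k : ℕ) :
    (D ^ k) (f * g) = ∑ p ∈ Finset.HasAntidiagonal.antidiagonal k,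
      (k.choose p.1 : ℝ) • ((D ^ p.1) f * (D ^ p.2) g) := by
  -- The Leibniz rule says that multiplication intertwines `D` with `D ⊗ 1 + 1 ⊗ D`, a sum of
  -- commuting operators to which the binomial theorem applies.
  have h1 : D ∘ₗ LinearMap.mul' ℝ A = LinearMap.mul' ℝ A ∘ₗ (D.rTensor A + D.lTensor A) := by
    refine TensorProduct.ext' fun f g => ?_
    simp [hD]
  have h2 : ∀ k : ℕ, (D ^ k) ∘ₗ LinearMap.mul' ℝ A =
      LinearMap.mul' ℝ A ∘ₗ ((D.rTensor A + D.lTensor A) ^ k) := fun k => by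
    induction k with
    | zero => rfl
    | succ k ih =>
      rw [pow_succ, pow_succ, Module.End.mul_eq_comp, Module.End.mul_eq_comp, LinearMap.comp_assoc,
        h1, ← LinearMap.comp_assoc, ih, LinearMap.comp_assoc]
  have hc : Commute (D.rTensor A) (D.lTensor A) := TensorProduct.ext' fun f g => by simp
  have h3 := congrArg (fun T => T (f ⊗ₜ g)) (h2 k)
  simp only [LinearMap.comp_apply, LinearMap.mul'_apply] at h3
  rw [h3, hc.add_pow', LinearMap.sum_apply, map_sum]
  refine Finset.sum_congr rfl fun p _ => ?_
  rw [LinearMap.smul_apply, map_nsmul, Nat.cast_smul_eq_nsmul, Module.End.mul_apply,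
    LinearMap.rTensor_pow, LinearMap.lTensor_pow, LinearMap.lTensor_tmul, LinearMap.rTensor_tmul,
    LinearMap.mul'_apply]

theorem sphereMean_rPow_mul_eq_zero (p : ℤ) {F : Smooth (punctured m)} (hF : sphereMean m F = 0) :
    sphereMean m (rPow m p * F) = 0 := by
  ext L
  rw [sphereMean_rPow_mul, hF]
  simp

/-- The divergence theorem on spheres. -/
theorem sphereMean_bosDeriv (i : Fin m) (g : Smooth (punctured m)) :
    sphereMean m (rPow m ((m : ℤ) - 2) * bosDeriv (punctured m) i g) =
      (2 : ℝ) • sphereMean m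
        (derivRSq m (rPow m ((m : ℤ) - 2) * (bosCoord (punctured m) i * g))) := by
  set q := rPow m ((m : ℤ) - 2)
  set x := bosCoord (punctured m)
  set D := bosDeriv (punctured m)
  -- The tangential part of `∂_i` is assembled from rotation fields; what remains involves only `x_i
  -- g` and the radial derivative.
  have hrot : ∑ j, bosRot (punctured m) j i (x j * g) =
      rPow m 2 * D i g - ((m : ℝ) - 1) • (x i * g) - x i * ∑ j, x j * D j g := by
    have hterm : ∀ j, bosRot (punctured m) j i (x j * g) =
        ((if i = j then x j * g else 0) + x j * x j * D i g) - x i * g - x i * (x j * D j g) := by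
      intro j
      rw [bosRot_apply, bosDeriv_mul, bosDeriv_mul, bosDeriv_bosCoord, bosDeriv_bosCoord, if_pos rfl]
      split_ifs with h
      · ring
      · ring
    simp only [hterm, Finset.sum_sub_distrib, Finset.sum_add_distrib, ← Finset.sum_mul,
      ← Finset.mul_sum]
    rw [Finset.sum_ite_eq, if_pos (Finset.mem_univ _), rPow_two, sum_bosCoord_mul_self,
      Finset.sum_const, Finset.card_univ, Fintype.card_fin, ← Nat.cast_smul_eq_nsmul ℝ, smul_mul_assoc]
    module
  -- The factor `r^{m-2}` contributes `m - 2` and `x_i` contributes `1`, which gives exactly the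
  -- coefficient `m - 1` of `hrot`.
  have hN : (2 : ℝ) • derivRSq m (q * (x i * g)) =
      rPow m (-2) * q * (((m : ℝ) - 1) • (x i * g) + x i * ∑ j, x j * D j g) := by
    rw [derivRSq_mul, derivRSq_mul, derivRSq_rPow, derivRSq_bosCoord, derivRSq_eq g]
    have : rPow m ((m : ℤ) - 2 - 2) = rPow m (-2) * q := by
      rw [rPow_mul]
      congr 1
      ring
    rw [this]
    simp only [smul_mul_assoc, mul_smul_comm, smul_add, smul_smul, mul_add]
    push_cast
    have e1 : rPow m (-2) * q * (x i * g) = q * (rPow m (-2) * x i * g) := by ring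
    have e2 : rPow m (-2) * q * (x i * ∑ j, x j * D j g) =
      q * (x i * (rPow m (-2) * ∑ j, x j * D j g)) := by ring
    rw [e1, e2]
    module
  have key : q * D i g - (2 : ℝ) • derivRSq m (q * (x i * g)) =
      rPow m (-2) * (q * ∑ j, bosRot (punctured m) j i (x j * g)) := by
    have e : q * D i g = rPow m (-2) * q * (rPow m 2 * D i g) := by
      have : rPow m (-2) * rPow m 2 = 1 := by rw [rPow_mul, neg_add_cancel, rPow_zero]
      linear_combination (-(q * D i g)) * this
    rw [hN, hrot, e]
    ring
  rw [← sub_eq_zero, ← map_smul, ← map_sub, key]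
  refine sphereMean_rPow_mul_eq_zero _ (sphereMean_rPow_mul_eq_zero _ ?_)
  rw [map_sum]
  exact Finset.sum_eq_zero fun j _ => sphereMean_bosRot _ _ _

end Radius

section SuperIntegral

variable {m n : ℕ}

/-! ### Restriction to the punctured space -/

/-- Restriction of globally smooth functions to `ℝ^m_0`. -/
def restrictPunctured (m : ℕ) :
    Smooth (⊤ : TopologicalSpace.Opens (Bos m)) →ₗ[ℝ] Smooth (punctured m) :=
  Smooth.restrict le_top

theorem restrictPunctured_apply (h : Smooth (⊤ : TopologicalSpace.Opens (Bos m)))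
    (x : punctured m) : (restrictPunctured m h).1 x = extendZero ⊤ h.1 x := rfl

theorem restrictPunctured_mul (f g : Smooth (⊤ : TopologicalSpace.Opens (Bos m))) :
    restrictPunctured m (f * g) = restrictPunctured m f * restrictPunctured m g := by
  ext x
  rw [restrictPunctured_apply, extendZero_mul]
  rfl

theorem restrictPunctured_bosCoord (i : Fin m) :
    restrictPunctured m (bosCoord ⊤ i) = bosCoord (punctured m) i := by
  ext x
  rw [restrictPunctured_apply]
  exact extendZero_apply (⊤ : TopologicalSpace.Opens (Bos m)) (bosCoord ⊤ i).1 ⟨x, trivial⟩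

theorem restrictPunctured_bosSq :
    restrictPunctured m (bosSq ⊤) = bosSq (punctured m) := by
  simp [bosSq, restrictPunctured_mul, restrictPunctured_bosCoord]

theorem restrictPunctured_bosDeriv (i : Fin m)
    (h : Smooth (⊤ : TopologicalSpace.Opens (Bos m))) :
    restrictPunctured m (bosDeriv ⊤ i h) = bosDeriv (punctured m) i (restrictPunctured m h) := by
  ext x
  rw [restrictPunctured_apply]
  have h1 := extendZero_apply (⊤ : TopologicalSpace.Opens (Bos m)) (bosDeriv ⊤ i h).1 ⟨x, trivial⟩
  exact h1.trans (bosDeriv_mk_apply i (h.2.mono le_top) x).symm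

theorem restrictPunctured_bosRot (i j : Fin m)
    (h : Smooth (⊤ : TopologicalSpace.Opens (Bos m))) :
    restrictPunctured m (bosRot ⊤ i j h) = bosRot (punctured m) i j (restrictPunctured m h) := by
  simp [bosRot_apply, restrictPunctured_mul, restrictPunctured_bosCoord,
    restrictPunctured_bosDeriv]

/-! ### The integral over the supersphere as a linear map -/

theorem berezinFun_tmul {U : TopologicalSpace.Opens (Bos m)} (f : Smooth U) (b : Grass n) :
    berezinFun n U (SuperFun.tmul f b) = berezin n b • f := rfl

theorem phiSharp_tmul (f : Smooth (punctured m)) (b : Grass n) :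
    phiSharp m n (SuperFun.tmul f b) = ∑ j ∈ Finset.range (n + 1),
      ((-1 : ℝ) ^ j / (j.factorial : ℝ)) •
        SuperFun.tmul ((derivRSq m ^ j) f) (thetaSq n ^ j * b) := by
  simp only [phiSharp, LinearMap.sum_apply, LinearMap.smul_apply]
  rfl

/-- The functional `b ↦ (-1)^j / j! ∫_B θ^{2j} b`. -/
def berezinCoeff (n j : ℕ) : Grass n →ₗ[ℝ] ℝ :=
  ((-1 : ℝ) ^ j / (j.factorial : ℝ)) • (berezin n ∘ₗ LinearMap.mulLeft ℝ (thetaSq n ^ j))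

theorem berezinCoeff_apply (j : ℕ) (b : Grass n) :
    berezinCoeff n j b = ((-1 : ℝ) ^ j / (j.factorial : ℝ)) * berezin n (thetaSq n ^ j * b) := rfl

theorem berezinFun_phiSharp_tmul (f : Smooth (punctured m)) (b : Grass n) :
    berezinFun n _ (phiSharp m n (SuperFun.tmul f b)) =
      ∑ j ∈ Finset.range (n + 1), berezinCoeff n j b • (derivRSq m ^ j) f := by
  rw [phiSharp_tmul, map_sum]
  refine Finset.sum_congr rfl fun j _ => ?_
  rw [map_smul, berezinFun_tmul, smul_smul]
  rfl

/-- The coordinate function on `ℝ⁺`. -/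
def posCoord : Smooth posReals := Smooth.mk posReals id contDiffOn_id

/-- The integral over the supersphere, as a function of the radius. -/
def superInt (m n : ℕ) :
    SuperFun n (⊤ : TopologicalSpace.Opens (Bos m)) →ₗ[ℝ] Smooth posReals :=
  LinearMap.mulLeft ℝ posCoord ∘ₗ sphereMean m ∘ₗ berezinFun n (punctured m) ∘ₗ phiSharp m n ∘ₗ
    LinearMap.mulLeft ℝ (SuperFun.tmul (rPow m ((m : ℤ) - 2)) 1) ∘ₗ toPunctured m n

theorem toPunctured_tmul (h : Smooth (⊤ : TopologicalSpace.Opens (Bos m))) (b : Grass n) :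
    toPunctured m n (SuperFun.tmul h b) = SuperFun.tmul (restrictPunctured m h) b := rfl

/-- This separated form is what the invariance proofs use: `b` enters only through the `berezinCoeff
n j`, and `h` only through sphere means. -/
theorem superInt_tmul (h : Smooth (⊤ : TopologicalSpace.Opens (Bos m))) (b : Grass n) :
    superInt m n (SuperFun.tmul h b) = posCoord * ∑ j ∈ Finset.range (n + 1), berezinCoeff n j b •
      sphereMean m ((derivRSq m ^ j) (rPow m ((m : ℤ) - 2) * restrictPunctured m h)) := by
  simp only [superInt, LinearMap.comp_apply, toPunctured_tmul, LinearMap.mulLeft_apply,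
    SuperFun.tmul_mul_tmul, one_mul, berezinFun_phiSharp_tmul, map_sum, map_smul]
  rw [Finset.mul_sum]
  simp only [mul_smul_comm]

theorem sphereIntegral_eq (F : Smooth (punctured m)) (L : posReals) :
    sphereIntegral F L = (L : ℝ) ^ (m - 1) * (sphereMean m F).1 L := rfl

theorem superInt_eq_supersphereIntegral' (hm : m ≠ 0)
    (f : SuperFun n (⊤ : TopologicalSpace.Opens (Bos m))) (L : posReals) :
    (superInt m n f).1 L = supersphereIntegral' f L := by
  have hL : (L : ℝ) ≠ 0 := ne_of_gt L.2
  rw [supersphereIntegral', sphereIntegral_eq]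
  have h1 : (superInt m n f).1 L = (L : ℝ) * (sphereMean m (berezinFun n _
      (phiSharp m n (SuperFun.tmul (rPow m ((m : ℤ) - 2)) 1 * toPunctured m n f)))).1 L := rfl
  -- The exponent `m - 1` is a truncated subtraction, so `m ≠ 0` is needed here. The result is the
  -- factor `posCoord` in `superInt`.
  have h2 : (1 / (L : ℝ) ^ ((m : ℤ) - 2)) * (L : ℝ) ^ (m - 1) = L := by
    rw [← zpow_natCast, one_div, ← zpow_neg, ← zpow_add₀ hL, Nat.cast_sub (Nat.one_le_iff_ne_zero.2 hm)]
    rw [show -((m : ℤ) - 2) + (m - (1 : ℕ)) = 1 by push_cast; ring, zpow_one]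
  rw [← mul_assoc, h2, h1]

theorem berezinFun_tmul_mul {U : TopologicalSpace.Opens (Bos m)} (q : Smooth U)
    (f : SuperFun n U) : berezinFun n U (SuperFun.tmul q 1 * f) = q * berezinFun n U f := by
  induction f using SuperFun.induction with
  | h0 => simp
  | ht f a => rw [SuperFun.tmul_mul_tmul, one_mul, berezinFun_tmul, berezinFun_tmul, mul_smul_comm]
  | ha x y hx hy => rw [mul_add, map_add, map_add, mul_add, hx, hy]

theorem derivRSq_pow_mul (f g : Smooth (punctured m)) (j : ℕ) :
    (derivRSq m ^ j) (f * g) = ∑ k ∈ Finset.range (j + 1),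
      (j.choose k : ℝ) • ((derivRSq m ^ k) f * (derivRSq m ^ (j - k)) g) := by
  refine (pow_apply_mul_of_leibniz (A := Smooth (punctured m)) (D := derivRSq m) derivRSq_mul f g
    j).trans ?_
  exact Finset.Nat.sum_antidiagonal_eq_sum_range_succ_mk
    (fun p => (j.choose p.1 : ℝ) • ((derivRSq m ^ p.1) f * (derivRSq m ^ p.2) g)) j
theorem neg_one_pow_div_factorial_mul_choose {j k : ℕ} (hk' : k ≤ j) :
    ((-1 : ℝ) ^ j / (j.factorial : ℝ)) * (j.choose k : ℝ) =
      (((-1 : ℝ) ^ k / (k.factorial : ℝ)) * ((-1 : ℝ) ^ (j - k) / ((j - k).factorial : ℝ))) := by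
  rw [Nat.cast_choose ℝ hk']
  have h1 := Nat.factorial_ne_zero j
  have h2 := Nat.factorial_ne_zero k
  have h3 := Nat.factorial_ne_zero (j - k)
  have h4 : (-1 : ℝ) ^ j = (-1) ^ k * (-1) ^ (j - k) := by
    rw [← pow_add, Nat.add_sub_cancel' hk']
  rw [h4]
  field_simp

theorem smul_tmul_mul_smul_tmul {U : TopologicalSpace.Opens (Bos m)} (c d : ℝ)
    (f g : Smooth U) (a b : Grass n) :
    (c • SuperFun.tmul f a) * (d • SuperFun.tmul g b) =
      (c * d) • SuperFun.tmul (f * g) (a * b) := by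
  rw [smul_mul_assoc, mul_smul_comm, smul_smul, SuperFun.tmul_mul_tmul]

/-- The exponential of a derivation is multiplicative. The truncation at `n` costs nothing: the left
side sums over the triangle `k + l ≤ n`, the right side over a square, and the extra terms carry
`θ^{2(k+l)} = 0`. -/
theorem phiSharp_tmul_mul (q : Smooth (punctured m)) (f : SuperFun n (punctured m)) :
    phiSharp m n (SuperFun.tmul q 1 * f) = phiSharp m n (SuperFun.tmul q 1) * phiSharp m n f := by
  induction f using SuperFun.induction with
  | h0 => simp
  | ha x y hx hy => rw [mul_add, map_add, map_add, mul_add, hx, hy]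
  | ht f b =>
    rw [SuperFun.tmul_mul_tmul, one_mul, phiSharp_tmul, phiSharp_tmul, phiSharp_tmul,
      Finset.sum_mul_sum]
    obtain ⟨t, ht⟩ : ∃ t : ℕ → ℕ → SuperFun n (punctured m), ∀ k l, t k l =
        (((-1 : ℝ) ^ k / (k.factorial : ℝ)) * ((-1 : ℝ) ^ l / (l.factorial : ℝ))) •
          SuperFun.tmul ((derivRSq m ^ k) q * (derivRSq m ^ l) f) (thetaSq n ^ (k + l) * b) :=
      ⟨_, fun _ _ => rfl⟩
    have hR : ∀ k l, (((-1 : ℝ) ^ k / (k.factorial : ℝ)) •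
        SuperFun.tmul ((derivRSq m ^ k) q) (thetaSq n ^ k * 1)) *
        (((-1 : ℝ) ^ l / (l.factorial : ℝ)) •
        SuperFun.tmul ((derivRSq m ^ l) f) (thetaSq n ^ l * b)) = t k l := fun k l => by
      rw [smul_tmul_mul_smul_tmul, mul_one, ← mul_assoc (thetaSq n ^ k), ← pow_add, ht]
    have hL : ∀ j, ((-1 : ℝ) ^ j / (j.factorial : ℝ)) •
        SuperFun.tmul ((derivRSq m ^ j) (q * f)) (thetaSq n ^ j * b) =
        ∑ k ∈ Finset.range (j + 1), t k (j - k) := fun j => by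
      rw [derivRSq_pow_mul, SuperFun.sum_tmul]
      refine (Finset.smul_sum (M := ℝ) (N := SuperFun n (punctured m))).trans
        (Finset.sum_congr rfl fun k hk => ?_)
      have hk' : k ≤ j := Nat.lt_succ_iff.1 (Finset.mem_range.1 hk)
      rw [ht, SuperFun.smul_tmul, smul_smul, Nat.add_sub_cancel' hk',
        neg_one_pow_div_factorial_mul_choose hk']
    simp only [hL, hR]
    rw [Finset.sum_range_diag_flip]
    refine Finset.sum_congr rfl fun k hk => ?_
    refine Finset.sum_subset (Finset.range_mono (Nat.sub_le _ _)) fun l _ hl => ?_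
    have : n < k + l := by
      have := Finset.mem_range.1 hk
      simp only [Finset.mem_range, not_lt] at hl
      omega
    rw [ht, thetaSq_pow_eq_zero this, zero_mul, SuperFun.tmul_zero, smul_zero]

theorem tmul_pow {U : TopologicalSpace.Opens (Bos m)} (f : Smooth U) (a : Grass n) (k : ℕ) :
    SuperFun.tmul f a ^ k = SuperFun.tmul (f ^ k) (a ^ k) := by
  induction k with
  | zero => rw [pow_zero, pow_zero, pow_zero, SuperFun.one_def]
  | succ k ih => rw [pow_succ, ih, SuperFun.tmul_mul_tmul, ← pow_succ, ← pow_succ]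

theorem rPow_pow (p : ℤ) (k : ℕ) : rPow m p ^ k = rPow m (p * k) := by
  induction k with
  | zero => simp [rPow_zero]
  | succ k ih =>
    rw [pow_succ, ih, rPow_mul]
    congr 1
    push_cast
    ring

/-- Formally `φ^♯` replaces `r²` by `r² - θ²`, so `r^{m-2}` becomes `(r² - θ²)^{m/2-1}`; the proof
compares the coefficients of `θ^{2k}`. -/
theorem rPow_mul_weight : SuperFun.tmul (rPow m ((m : ℤ) - 2)) 1 * weight m n =
    phiSharp m n (SuperFun.tmul (rPow m ((m : ℤ) - 2)) 1) := by
  rw [phiSharp_tmul, weight, taylorSubst, Finset.mul_sum]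
  refine Finset.sum_congr rfl fun k _ => ?_
  rw [derivRSq_pow_rPow, neg_pow, tmul_pow, rPow_pow, mul_smul_comm, SuperFun.smul_tmul, mul_one,
    smul_smul]
  have h1 : ((-1 : SuperFun n (punctured m)) ^ k) = ((-1 : ℝ) ^ k) • 1 := by
    rcases Nat.even_or_odd k with h | h
    · rw [h.neg_one_pow, h.neg_one_pow, one_smul]
    · rw [h.neg_one_pow, h.neg_one_pow, neg_one_smul]
  have h2 : (((m : ℤ) - 2 : ℤ) : ℝ) / 2 = (m : ℝ) / 2 - 1 := by
    push_cast
    ring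
  rw [h1, smul_mul_assoc, one_mul, mul_smul_comm, smul_smul, SuperFun.tmul_mul_tmul, one_mul,
    rPow_mul, h2]
  congr 1
  ring

theorem supersphereIntegral_eq (f : SuperFun n (⊤ : TopologicalSpace.Opens (Bos m)))
    (L : posReals) : supersphereIntegral f L = supersphereIntegral' f L := by
  have hL : (L : ℝ) ≠ 0 := ne_of_gt L.2
  rw [supersphereIntegral, supersphereIntegral', phiSharp_tmul_mul, ← rPow_mul_weight, mul_assoc,
    berezinFun_tmul_mul, sphereIntegral_eq, sphereIntegral_eq, sphereMean_rPow_mul]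
  have := zpow_ne_zero ((m : ℤ) - 2) hL
  field_simp

/-! ### Invariance under the Lie superalgebra -/

theorem sphereMean_derivRSq_pow_congr {F G : Smooth (punctured m)}
    (h : sphereMean m F = sphereMean m G) (k : ℕ) :
    sphereMean m ((derivRSq m ^ k) F) = sphereMean m ((derivRSq m ^ k) G) := by
  rw [← sub_eq_zero, ← map_sub, ← map_sub]
  exact sphereMean_derivRSq_pow (by rw [map_sub, h, sub_self]) k

theorem berezinCoeff_zero_grassDerivUp (a : FermIdx n) (b : Grass n) :
    berezinCoeff n 0 (grassDerivUp a b) = 0 := by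
  simp [berezinCoeff_apply, berezin_grassDerivUp]

/-- Berezin integration by parts against `θ^{2(j+1)}`; the factor `j + 1` from differentiating the
power is absorbed by the factorials. -/
theorem berezinCoeff_succ_grassDerivUp (j : ℕ) (a : FermIdx n) (b : Grass n) :
    berezinCoeff n (j + 1) (grassDerivUp a b) = 2 * berezinCoeff n j (grassGen a * b) := by
  have h := berezin_grassDerivUp a (thetaSq n ^ (j + 1) * b)
  rw [grassDerivUp_thetaSq_pow_mul, map_add, map_smul, smul_eq_mul] at h
  rw [berezinCoeff_apply, berezinCoeff_apply, eq_neg_of_add_eq_zero_right h, Nat.factorial_succ,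
    pow_succ]
  have h1 : (j.factorial : ℝ) ≠ 0 := Nat.cast_ne_zero.2 (Nat.factorial_ne_zero j)
  have h2 : (j : ℝ) + 1 ≠ 0 := by positivity
  push_cast
  field_simp

theorem berezinCoeff_eq_zero {j : ℕ} (hj : n < j) (b : Grass n) : berezinCoeff n j b = 0 := by
  rw [berezinCoeff_apply, thetaSq_pow_eq_zero hj, zero_mul, map_zero, mul_zero]

theorem symplecticJInv_add_swap (a c : FermIdx n) :
    symplecticJInv n a c + symplecticJInv n c a = 0 := by
  have h : ∀ a b : FermIdx n, symplecticJInv n a b = (1 : Matrix (Fin n) (Fin n) ℝ) a.1 b.1 *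
      ((2 : ℝ) • !![(0 : ℝ), 1; -1, 0]) a.2 b.2 := fun _ _ => rfl
  obtain ⟨i, e⟩ := a
  obtain ⟨j, e'⟩ := c
  rw [h, h]
  simp only [Matrix.one_apply, eq_comm (a := j)]
  split_ifs
  · fin_cases e <;> fin_cases e' <;> simp
  · simp

/-- Moving the derivatives to the front costs nothing because `J⁻¹` is antisymmetric. Integration by
parts then leaves `x̀_a x̀_c + x̀_c x̀_a = 0`. -/
theorem berezinCoeff_symplectic (j : ℕ) (a c : FermIdx n) (b : Grass n) :
    berezinCoeff n j (grassGen a * grassDerivUp c b + grassGen c * grassDerivUp a b) = 0 := by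
  have hterm : ∀ a c : FermIdx n, grassGen a * grassDerivUp c b =
      symplecticJInv n c a • b - grassDerivUp c (grassGen a * b) := fun a c => by
    rw [grassDerivUp_eq, grassContract_gen_mul, upCovector_single, sub_sub_cancel]
  have hsum : grassGen a * grassDerivUp c b + grassGen c * grassDerivUp a b =
      -(grassDerivUp c (grassGen a * b) + grassDerivUp a (grassGen c * b)) := by
    have h := congrArg (fun r : ℝ => r • b) (symplecticJInv_add_swap c a)
    simp only [add_smul, zero_smul] at h
    rw [hterm a c, hterm c a, sub_add_sub_comm, h, zero_sub]
  rw [hsum, map_neg, neg_eq_zero, map_add]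
  cases j with
  | zero => rw [berezinCoeff_zero_grassDerivUp, berezinCoeff_zero_grassDerivUp, add_zero]
  | succ j =>
    rw [berezinCoeff_succ_grassDerivUp, berezinCoeff_succ_grassDerivUp, ← mul_add, ← map_add,
      ← mul_assoc, ← mul_assoc, grassGen_mul_comm c a, neg_mul, neg_add_cancel, map_zero, mul_zero]

theorem superInt_ospGen_inl_inr (i : Fin m) (a : FermIdx n)
    (f : SuperFun n (⊤ : TopologicalSpace.Opens (Bos m))) :
    superInt m n (ospGen (.inl i) (.inr a) f) = 0 := by
  suffices h : superInt m n ∘ₗ ospGen (.inl i) (.inr a) = 0 from congrArg (fun D => D f) h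
  refine SuperFun.linearMap_ext fun h b => ?_
  rw [LinearMap.comp_apply, ospGen_inl_inr, map_sub, superInt_tmul, superInt_tmul,
    restrictPunctured_mul, restrictPunctured_bosCoord, restrictPunctured_bosDeriv, ← mul_sub,
    LinearMap.zero_apply]
  set q := rPow m ((m : ℤ) - 2)
  set u : ℕ → Smooth posReals := fun j => sphereMean m ((derivRSq m ^ j)
    (q * (bosCoord (punctured m) i * restrictPunctured m h))) with hu
  have hu' : ∀ j, sphereMean m ((derivRSq m ^ j)
      (q * bosDeriv (punctured m) i (restrictPunctured m h))) = (2 : ℝ) • u (j + 1) := fun j => by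
    have h1 : sphereMean m (q * bosDeriv (punctured m) i (restrictPunctured m h)) =
        sphereMean m ((2 : ℝ) • derivRSq m
          (q * (bosCoord (punctured m) i * restrictPunctured m h))) := by
      rw [map_smul]
      exact sphereMean_bosDeriv i _
    rw [sphereMean_derivRSq_pow_congr h1, map_smul, map_smul, ← Module.End.mul_apply, ← pow_succ]
  convert mul_zero _
  simp only [hu', smul_smul]
  -- The two sums match after shifting the index by one. The unmatched term `j = 0` vanishes because
  -- the Berezin integral kills derivatives, and the unmatched term `j = n` because `θ^{2(n+1)} =
  -- 0`.
  rw [Finset.sum_range_succ', Finset.sum_range_succ, berezinCoeff_zero_grassDerivUp, zero_smul,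
    add_zero]
  have hn : berezinCoeff n n (grassGen a * b) * 2 = 0 := by
    rw [mul_comm, ← berezinCoeff_succ_grassDerivUp, berezinCoeff_eq_zero (Nat.lt_succ_self n)]
  rw [hn, zero_smul, add_zero, sub_eq_zero]
  refine Finset.sum_congr rfl fun j _ => ?_
  rw [berezinCoeff_succ_grassDerivUp, mul_comm]

theorem superInt_ospGen (i j : Idx m n) (f : SuperFun n (⊤ : TopologicalSpace.Opens (Bos m))) :
    superInt m n (ospGen i j f) = 0 := by
  rcases i with i | a <;> rcases j with j | c
  · suffices h : superInt m n ∘ₗ ospGen (.inl i) (.inl j) = 0 from congrArg (fun D => D f) h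
    refine SuperFun.linearMap_ext fun h b => ?_
    rw [LinearMap.comp_apply, ospGen_inl_inl, superInt_tmul, restrictPunctured_bosRot,
      LinearMap.zero_apply]
    convert mul_zero _
    refine Finset.sum_eq_zero fun k _ => ?_
    rw [sphereMean_derivRSq_pow, smul_zero]
    exact sphereMean_rPow_mul_eq_zero _ (sphereMean_bosRot i j _)
  · exact superInt_ospGen_inl_inr i c f
  · rw [ospGen_inr_inl, LinearMap.neg_apply, map_neg, superInt_ospGen_inl_inr, neg_zero]
  · suffices h : superInt m n ∘ₗ ospGen (.inr a) (.inr c) = 0 from congrArg (fun D => D f) h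
    refine SuperFun.linearMap_ext fun h b => ?_
    rw [LinearMap.comp_apply, ospGen_inr_inr, superInt_tmul]
    simp [berezinCoeff_symplectic]

/-! ### Invariance under the group -/

theorem norm_toEuclideanCLM {A : Matrix (Fin m) (Fin m) ℝ} (hA : A ∈ Matrix.orthogonalGroup (Fin m) ℝ)
    (x : Bos m) : ‖Matrix.toEuclideanCLM (𝕜 := ℝ) A x‖ = ‖x‖ :=
  ContinuousLinearMap.norm_map_of_mem_unitary
    (Unitary.map_mem (Matrix.toEuclideanCLM (n := Fin m) (𝕜 := ℝ)) hA) x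

/-- An orthogonal matrix as a linear isometry. -/
def orthogonalIsometry {A : Matrix (Fin m) (Fin m) ℝ} (hA : A ∈ Matrix.orthogonalGroup (Fin m) ℝ) :
    Bos m ≃ₗᵢ[ℝ] Bos m :=
  LinearIsometry.toLinearIsometryEquiv
    ⟨(Matrix.toEuclideanCLM (𝕜 := ℝ) A).toLinearMap, norm_toEuclideanCLM hA⟩ rfl

theorem orthogonalGroup.inv_mem {A : Matrix (Fin m) (Fin m) ℝ}
    (hA : A ∈ Matrix.orthogonalGroup (Fin m) ℝ) : A⁻¹ ∈ Matrix.orthogonalGroup (Fin m) ℝ := by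
  have h : A⁻¹ = star A := Matrix.inv_eq_right_inv (Matrix.mem_orthogonalGroup_iff _ _ |>.1 hA)
  rw [h]
  exact Unitary.star_mem hA

theorem sphereMean_bosPullback {A : Matrix (Fin m) (Fin m) ℝ}
    (hA : A ∈ Matrix.orthogonalGroup (Fin m) ℝ)
    (h : Smooth (⊤ : TopologicalSpace.Opens (Bos m))) :
    sphereMean m (restrictPunctured m (bosPullback A h)) =
      sphereMean m (restrictPunctured m h) := by
  ext L
  have hL : (0 : ℝ) < L := L.2
  rw [sphereMean_apply, sphereMean_apply]
  have hval : ∀ (g : Smooth (⊤ : TopologicalSpace.Opens (Bos m)))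
      (η : Metric.sphere (0 : Bos m) 1), extendZero (punctured m) (restrictPunctured m g).1
        ((L : ℝ) • (η : Bos m)) = extendZero ⊤ g.1 ((L : ℝ) • (η : Bos m)) := fun g η =>
    extendZero_apply (punctured m) (restrictPunctured m g).1
      ⟨_, smul_ne_zero hL.ne' (ne_zero_of_mem_sphere_one η.2)⟩
  simp only [hval]
  rw [← integral_sphere_comp_isometry (orthogonalIsometry hA)
    fun x => extendZero ⊤ h.1 ((L : ℝ) • x)]
  refine MeasureTheory.integral_congr_ae (Filter.Eventually.of_forall fun η => ?_)
  have h1 := extendZero_apply (⊤ : TopologicalSpace.Opens (Bos m)) (bosPullback A h).1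
    ⟨(L : ℝ) • (η : Bos m), trivial⟩
  refine h1.trans ?_
  change extendZero ⊤ h.1 (Matrix.toEuclideanCLM (𝕜 := ℝ) A ((L : ℝ) • (η : Bos m))) = _
  rw [map_smul]
  rfl

theorem superInt_groupAct {A : Matrix (Fin m) (Fin m) ℝ}
    (hA : A ∈ Matrix.orthogonalGroup (Fin m) ℝ) {B : Matrix (FermIdx n) (FermIdx n) ℝ}
    (hB : B ∈ Sp n) (f : SuperFun n (⊤ : TopologicalSpace.Opens (Bos m))) :
    superInt m n (groupAct A B f) = superInt m n f := by
  suffices h : superInt m n ∘ₗ groupAct A B = superInt m n from congrArg (fun D => D f) h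
  refine SuperFun.linearMap_ext fun h b => ?_
  rw [LinearMap.comp_apply, groupAct, SuperFun.map_tmul, superInt_tmul, superInt_tmul]
  congr 1
  refine Finset.sum_congr rfl fun j _ => ?_
  have hB' := Sp.inv_mem hB
  congr 1
  · rw [berezinCoeff_apply, berezinCoeff_apply]
    congr 1
    rw [← berezin_grassPullback hB' (thetaSq n ^ j * b), map_mul (grassPullback _),
      map_pow (grassPullback _),
      grassPullback_thetaSq hB']
    rfl
  · refine sphereMean_derivRSq_pow_congr ?_ j
    ext L
    rw [sphereMean_rPow_mul, sphereMean_rPow_mul,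
      sphereMean_bosPullback (orthogonalGroup.inv_mem hA)]

/-- The group element drops out, and in a nonempty word the outermost algebra element alone forces
the value zero. -/
theorem superInt_isInvariant {K : Set (Matrix (Fin m) (Fin m) ℝ)}
    (hK : K ⊆ Matrix.orthogonalGroup (Fin m) ℝ) : IsInvariant K (superInt m n) := by
  intro A hA B hB w hw f
  rw [superInt_groupAct (hK hA) hB]
  cases w with
  | nil => simp
  | cons X w =>
    rw [if_neg (List.cons_ne_nil X w), List.prod_cons, Module.End.mul_apply]
    have hle : osp m n ≤ LinearMap.ker (LinearMap.compRight ℝ (superInt m n) :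
        Module.End ℝ (SuperFun n (⊤ : TopologicalSpace.Opens (Bos m))) →ₗ[ℝ] _) := by
      rw [osp, Submodule.span_le]
      rintro _ ⟨p, rfl⟩
      exact LinearMap.ext fun f => superInt_ospGen p.1 p.2 f
    exact congrArg (fun D => D (w.prod f)) (hle (hw X (List.mem_cons_self)))

/-! ### Multiplication by `R²` -/

theorem derivRSq_pow_rPow_two_mul (F : Smooth (punctured m)) (k : ℕ) :
    (derivRSq m ^ (k + 1)) (rPow m 2 * F) = rPow m 2 * (derivRSq m ^ (k + 1)) F +
      ((k : ℝ) + 1) • (derivRSq m ^ k) F := by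
  have h2 : derivRSq m (rPow m 2) = 1 := by
    rw [derivRSq_rPow]
    simp [rPow_zero]
  induction k with
  | zero => simp [derivRSq_mul, h2, add_comm]
  | succ k ih =>
    rw [pow_succ', Module.End.mul_apply, ih, map_add, map_smul, derivRSq_mul, h2, one_mul,
      ← Module.End.mul_apply, ← pow_succ', ← Module.End.mul_apply, ← pow_succ']
    push_cast
    module

theorem berezinCoeff_thetaSq_mul (j : ℕ) (b : Grass n) :
    berezinCoeff n j (thetaSq n * b) = -((j : ℝ) + 1) * berezinCoeff n (j + 1) b := by
  rw [berezinCoeff_apply, berezinCoeff_apply, ← mul_assoc, ← pow_succ, Nat.factorial_succ, pow_succ]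
  have h1 : (j.factorial : ℝ) ≠ 0 := Nat.cast_ne_zero.2 (Nat.factorial_ne_zero j)
  have h2 : (j : ℝ) + 1 ≠ 0 := by positivity
  push_cast
  field_simp
  ring

/-- Commuting `D^{k+1}` past `r²` leaves `(k+1) D^k`, while `c_j(θ² b) = -(j+1) c_{j+1}(b)`; these
correction terms cancel and only the factor `r² = L²` survives. -/
theorem superInt_RSq_mul (f : SuperFun n (⊤ : TopologicalSpace.Opens (Bos m))) :
    superInt m n (RSq m n * f) = posCoord ^ 2 * superInt m n f := by
  suffices h : superInt m n ∘ₗ LinearMap.mulLeft ℝ (RSq m n) =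
      LinearMap.mulLeft ℝ (posCoord ^ 2) ∘ₗ superInt m n from congrArg (fun D => D f) h
  refine SuperFun.linearMap_ext fun h b => ?_
  rw [LinearMap.comp_apply, LinearMap.comp_apply, LinearMap.mulLeft_apply, LinearMap.mulLeft_apply,
    RSq_eq, add_mul, SuperFun.tmul_mul_tmul, SuperFun.tmul_mul_tmul, one_mul, one_mul, map_add,
    superInt_tmul, superInt_tmul, superInt_tmul, restrictPunctured_mul, restrictPunctured_bosSq,
    ← rPow_two, mul_left_comm (posCoord ^ 2), ← mul_add]
  congr 1
  set F := rPow m ((m : ℤ) - 2) * restrictPunctured m h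
  have hF : rPow m ((m : ℤ) - 2) * (rPow m 2 * restrictPunctured m h) = rPow m 2 * F :=
    mul_left_comm _ _ _
  have hpos : ∀ G : Smooth (punctured m), sphereMean m (rPow m 2 * G) =
      posCoord ^ 2 * sphereMean m G := fun G => by
    ext L
    rw [sphereMean_rPow_mul]
    rfl
  rw [hF, Finset.sum_range_succ', Finset.sum_range_succ (fun j => berezinCoeff n j (_ * _) • _),
    Finset.mul_sum, Finset.sum_range_succ' (fun j => _ * _)]
  simp only [berezinCoeff_thetaSq_mul, derivRSq_pow_rPow_two_mul, map_add, map_smul, hpos, pow_zero,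
    Module.End.one_apply, mul_smul_comm, berezinCoeff_eq_zero (Nat.lt_succ_self n), mul_zero,
    zero_smul, add_zero, smul_add, Finset.sum_add_distrib, neg_mul, neg_smul,
    Finset.sum_neg_distrib, smul_smul]
  have hcancel : ∑ j ∈ Finset.range n, (berezinCoeff n (j + 1) b * ((j : ℝ) + 1)) •
      sphereMean m ((derivRSq m ^ j) F) = ∑ j ∈ Finset.range n,
        (((j : ℝ) + 1) * berezinCoeff n (j + 1) b) • sphereMean m ((derivRSq m ^ j) F) :=
    Finset.sum_congr rfl fun j _ => by rw [mul_comm]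
  rw [hcancel]
  abel

theorem superInt_isModRSq : IsModRSq (superInt m n) := fun f L => by
  rw [superInt_RSq_mul]
  rfl

/-! ### Values on powers of `θ²` -/

/-- Only the term `j = 0` survives, because any further `θ²` kills `θ^{2n}`. What is left is nonzero
since the sphere has positive measure. -/
theorem superInt_thetaSq_pow (hm : m ≠ 0) (L : posReals) :
    (superInt m n (SuperFun.tmul 1 (thetaSq n ^ n))).1 L ≠ 0 := by
  have hL : (0 : ℝ) < L := L.2
  have : NeZero m := ⟨hm⟩
  have hcoeff : ∀ j ∈ Finset.range (n + 1), j ≠ 0 → berezinCoeff n j (thetaSq n ^ n) •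
      sphereMean m ((derivRSq m ^ j) (rPow m ((m : ℤ) - 2) * restrictPunctured m 1)) = 0 := by
    intro j _ hj
    rw [berezinCoeff_apply, ← pow_add, thetaSq_pow_eq_zero (by omega), map_zero, mul_zero,
      zero_smul]
  rw [superInt_tmul, Finset.sum_eq_single_of_mem 0 (by simp) hcoeff]
  have h0 : berezinCoeff n 0 (thetaSq n ^ n) ≠ 0 := by
    simpa [berezinCoeff_apply] using berezin_thetaSq_pow_ne_zero
  have h1 : (sphereMean m (restrictPunctured m 1)).1 L ≠ 0 := by
    rw [sphereMean_apply]
    have hval : ∀ η : Metric.sphere (0 : Bos m) 1, extendZero (punctured m)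
        (restrictPunctured m 1).1 ((L : ℝ) • (η : Bos m)) = 1 := fun η => by
      refine (extendZero_apply (punctured m) (restrictPunctured m 1).1
        ⟨_, smul_ne_zero hL.ne' (ne_zero_of_mem_sphere_one η.2)⟩).trans ?_
      rw [restrictPunctured_apply]
      exact extendZero_apply (⊤ : TopologicalSpace.Opens (Bos m)) _ ⟨_, trivial⟩
    simp only [hval, MeasureTheory.integral_const, smul_eq_mul, mul_one]
    rw [MeasureTheory.measureReal_ne_zero_iff]
    exact fun h => MeasureTheory.Measure.toSphere_ne_zero (MeasureTheory.volume : MeasureTheory.Measure (Bos m))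
      (MeasureTheory.Measure.measure_univ_eq_zero.1 h)
  have h2 := sphereMean_rPow_mul ((m : ℤ) - 2) (restrictPunctured m 1) L
  rw [pow_zero, Module.End.one_apply]
  change (L : ℝ) * (berezinCoeff n 0 (thetaSq n ^ n) * (sphereMean m _).1 L) ≠ 0
  rw [h2]
  exact mul_ne_zero hL.ne' (mul_ne_zero h0 (mul_ne_zero (zpow_ne_zero _ hL.ne') h1))

end SuperIntegral

/-! ### Averaging over plane rotations, modulo rotation fields -/

section Averaging

open MeasureTheory

theorem integrable_fderiv_param {P V E F : Type} [MeasurableSpace P]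
    [NormedAddCommGroup V] [NormedSpace ℝ V] [MeasurableSpace V] [BorelSpace V]
    [NormedAddCommGroup E] [NormedSpace ℝ E]
    [NormedAddCommGroup F] [NormedSpace ℝ F] [FiniteDimensional ℝ F]
    (μ : Measure P) [IsFiniteMeasure μ] {ι : P → V}
    (hι : Measurable ι) {C : Set V} (hC : IsCompact C) (hιC : ∀ p, ι p ∈ C) {H : V × E → F}
    (hH : ContDiff ℝ 1 H) (x v : E) :
    Integrable (fun p => fderiv ℝ (fun y => H (ι p, y)) x v) μ := by
  have h2 : ∀ a, fderiv ℝ (fun y => H (a, y)) x v = fderiv ℝ H (a, x) (0, v) := fun a => by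
    have h1 : HasFDerivAt H (fderiv ℝ H (a, x)) (a, x) := (hH.differentiable (by simp) _).hasFDerivAt
    have h2 : HasFDerivAt (fun y => H (a, y)) _ x := h1.comp x (hasFDerivAt_prodMk_right a x)
    rw [h2.fderiv]
    rfl
  simp only [h2]
  refine integrable_comp_of_continuousOn μ hι hC hιC (f := fun a => fderiv ℝ H (a, x) (0, v)) ?_
  have h3 : Continuous (fderiv ℝ H) := hH.continuous_fderiv (by simp)
  fun_prop

variable {m : ℕ}

theorem Smooth.contDiff_top (h : Smooth (⊤ : TopologicalSpace.Opens (Bos m))) :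
    ContDiff ℝ ∞ (extendZero ⊤ h.1) :=
  contDiffOn_univ.1 h.2

theorem bosRot_mk_apply {f : Bos m → ℝ} (hf : ContDiff ℝ ∞ f) (i j : Fin m)
    (x : (⊤ : TopologicalSpace.Opens (Bos m))) :
    (bosRot ⊤ i j (Smooth.mk ⊤ f hf.contDiffOn)).1 x = fderiv ℝ f x
      ((x : Bos m) i • EuclideanSpace.single j 1 - (x : Bos m) j • EuclideanSpace.single i 1) := by
  rw [bosRot_apply_point, (Smooth.extendZero_mk_eventuallyEq hf.contDiffOn x.2).fderiv_eq]

theorem inner_single_one (j : Fin m) (x : Bos m) :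
    inner ℝ (EuclideanSpace.single j (1 : ℝ)) x = x j := by
  simp [EuclideanSpace.inner_single_left]

/-- Differentiating along the rotations in the plane of `e_j` and `w`. -/
theorem hasDerivAt_comp_planeRot {f : Bos m → ℝ} (hf : ContDiff ℝ ∞ f) (j : Fin m) {w : Bos m}
    (hw : ‖w‖ = 1) (hjw : inner ℝ (EuclideanSpace.single j (1 : ℝ)) w = 0) (θ : ℝ) (x : Bos m) :
    HasDerivAt (fun θ => f (planeRot (EuclideanSpace.single j 1) w θ x))
      (∑ i, w i * fderiv ℝ (fun y => f (planeRot (EuclideanSpace.single j 1) w θ y)) x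
        (x j • EuclideanSpace.single i 1 - x i • EuclideanSpace.single j 1)) θ := by
  set e : Bos m := EuclideanSpace.single j 1
  have he : ‖e‖ = 1 := by simp [e]
  have h1 := hasDerivAt_planeRot he hw hjw θ x
  have h2 : HasFDerivAt f (fderiv ℝ f (planeRot e w θ x)) (planeRot e w θ x) :=
    (hf.differentiable (by simp) _).hasFDerivAt
  refine (h2.comp_hasDerivAt θ h1).congr_deriv ?_
  have h3 : HasFDerivAt (fun y => f (planeRot e w θ y)) _ x :=
    h2.comp x (LinearMap.toContinuousLinearMap (planeRot e w θ)).hasFDerivAt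
  rw [h3.fderiv]
  -- The generator of the rotation in the plane of `e_j` and `w` is the combination with
  -- coefficients `w_i` of the coordinate rotation fields.
  have hsum : inner ℝ e x • w - inner ℝ w x • e =
      ∑ i, w i • (x j • EuclideanSpace.single i 1 - x i • e) := by
    have hwsum : w = ∑ i, w i • EuclideanSpace.single i (1 : ℝ) := by
      ext k
      simp [Finset.sum_apply, Pi.single_apply]
    have hin : inner ℝ w x = ∑ i, w i * x i := by
      rw [PiLp.inner_apply]
      simp [mul_comm]
    simp only [smul_sub, Finset.sum_sub_distrib, smul_smul, ← Finset.sum_smul, ← hin]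
    rw [inner_single_one]
    congr 1
    conv_lhs => rw [hwsum]
    rw [Finset.smul_sum]
    exact Finset.sum_congr rfl fun i _ => by rw [smul_smul, mul_comm]
  rw [hsum]
  simp only [map_sum, map_smul, smul_eq_mul]
  rfl

/-- Averages of a function over plane rotations agree with the function modulo the images of the
rotation fields. -/
theorem smul_sub_average_mem {N : Submodule ℝ (Smooth (⊤ : TopologicalSpace.Opens (Bos m)))}
    (hN : ∀ i j h, bosRot ⊤ i j h ∈ N) (h : Smooth (⊤ : TopologicalSpace.Opens (Bos m)))
    {P : Type} [MeasurableSpace P] (μ : Measure P) [IsFiniteMeasure μ] (j : Fin m)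
    {w : P → Bos m} (hw : Measurable w) (hw1 : ∀ p, ‖w p‖ = 1)
    (hjw : ∀ p, inner ℝ (EuclideanSpace.single j (1 : ℝ)) (w p) = 0)
    {α : P → ℝ} (hα : Measurable α) {A : ℝ} (hαA : ∀ p, |α p| ≤ A) :
    ∃ g : Smooth (⊤ : TopologicalSpace.Opens (Bos m)),
      (∀ x, extendZero ⊤ g.1 x = ∫ p, extendZero ⊤ h.1
        (planeRot (EuclideanSpace.single j 1) (w p) (α p) x) ∂μ) ∧ μ.real Set.univ • h - g ∈ N := by
  set f := extendZero ⊤ h.1 with hf_def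
  have hf : ContDiff ℝ ∞ f := Smooth.contDiff_top h
  set e : Bos m := EuclideanSpace.single j 1
  have he : ‖e‖ = 1 := by simp [e]
  have hG : ContDiff ℝ ∞ fun x => ∫ p, f (planeRot e (w p) (α p) x) ∂μ := by
    refine contDiffOn_univ.1 (contDiffOn_integral_param μ (ι := fun p => (w p, α p))
      (hw.prodMk hα) (C := Metric.closedBall 0 1 ×ˢ Metric.closedBall 0 A)
      ((isCompact_closedBall _ _).prod (isCompact_closedBall _ _))
      (fun p => ⟨by simp [hw1], by simpa using hαA p⟩) isOpen_univ (W := Set.univ) isOpen_univ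
      (Set.subset_univ _)
      (H := fun z : (Bos m × ℝ) × Bos m => f (planeRot e z.1.1 z.1.2 z.2)) ?_)
    exact (hf.comp (contDiff_planeRot contDiff_const (by fun_prop) (by fun_prop)
      (by fun_prop))).contDiffOn
  refine ⟨Smooth.mk ⊤ _ hG.contDiffOn, fun x => extendZero_apply ⊤ _ ⟨x, trivial⟩, ?_⟩
  -- The second factor parametrizes the path of angles `s ↦ s α`, `0 ≤ s ≤ 1`, from the identity to
  -- the rotation by `α`. The last component of `ι` retains the speed `α`.
  let ν : Measure (P × unitInterval) := μ.prod volume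
  let ι : P × unitInterval → Bos m × ℝ × ℝ := fun p => (w p.1, p.2 * α p.1, α p.1)
  have hι : Measurable ι := by fun_prop
  let C : Set (Bos m × ℝ × ℝ) :=
    Metric.closedBall 0 1 ×ˢ (Metric.closedBall 0 A ×ˢ Metric.closedBall 0 A)
  have hC : IsCompact C :=
    (isCompact_closedBall _ _).prod ((isCompact_closedBall _ _).prod (isCompact_closedBall _ _))
  have hιC : ∀ p, ι p ∈ C := by
    rintro ⟨p, s⟩
    refine ⟨by simp [ι, hw1], ?_, by simpa [ι] using hαA p⟩
    have h1 : |(s : ℝ)| ≤ 1 := by rw [abs_of_nonneg s.2.1]; exact s.2.2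
    simp only [ι, mem_closedBall_zero_iff, Real.norm_eq_abs, abs_mul]
    exact (mul_le_of_le_one_left (abs_nonneg _) h1).trans (hαA p)
  let H : Fin m → (Bos m × ℝ × ℝ) × Bos m → ℝ := fun i z =>
    z.1.2.2 * z.1.1 i * f (planeRot e z.1.1 z.1.2.1 z.2)
  have hH : ∀ i, ContDiff ℝ ∞ (H i) := fun i => by
    have h1 : ContDiff ℝ ∞ fun z : (Bos m × ℝ × ℝ) × Bos m => f (planeRot e z.1.1 z.1.2.1 z.2) :=
      hf.comp (contDiff_planeRot contDiff_const (by fun_prop) (by fun_prop) (by fun_prop))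
    have h2 : ContDiff ℝ ∞ fun z : (Bos m × ℝ × ℝ) × Bos m => z.1.1 i :=
      (EuclideanSpace.proj (𝕜 := ℝ) i : Bos m →L[ℝ] ℝ).contDiff.comp (by fun_prop)
    exact (ContDiff.mul (by fun_prop) h2).mul h1
  have hg : ∀ i, ContDiff ℝ ∞ fun x => ∫ p, H i (ι p, x) ∂ν := fun i =>
    contDiffOn_univ.1 (contDiffOn_integral_param ν hι hC hιC isOpen_univ (W := Set.univ)
      isOpen_univ (Set.subset_univ _) (hH i).contDiffOn)
  -- By the fundamental theorem of calculus along the path, the difference is an integral of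
  -- rotation fields applied to rotated copies of `f`. Taking the fields out of the integral leaves
  -- a finite sum of their images, which suffices for a submodule without topology.
  have key : μ.real Set.univ • h - Smooth.mk ⊤ _ hG.contDiffOn =
      -∑ i, bosRot ⊤ j i (Smooth.mk ⊤ _ (hg i).contDiffOn) := by
    ext x
    obtain ⟨x, -⟩ := x
    have hD : ∀ i, (bosRot ⊤ j i (Smooth.mk ⊤ _ (hg i).contDiffOn)).1 ⟨x, trivial⟩ =
        ∫ p, fderiv ℝ (fun y => H i (ι p, y)) x
          (x j • EuclideanSpace.single i 1 - x i • e) ∂ν := fun i => by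
      rw [bosRot_mk_apply (hg i)]
      exact fderiv_integral_param_apply ν hι hC hιC isOpen_univ (W := Set.univ) isOpen_univ
        (Set.subset_univ _) ((hH i).of_le (by simp)).contDiffOn (Set.mem_univ x) _
    have hint : ∀ i, Integrable (fun p => fderiv ℝ (fun y => H i (ι p, y)) x
        (x j • EuclideanSpace.single i 1 - x i • e)) ν := fun i =>
      integrable_fderiv_param ν hι hC hιC ((hH i).of_le (by simp)) _ _
    have hsum : (∑ i, bosRot ⊤ j i (Smooth.mk ⊤ _ (hg i).contDiffOn)).1 ⟨x, trivial⟩ =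
        ∫ p, (f (planeRot e (w p) (α p) x) - f x) ∂μ := by
      rw [AddSubmonoidClass.coe_finsetSum, Finset.sum_apply]
      simp only [hD]
      rw [← integral_finsetSum _ fun i _ => hint i]
      rw [integral_prod _ (integrable_finsetSum _ fun i _ => hint i)]
      refine integral_congr_ae (Filter.Eventually.of_forall fun p => ?_)
      have hd : ∀ s : ℝ, HasDerivAt (fun s : ℝ => f (planeRot e (w p) (s * α p) x))
          (∑ i, fderiv ℝ (fun y => α p * w p i * f (planeRot e (w p) (s * α p) y)) x
            (x j • EuclideanSpace.single i 1 - x i • e)) s := fun s => by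
        have h1 := (hasDerivAt_comp_planeRot hf j (hw1 p) (hjw p) (s * α p) x).comp s
          ((hasDerivAt_id s).mul_const (α p))
        refine h1.congr_deriv ?_
        rw [one_mul, Finset.sum_mul]
        refine Finset.sum_congr rfl fun i _ => ?_
        have h2 : DifferentiableAt ℝ (fun y => f (planeRot e (w p) (s * α p) y)) x :=
          (hf.comp (contDiff_planeRot contDiff_const contDiff_const contDiff_const
            contDiff_id)).differentiable (by simp) x
        rw [fderiv_const_mul h2, smul_apply, smul_eq_mul]
        ring
      have hc : Continuous fun s : ℝ =>
          ∑ i, fderiv ℝ (fun y => α p * w p i * f (planeRot e (w p) (s * α p) y)) x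
            (x j • EuclideanSpace.single i 1 - x i • e) := by
        have : ContDiff ℝ ∞ fun s : ℝ => f (planeRot e (w p) (s * α p) x) :=
          hf.comp (contDiff_planeRot contDiff_const contDiff_const (by fun_prop) contDiff_const)
        have h2 := this.continuous_deriv (by simp)
        convert h2 using 2 with s
        exact (hd s).deriv.symm
      have hFTC := intervalIntegral.integral_eq_sub_of_hasDerivAt (fun s _ => hd s)
        (hc.intervalIntegrable 0 1)
      simp only [one_mul, zero_mul, planeRot_zero] at hFTC
      beta_reduce
      rw [← hFTC, intervalIntegral.integral_of_le zero_le_one, ← integral_Icc_eq_integral_Ioc]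
      exact integral_subtype measurableSet_Icc (fun s : ℝ =>
          ∑ i, fderiv ℝ (fun y => α p * w p i * f (planeRot e (w p) (s * α p) y)) x
            (x j • EuclideanSpace.single i 1 - x i • e))
    have hint0 : Integrable (fun p => f (planeRot e (w p) (α p) x)) μ :=
      integrable_comp_of_continuousOn μ (ι := fun p => (w p, α p))
        (hw.prodMk hα) (C := Metric.closedBall 0 1 ×ˢ Metric.closedBall 0 A)
        ((isCompact_closedBall _ _).prod (isCompact_closedBall _ _))
        (fun p => ⟨by simp [hw1], by simpa using hαA p⟩)
        (f := fun z : Bos m × ℝ => f (planeRot e z.1 z.2 x))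
        (hf.comp (contDiff_planeRot contDiff_const contDiff_fst contDiff_snd
          contDiff_const)).continuous.continuousOn
    rw [integral_sub hint0 (integrable_const _), integral_const] at hsum
    change μ.real Set.univ • h.1 ⟨x, trivial⟩ - ∫ p, f (planeRot e (w p) (α p) x) ∂μ =
      -(∑ i, bosRot ⊤ j i (Smooth.mk ⊤ _ (hg i).contDiffOn)).1 ⟨x, trivial⟩
    have hfx : f x = h.1 ⟨x, trivial⟩ := extendZero_apply ⊤ h.1 ⟨x, trivial⟩
    rw [hsum, hfx]
    ring
  rw [key]
  exact N.neg_mem (N.sum_mem fun i _ => hN _ _ _)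

end Averaging

/-! ### Reduction to radial functions -/

section Radial

open MeasureTheory

variable {m : ℕ}

/-- The function depends only on the norm and the first `k` coordinates. -/
def DependsOnNormAndFirst (k : ℕ) (F : Bos m → ℝ) : Prop :=
  ∀ x y, (∀ i : Fin m, i.val < k → x i = y i) → ‖x‖ = ‖y‖ → F x = F y

theorem planeRot_apply_of_ne {j i : Fin m} {w : Bos m} (hij : i ≠ j) (hi : w i = 0) (θ : ℝ)
    (x : Bos m) : planeRot (EuclideanSpace.single j 1) w θ x i = x i := by
  simp [planeRot_apply, hij, hi]

theorem exists_planeRot_eq {a b : Fin m} (hab : a ≠ b) {x y : Bos m}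
    (h : ∀ i, i ≠ a → i ≠ b → x i = y i) (hn : ‖x‖ = ‖y‖) :
    ∃ t, y = planeRot (EuclideanSpace.single a 1) (EuclideanSpace.single b 1) t x := by
  have hsq : x a ^ 2 + x b ^ 2 = y a ^ 2 + y b ^ 2 := by
    have h1 : ‖x‖ ^ 2 = ‖y‖ ^ 2 := by rw [hn]
    rw [EuclideanSpace.real_norm_sq_eq, EuclideanSpace.real_norm_sq_eq,
      ← Finset.add_sum_erase _ _ (Finset.mem_univ a), ← Finset.add_sum_erase _ _ (Finset.mem_univ a),
      ← Finset.add_sum_erase _ _ (Finset.mem_erase.2 ⟨hab.symm, Finset.mem_univ b⟩),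
      ← Finset.add_sum_erase _ _ (Finset.mem_erase.2 ⟨hab.symm, Finset.mem_univ b⟩),
      Finset.sum_congr (g := fun i => y i ^ 2) rfl fun i hi => by
        simp only [Finset.mem_erase] at hi
        rw [h i hi.2.1 hi.1]] at h1
    linarith
  obtain ⟨t, h1, h2⟩ : ∃ t : ℝ, y a = Real.cos t * x a - Real.sin t * x b ∧
      y b = Real.sin t * x a + Real.cos t * x b := by
    by_cases h0 : x a ^ 2 + x b ^ 2 = 0
    · have hx : x a = 0 ∧ x b = 0 := by constructor <;> nlinarith [sq_nonneg (x a), sq_nonneg (x b)]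
      have hy : y a = 0 ∧ y b = 0 := by
        constructor <;> nlinarith [sq_nonneg (y a), sq_nonneg (y b)]
      exact ⟨0, by simp [hx, hy], by simp [hx, hy]⟩
    -- `c + i s` is the quotient of `y_a + i y_b` by `x_a + i x_b`, a complex number of modulus one
    -- whose argument is the angle.
    · let c := (y a * x a + y b * x b) / (x a ^ 2 + x b ^ 2)
      let s := (y b * x a - y a * x b) / (x a ^ 2 + x b ^ 2)
      have hcs : c ^ 2 + s ^ 2 = 1 := by
        have : (y a * x a + y b * x b) ^ 2 + (y b * x a - y a * x b) ^ 2 =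
            (x a ^ 2 + x b ^ 2) * (y a ^ 2 + y b ^ 2) := by ring
        simp only [c, s]
        rw [div_pow, div_pow, ← add_div, this, ← hsq]
        field_simp
      have hn : ‖(⟨c, s⟩ : ℂ)‖ = 1 := by
        have h1 := Complex.normSq_add_mul_I c s
        rw [Complex.norm_def, Complex.normSq_mk, ← pow_two, ← pow_two, hcs, Real.sqrt_one]
      have hne : (⟨c, s⟩ : ℂ) ≠ 0 := by
        intro h
        simp [h] at hn
      refine ⟨Complex.arg ⟨c, s⟩, ?_, ?_⟩ <;>
      · rw [Complex.cos_arg hne, Complex.sin_arg, hn]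
        simp only [c, s]
        field_simp
        ring
  refine ⟨t, ?_⟩
  have hw : (EuclideanSpace.single b (1 : ℝ) : Bos m) a = 0 := by simp [hab]
  have hew : inner ℝ (EuclideanSpace.single a (1 : ℝ) : Bos m) (EuclideanSpace.single b 1) = 0 := by
    rw [inner_single_one, hw]
  ext i
  by_cases hia : i = a
  · subst hia
    rw [← inner_single_one, ← inner_single_one, inner_left_planeRot (by simp) hew]
    simp only [inner_single_one]
    exact h1
  · by_cases hib : i = b
    · subst hib
      rw [← inner_single_one, ← inner_single_one, inner_right_planeRot (by simp) hew]
      simp only [inner_single_one]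
      exact h2
    · rw [planeRot_apply_of_ne hia (by simp [hib]), h i hia hib]

variable {N : Submodule ℝ (Smooth (⊤ : TopologicalSpace.Opens (Bos m)))}

theorem exists_average_circle (hN : ∀ i j h, bosRot ⊤ i j h ∈ N) {k : ℕ} (hk : k + 2 = m)
    (h : Smooth (⊤ : TopologicalSpace.Opens (Bos m))) :
    ∃ g : Smooth (⊤ : TopologicalSpace.Opens (Bos m)),
      DependsOnNormAndFirst k (extendZero ⊤ g.1) ∧ h - g ∈ N := by
  let a : Fin m := ⟨k, by omega⟩
  let b : Fin m := ⟨k + 1, by omega⟩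
  have hab : a ≠ b := by simp [a, b]
  let e : Bos m := EuclideanSpace.single a 1
  let w : Bos m := EuclideanSpace.single b 1
  have he : ‖e‖ = 1 := by simp [e]
  have hw : ‖w‖ = 1 := by simp [w]
  have hew : inner ℝ e w = 0 := by simp [e, w, inner_single_one, hab]
  -- The angle is clamped to `[0, 2π]` because it must be bounded on all of the parameter line; on
  -- the domain of integration the clamp does nothing.
  obtain ⟨g, hg, hgN⟩ := smul_sub_average_mem hN h
    (volume.restrict (Set.Ioc 0 (2 * Real.pi))) a (P := ℝ) (w := fun _ => w) measurable_const
    (fun _ => hw) (fun _ => hew) (α := fun t => max 0 (min t (2 * Real.pi))) (by fun_prop)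
    (A := 2 * Real.pi) (fun t => by
      rw [abs_of_nonneg (le_max_left _ _)]
      exact max_le Real.two_pi_pos.le (min_le_right _ _))
  have hg' : ∀ x, extendZero ⊤ g.1 x =
      ∫ t in (0 : ℝ)..(2 * Real.pi), extendZero ⊤ h.1 (planeRot e w t x) := fun x => by
    rw [hg, intervalIntegral.integral_of_le Real.two_pi_pos.le]
    refine setIntegral_congr_fun measurableSet_Ioc fun t ht => ?_
    simp only [min_eq_left ht.2, max_eq_right ht.1.le]
    rfl
  have hinv : DependsOnNormAndFirst k (extendZero ⊤ g.1) := fun x y hxy hn => by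
    obtain ⟨t, rfl⟩ := exists_planeRot_eq hab (x := x) (y := y) (fun i hia hib => hxy i (by
      have h1 : i.val ≠ k := fun h => hia (Fin.ext h)
      have h2 : i.val ≠ k + 1 := fun h => hib (Fin.ext h)
      omega)) hn
    rw [hg', hg']
    have hper : Function.Periodic (fun s => extendZero ⊤ h.1 (planeRot e w s x)) (2 * Real.pi) :=
      fun s => by simp only [planeRot_apply, Real.cos_add_two_pi, Real.sin_add_two_pi]
    have h1 := hper.intervalIntegral_add_eq 0 t
    rw [zero_add] at h1
    rw [h1]
    have h2 := intervalIntegral.integral_comp_add_right (a := 0) (b := 2 * Real.pi)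
      (fun s => extendZero ⊤ h.1 (planeRot e w s x)) t
    rw [zero_add, add_comm] at h2
    rw [← h2]
    refine intervalIntegral.integral_congr fun s _ => ?_
    rw [show (planeRot (EuclideanSpace.single a 1) (EuclideanSpace.single b 1) t) x =
      planeRot e w t x from rfl, planeRot_planeRot he hw hew]
  have hc : (volume.restrict (Set.Ioc 0 (2 * Real.pi))).real Set.univ = 2 * Real.pi := by
    simp [Measure.real, Real.pi_pos.le]
  rw [hc] at hgN
  refine ⟨(2 * Real.pi)⁻¹ • g, fun x y hxy hn => ?_, ?_⟩
  · have h1 : ∀ z : Bos m, extendZero ⊤ ((2 * Real.pi)⁻¹ • g).1 z =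
        (2 * Real.pi)⁻¹ * extendZero ⊤ g.1 z := fun z =>
      (extendZero_apply ⊤ _ ⟨z, trivial⟩).trans
        (congrArg ((2 * Real.pi)⁻¹ * ·) (extendZero_apply ⊤ g.1 ⟨z, trivial⟩).symm)
    rw [h1, h1, hinv x y hxy hn]
  · have := N.smul_mem (2 * Real.pi)⁻¹ hgN
    rwa [smul_sub, smul_smul, inv_mul_cancel₀ Real.two_pi_pos.ne', one_smul] at this

/-- The projection that drops the first `k` coordinates. -/
def dropFirst (k : ℕ) (v : Bos m) : Bos m :=
  WithLp.toLp 2 fun i => if i.val < k then 0 else v i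

theorem dropFirst_apply (k : ℕ) (v : Bos m) (i : Fin m) :
    dropFirst k v i = if i.val < k then 0 else v i := rfl

theorem continuous_dropFirst (k : ℕ) : Continuous (dropFirst k : Bos m → Bos m) := by
  refine (PiLp.continuous_toLp 2 _).comp (continuous_pi fun i => ?_)
  split_ifs <;> fun_prop

theorem inner_dropFirst (k : ℕ) (v x : Bos m) :
    inner ℝ (dropFirst k v) x = inner ℝ v x - ∑ i : Fin m, if i.val < k then v i * x i else 0 := by
  simp only [PiLp.inner_apply, dropFirst_apply, ← Finset.sum_sub_distrib]
  refine Finset.sum_congr rfl fun i _ => ?_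
  split_ifs <;> simp [mul_comm]

theorem norm_dropFirst_sq (k : ℕ) (v : Bos m) :
    ‖dropFirst k v‖ ^ 2 = inner ℝ (dropFirst k v) v := by
  rw [← real_inner_self_eq_norm_sq]
  simp only [PiLp.inner_apply, dropFirst_apply]
  refine Finset.sum_congr rfl fun i _ => ?_
  split_ifs <;> simp

theorem inner_dropFirst_succ (j : Fin m) (v x : Bos m) :
    inner ℝ (dropFirst j.val v) x = v j * x j + inner ℝ (dropFirst (j.val + 1) v) x := by
  have h1 : v j * x j = ∑ i, if i = j then v i * x i else 0 := by simp
  simp only [PiLp.inner_apply, dropFirst_apply, h1, ← Finset.sum_add_distrib]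
  refine Finset.sum_congr rfl fun i _ => ?_
  by_cases hij : i = j
  · subst hij
    simp [mul_comm]
  · have h2 : i.val ≠ j.val := fun h => hij (Fin.ext h)
    have h3 : i.val < j.val ↔ i.val < j.val + 1 := by omega
    simp [hij, h3]

/-- Averaging over rotations that move a random direction orthogonal to the first `j` coordinate
vectors to the next coordinate vector. -/
theorem exists_average_step (hN : ∀ i j h, bosRot ⊤ i j h ∈ N) {j : ℕ} (hj : j + 1 < m)
    (h : Smooth (⊤ : TopologicalSpace.Opens (Bos m)))
    (hh : DependsOnNormAndFirst (j + 1) (extendZero ⊤ h.1)) :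
    ∃ g : Smooth (⊤ : TopologicalSpace.Opens (Bos m)),
      DependsOnNormAndFirst j (extendZero ⊤ g.1) ∧ h - g ∈ N := by
  let a : Fin m := ⟨j, by omega⟩
  let b : Fin m := ⟨j + 1, hj⟩
  have hab : a ≠ b := by simp [a, b]
  let e : Bos m := EuclideanSpace.single a 1
  have he : ‖e‖ = 1 := by simp [e]
  let u : Bos m → Bos m := dropFirst (j + 1)
  have hu : Continuous u := continuous_dropFirst _
  -- When `u v = 0` any unit vector orthogonal to the first `j + 1` coordinate vectors would do;
  -- `e_b` exists because `j + 1 < m`.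
  let w : Bos m → Bos m := fun v => if u v = 0 then EuclideanSpace.single b 1 else ‖u v‖⁻¹ • u v
  let α : Bos m → ℝ := fun v => -Complex.arg ⟨v a, ‖u v‖⟩
  -- A random direction is a random point of the unit ball, minus the points whose projection has no
  -- direction. This set is invariant under the isometries fixing the first `j` coordinate vectors.
  let B : Set (Bos m) := Metric.closedBall 0 1 ∩ (dropFirst j ⁻¹' {0})ᶜ
  have hBm : MeasurableSet B := measurableSet_closedBall.inter
    ((continuous_dropFirst j).measurable (measurableSet_singleton 0)).compl
  have hw : Measurable w := by
    refine Measurable.ite (hu.measurable (measurableSet_singleton 0)) measurable_const ?_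
    have hum := hu.measurable
    exact hum.norm.inv.smul hum
  have huw : ∀ v, ‖u v‖ • w v = u v := fun v => by
    by_cases h0 : u v = 0
    · simp [h0]
    · simp only [w, if_neg h0, smul_smul]
      rw [mul_inv_cancel₀ (norm_ne_zero_iff.2 h0), one_smul]
  have hw1 : ∀ v, ‖w v‖ = 1 := fun v => by
    by_cases h0 : u v = 0
    · simp [w, h0]
    · simp only [w, if_neg h0, norm_smul, norm_inv, norm_norm]
      exact inv_mul_cancel₀ (norm_ne_zero_iff.2 h0)
  have hwi : ∀ v (i : Fin m), i.val < j + 1 → w v i = 0 := fun v i hi => by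
    by_cases h0 : u v = 0
    · have : i ≠ b := fun h => by simp [h, b] at hi
      simp [w, h0, this]
    · simp [w, if_neg h0, u, dropFirst_apply, hi]
  have hew : ∀ v, inner ℝ e (w v) = 0 := fun v => by
    rw [inner_single_one]
    exact hwi v a (by simp [a])
  have hα : Measurable α := by
    refine (Complex.measurable_arg.comp ?_).neg
    have h1 : (fun v : Bos m => (⟨v a, ‖u v‖⟩ : ℂ)) = fun v => (v a : ℂ) + ‖u v‖ * Complex.I := by
      ext v
      apply Complex.ext <;> simp
    rw [h1]
    have := hu.measurable
    fun_prop
  have : IsFiniteMeasure (volume.restrict B) := by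
    refine ⟨?_⟩
    rw [Measure.restrict_apply_univ]
    exact (measure_mono fun v hv => hv.1).trans_lt
      (measure_closedBall_lt_top (x := (0 : Bos m)) (r := 1))
  obtain ⟨g, hg, hgN⟩ := smul_sub_average_mem hN h (volume.restrict B) a hw hw1 hew hα
    (A := Real.pi) fun v => by
      rw [abs_neg]
      exact Complex.abs_arg_le_pi _
  -- The angle is chosen so that the new coordinate at `a` is the component of `x` along the
  -- normalized projection of `v`. Since `h` sees only this, the earlier coordinates and the norm,
  -- the choice of `w` no longer matters.
  have hrot : ∀ v ∈ B, ∀ x, planeRot e (w v) (α v) x a =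
      inner ℝ (dropFirst j v) x / ‖dropFirst j v‖ := fun v hv x => by
    have hsq : ‖dropFirst j v‖ ^ 2 = v a ^ 2 + ‖u v‖ ^ 2 := by
      rw [norm_dropFirst_sq, norm_dropFirst_sq, inner_dropFirst_succ a]
      ring
    have hnorm : ‖(⟨v a, ‖u v‖⟩ : ℂ)‖ = ‖dropFirst j v‖ := by
      rw [Complex.norm_def, Complex.normSq_mk, ← pow_two, ← pow_two, ← hsq,
        Real.sqrt_sq (norm_nonneg _)]
    have hne : (⟨v a, ‖u v‖⟩ : ℂ) ≠ 0 := by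
      rw [← norm_ne_zero_iff, hnorm]
      exact norm_ne_zero_iff.2 hv.2
    rw [← inner_single_one, inner_left_planeRot he (hew v), Real.cos_neg, Real.sin_neg,
      Complex.cos_arg hne, Complex.sin_arg, hnorm]
    have h1 := inner_dropFirst_succ a v x
    have h2 : inner ℝ (dropFirst (a.val + 1) v) x = ‖u v‖ * inner ℝ (w v) x := by
      rw [← real_inner_smul_left, huw]
    rw [h2] at h1
    rw [show dropFirst j v = dropFirst a.val v from rfl, h1, inner_single_one]
    ring
  have hinv : DependsOnNormAndFirst j (extendZero ⊤ g.1) := fun x y hxy hn => by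
    -- This reflection takes `x` to `y`, as they have equal norms, and fixes the first `j`
    -- coordinate vectors, as `x` and `y` agree there. Substituting `v ↦ ρ v` identifies the two
    -- averages.
    let ρ := (Submodule.span ℝ {x - y})ᗮ.reflection
    have hρx : ρ x = y := by
      exact Submodule.reflection_sub hn
    have hρi : ∀ v (i : Fin m), i.val < j → ρ v i = v i := fun v i hi => by
      have h1 : ρ (EuclideanSpace.single i 1) = EuclideanSpace.single i 1 := by
        refine Submodule.reflection_mem_subspace_eq_self ?_
        rw [Submodule.mem_orthogonal_singleton_iff_inner_left, inner_single_one]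
        simp [hxy i hi]
      rw [← inner_single_one, ← inner_single_one, ← LinearIsometryEquiv.inner_map_map ρ _ v, h1]
    have hρn : ∀ v z, inner ℝ (dropFirst j (ρ v)) (ρ z) = inner ℝ (dropFirst j v) z := fun v z => by
      rw [inner_dropFirst, inner_dropFirst, LinearIsometryEquiv.inner_map_map]
      congr 1
      refine Finset.sum_congr rfl fun i _ => ?_
      split_ifs with hi
      · rw [hρi v i hi, hρi z i hi]
      · rfl
    have hρd : ∀ v, ‖dropFirst j (ρ v)‖ = ‖dropFirst j v‖ := fun v => by
      rw [← sq_eq_sq₀ (norm_nonneg _) (norm_nonneg _), norm_dropFirst_sq, norm_dropFirst_sq, hρn]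
    have hB : ρ ⁻¹' B = B := by
      ext v
      have h0 : dropFirst j (ρ v) = 0 ↔ dropFirst j v = 0 := by
        rw [← norm_eq_zero, hρd, norm_eq_zero]
      simp [B, h0]
    rw [hg, hg y, ← ρ.measurePreserving.setIntegral_preimage_emb
      ρ.toHomeomorph.measurableEmbedding
      (fun v => extendZero ⊤ h.1 (planeRot (EuclideanSpace.single a 1) (w v) (α v) y)) B, hB]
    refine setIntegral_congr_fun hBm fun v hv => ?_
    have hρv : ρ v ∈ B := by
      have : v ∈ ρ ⁻¹' B := by rwa [hB]
      exact this
    refine hh _ _ (fun i hi => ?_) ?_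
    · by_cases hia : i = a
      · subst hia
        refine (hrot v hv x).trans (Eq.trans ?_ (hrot _ hρv y).symm)
        rw [hρd, ← hρx, hρn]
      · have hi' : i.val < j := by
          have : i.val ≠ j := fun h => hia (Fin.ext h)
          omega
        rw [planeRot_apply_of_ne hia (hwi _ _ hi), planeRot_apply_of_ne hia (hwi _ _ hi),
          hxy i hi']
    · rw [norm_planeRot he (hw1 _) (hew _), norm_planeRot he (hw1 _) (hew _), hn]
  have hc : (volume.restrict B).real Set.univ ≠ 0 := by
    rw [Measure.real, Measure.restrict_apply_univ, ENNReal.toReal_ne_zero]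
    refine ⟨?_, fun h => ?_⟩
    · have hopen : IsOpen (Metric.ball 0 1 ∩ (fun v : Bos m => v a) ⁻¹' {0}ᶜ) :=
        Metric.isOpen_ball.inter (isOpen_compl_singleton.preimage (by fun_prop))
      have hne : (Metric.ball 0 1 ∩ (fun v : Bos m => v a) ⁻¹' {0}ᶜ).Nonempty := by
        refine ⟨(1 / 2 : ℝ) • e, ?_, by simp [e]⟩
        rw [mem_ball_zero_iff, norm_smul, he]
        norm_num
      have hsub : Metric.ball 0 1 ∩ (fun v : Bos m => v a) ⁻¹' {0}ᶜ ⊆ B := fun v hv => by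
        refine ⟨Metric.ball_subset_closedBall hv.1, fun h0 => hv.2 ?_⟩
        have := congrArg (fun z : Bos m => z a) (show dropFirst j v = 0 from h0)
        simpa [dropFirst_apply, a] using this
      exact ((hopen.measure_pos volume hne).trans_le (measure_mono hsub)).ne'
    · have := measure_lt_top (volume.restrict B) Set.univ
      rw [Measure.restrict_apply_univ, h] at this
      exact lt_irrefl _ this
  generalize (volume.restrict B).real Set.univ = c at hgN hc
  refine ⟨c⁻¹ • g, fun x y hxy hn => ?_, ?_⟩
  · have h1 : ∀ z : Bos m, extendZero ⊤ (c⁻¹ • g).1 z = c⁻¹ * extendZero ⊤ g.1 z := fun z =>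
      (extendZero_apply ⊤ _ ⟨z, trivial⟩).trans
        (congrArg (c⁻¹ * ·) (extendZero_apply ⊤ g.1 ⟨z, trivial⟩).symm)
    rw [h1, h1, hinv x y hxy hn]
  · have := N.smul_mem c⁻¹ hgN
    rwa [smul_sub, smul_smul, inv_mul_cancel₀ hc, one_smul] at this

/-- Averaging over the circle in the last two coordinates removes the dependence on both apart from
the norm, and each further step removes one more coordinate. -/
theorem exists_radial_sub_mem (hN : ∀ i j h, bosRot ⊤ i j h ∈ N) (hm : 2 ≤ m)
    (h : Smooth (⊤ : TopologicalSpace.Opens (Bos m))) :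
    ∃ g : Smooth (⊤ : TopologicalSpace.Opens (Bos m)),
      (∀ x y : Bos m, ‖x‖ = ‖y‖ → extendZero ⊤ g.1 x = extendZero ⊤ g.1 y) ∧ h - g ∈ N := by
  obtain ⟨k, rfl⟩ : ∃ k, m = k + 2 := ⟨m - 2, by omega⟩
  have key : ∀ j ≤ k, ∃ g : Smooth (⊤ : TopologicalSpace.Opens (Bos (k + 2))),
      DependsOnNormAndFirst (k - j) (extendZero ⊤ g.1) ∧ h - g ∈ N := fun j => by
    induction j with
    | zero => exact fun _ => exists_average_circle hN rfl h
    | succ j ih =>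
      intro hj
      obtain ⟨g, hg, hgN⟩ := ih (by omega)
      rw [show k - j = k - (j + 1) + 1 by omega] at hg
      obtain ⟨g', hg', hgN'⟩ := exists_average_step hN (by omega) g hg
      exact ⟨g', hg', by simpa using N.add_mem hgN hgN'⟩
  obtain ⟨g, hg, hgN⟩ := key k le_rfl
  exact ⟨g, fun x y hxy => hg x y (fun i hi => absurd hi (by omega)) hxy, hgN⟩

end Radial

/-! ### Primitives and division by `r² - L²` -/

section Hadamard

open MeasureTheory

theorem integral_unitInterval (g : ℝ → ℝ) : ∫ s : unitInterval, g s = ∫ s in (0 : ℝ)..1, g s := by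
  rw [intervalIntegral.integral_of_le zero_le_one, ← integral_Icc_eq_integral_Ioc]
  exact integral_subtype measurableSet_Icc g

/-- Parameter integrals over the unit interval are smooth. -/
theorem contDiff_integral_unitInterval {E : Type} [NormedAddCommGroup E] [NormedSpace ℝ E]
    [FiniteDimensional ℝ E] {H : ℝ × E → ℝ} (hH : ContDiff ℝ ∞ H) :
    ContDiff ℝ ∞ fun x => ∫ s in (0 : ℝ)..1, H (s, x) := by
  have h := contDiffOn_univ.1 (contDiffOn_integral_param (volume : Measure unitInterval)
    (ι := fun s => (s : ℝ)) measurable_subtype_coe (C := Set.Icc 0 1) isCompact_Icc (fun s => s.2)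
    isOpen_univ (W := Set.univ) isOpen_univ (Set.subset_univ _) hH.contDiffOn)
  have h2 : (fun x => ∫ s in (0 : ℝ)..1, H (s, x)) = fun x => ∫ s : unitInterval, H (s, x) :=
    funext fun x => (integral_unitInterval fun s => H (s, x)).symm
  rw [h2]
  exact h

/-- Hadamard's lemma on the line. -/
theorem exists_contDiff_eq_sub_mul {ψ : ℝ → ℝ} (hψ : ContDiff ℝ ∞ ψ) (L : ℝ) :
    ∃ k : ℝ → ℝ, ContDiff ℝ ∞ k ∧ ∀ t, ψ t - ψ L = (t - L) * k t := by
  have hd : ContDiff ℝ ∞ (deriv ψ) := (contDiff_infty_iff_deriv.1 hψ).2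
  refine ⟨fun t => ∫ s in (0 : ℝ)..1, deriv ψ (L + s * (t - L)),
    contDiff_integral_unitInterval (H := fun z : ℝ × ℝ => deriv ψ (L + z.1 * (z.2 - L)))
      (hd.comp (by fun_prop)), fun t => ?_⟩
  have h1 : ∀ s : ℝ, HasDerivAt (fun s : ℝ => ψ (L + s * (t - L)))
      ((t - L) * deriv ψ (L + s * (t - L))) s := fun s => by
    have h2 : HasDerivAt (fun s : ℝ => L + s * (t - L)) (t - L) s := by
      simpa using ((hasDerivAt_id s).mul_const (t - L)).const_add L
    have h3 := (hψ.differentiable (by simp) (L + s * (t - L))).hasDerivAt.comp s h2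
    exact h3.congr_deriv (mul_comm _ _)
  have h2 := intervalIntegral.integral_eq_sub_of_hasDerivAt (a := 0) (b := 1) (fun s _ => h1 s)
    ((continuous_const.mul (hd.continuous.comp (by fun_prop))).intervalIntegrable _ _)
  rw [intervalIntegral.integral_const_mul] at h2
  rw [h2]
  simp

variable {m : ℕ}

/-- Every smooth function on `ℝ^m` has a smooth primitive in a given coordinate. -/
theorem exists_bosDeriv_eq (i : Fin m) (h : Smooth (⊤ : TopologicalSpace.Opens (Bos m))) :
    ∃ F, bosDeriv ⊤ i F = h := by
  set f := extendZero ⊤ h.1 with hf_def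
  have hf : ContDiff ℝ ∞ f := Smooth.contDiff_top h
  let e : Bos m := EuclideanSpace.single i 1
  have hx : ContDiff ℝ ∞ fun x : Bos m => x i :=
    (EuclideanSpace.proj (𝕜 := ℝ) i : Bos m →L[ℝ] ℝ).contDiff
  -- The integral from `0` to `x_i`, rescaled to a fixed interval so that smoothness follows from
  -- the parameter integral.
  let G : Bos m → ℝ := fun x => x i * ∫ s in (0 : ℝ)..1, f (x - x i • e + (s * x i) • e)
  have hG : ContDiff ℝ ∞ G := by
    refine hx.mul (contDiff_integral_unitInterval
      (H := fun z : ℝ × Bos m => f (z.2 - z.2 i • e + (z.1 * z.2 i) • e)) (hf.comp ?_))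
    have hx2 : ContDiff ℝ ∞ fun z : ℝ × Bos m => z.2 i := hx.comp contDiff_snd
    fun_prop
  refine ⟨Smooth.mk ⊤ G hG.contDiffOn, ?_⟩
  ext x
  obtain ⟨x, hxt⟩ := x
  rw [bosDeriv_mk_apply]
  have hline : ∀ t : ℝ, G (x + t • e) = ∫ u in (0 : ℝ)..(x i + t), f (x - x i • e + u • e) := by
    intro t
    have h1 : (x + t • e) i = x i + t := by simp [e]
    have h2 : x + t • e - (x i + t) • e = x - x i • e := by module
    simp only [G, h1, h2]
    have h3 := intervalIntegral.mul_integral_comp_mul_right (a := 0) (b := 1)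
      (f := fun u => f (x - x i • e + u • e)) (x i + t)
    simpa using h3
  have hc : Continuous fun u : ℝ => f (x - x i • e + u • e) := hf.continuous.comp (by fun_prop)
  have h1 : HasDerivAt (fun t : ℝ => ∫ u in (0 : ℝ)..(x i + t), f (x - x i • e + u • e)) (f x) 0 := by
    have h2 := hc.integral_hasStrictDerivAt 0 (x i + 0)
    have h3 : HasDerivAt (fun t : ℝ => x i + t) 1 0 := (hasDerivAt_id 0).const_add (x i)
    have h4 := h2.hasDerivAt.comp (0 : ℝ) h3
    refine h4.congr_deriv ?_
    simp
  have h2 : HasDerivAt (fun t : ℝ => G (x + t • e)) (fderiv ℝ G x e) 0 := by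
    have h3 : HasDerivAt (fun t : ℝ => x + t • e) e 0 := by
      simpa using ((hasDerivAt_id (0 : ℝ)).smul_const e).const_add x
    have h4 : HasFDerivAt G (fderiv ℝ G x) (x + (0 : ℝ) • e) := by
      rw [zero_smul, add_zero]
      exact (hG.differentiable (by simp) x).hasFDerivAt
    exact h4.comp_hasDerivAt (0 : ℝ) h3
  simp only [hline] at h2
  exact (h2.unique h1).trans (extendZero_apply ⊤ h.1 ⟨x, hxt⟩)

/-- `r² - L²`. -/
def sphereEq (m : ℕ) (L : ℝ) : Smooth (⊤ : TopologicalSpace.Opens (Bos m)) :=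
  bosSq ⊤ - L ^ 2 • 1

theorem sphereEq_apply (L : ℝ) (x : (⊤ : TopologicalSpace.Opens (Bos m))) :
    (sphereEq m L).1 x = ‖(x : Bos m)‖ ^ 2 - L ^ 2 := by
  have h1 := bosSq_apply x
  change (bosSq ⊤).1 x - L ^ 2 * 1 = _
  rw [h1, mul_one]

/-- Rotation invariance of a function. -/
def IsRadial (h : Smooth (⊤ : TopologicalSpace.Opens (Bos m))) : Prop :=
  ∀ x y : Bos m, ‖x‖ = ‖y‖ → extendZero ⊤ h.1 x = extendZero ⊤ h.1 y

/-- Division with remainder of a radial function by `r² - L²`. -/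
theorem IsRadial.exists_eq_add_sphereEq_mul (i : Fin m) {L : ℝ} (hL : 0 < L)
    {h : Smooth (⊤ : TopologicalSpace.Opens (Bos m))} (hh : IsRadial h) :
    ∃ (c : ℝ) (g : Smooth (⊤ : TopologicalSpace.Opens (Bos m))), IsRadial g ∧
      h = c • 1 + sphereEq m L * g := by
  set f := extendZero ⊤ h.1 with hf_def
  have hf : ContDiff ℝ ∞ f := Smooth.contDiff_top h
  let e : Bos m := EuclideanSpace.single i 1
  have he : ‖e‖ = 1 := by simp [e]
  obtain ⟨k, hk, hkψ⟩ := exists_contDiff_eq_sub_mul (ψ := fun t => f (t • e))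
    (hf.comp (by fun_prop)) L
  have hfk : ∀ x, f x - f (L • e) = (‖x‖ ^ 2 - L ^ 2) * (k ‖x‖ / (‖x‖ + L)) := fun x => by
    have h1 := hkψ ‖x‖
    have h2 : f (‖x‖ • e) = f x := hh _ _ (by rw [norm_smul, he, norm_norm, mul_one])
    have h3 : ‖x‖ + L ≠ 0 := (add_pos_of_nonneg_of_pos (norm_nonneg x) hL).ne'
    rw [← h2]
    rw [h1]
    field_simp
    ring
  have hg : ContDiff ℝ ∞ fun x : Bos m => k ‖x‖ / (‖x‖ + L) := by
    rw [contDiff_iff_contDiffAt]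
    intro x
    -- The norm is not smooth at the origin; there the quotient is recognized as `(f - f(L e)) / (r²
    -- - L²)`, whose denominator does not vanish inside the ball of radius `L`.
    by_cases hx : x = 0
    · have h1 : ∀ᶠ y in nhds x, (f y - f (L • e)) / (‖y‖ ^ 2 - L ^ 2) = k ‖y‖ / (‖y‖ + L) := by
        have : Metric.ball (0 : Bos m) L ∈ nhds x := by
          rw [hx]
          exact Metric.ball_mem_nhds _ hL
        filter_upwards [this] with y hy
        rw [mem_ball_zero_iff] at hy
        have h2 : ‖y‖ ^ 2 - L ^ 2 ≠ 0 := by nlinarith [norm_nonneg y]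
        rw [hfk, mul_div_cancel_left₀ _ h2]
      refine ContDiffAt.congr_of_eventuallyEq ?_ (h1.mono fun y hy => hy.symm)
      refine ContDiffAt.div (hf.contDiffAt.sub contDiffAt_const)
        ((contDiff_norm_sq ℝ).contDiffAt.sub contDiffAt_const) ?_
      rw [hx, norm_zero]
      have := pow_pos hL 2
      simp [hL.ne']
    · have h1 : ContDiffAt ℝ ∞ (fun y : Bos m => ‖y‖) x := contDiffAt_norm ℝ hx
      refine ContDiffAt.div (hk.contDiffAt.comp x h1) (h1.add contDiffAt_const) ?_
      exact (add_pos_of_nonneg_of_pos (norm_nonneg x) hL).ne'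
  refine ⟨f (L • e), Smooth.mk ⊤ _ hg.contDiffOn, fun x y hxy => ?_, ?_⟩
  · have h1 := fun z : Bos m => extendZero_apply ⊤ (Smooth.mk ⊤ _ hg.contDiffOn).1 ⟨z, trivial⟩
    refine (h1 x).trans (Eq.trans ?_ (h1 y).symm)
    simp only [Smooth.mk, hxy]
  · ext x
    have h1 := hfk x
    have h2 : f x = h.1 x := extendZero_apply ⊤ h.1 x
    change h.1 x = f (L • e) * 1 + (sphereEq m L).1 x * (k ‖(x : Bos m)‖ / (‖(x : Bos m)‖ + L))
    rw [sphereEq_apply, ← h1, h2]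
    ring

end Hadamard

/-! ### Codimension at most one -/

section Reduction

variable {m n : ℕ} {N : Submodule ℝ (SuperFun n (⊤ : TopologicalSpace.Opens (Bos m)))}

/-- The span of the words of length at most `k`. -/
def wordSpan (n k : ℕ) : Submodule ℝ (Grass n) :=
  Submodule.span ℝ {b | ∃ l : List (FermIdx n), l.length ≤ k ∧ grassWord l = b}

theorem wordSpan_mono {k k' : ℕ} (h : k ≤ k') : wordSpan n k ≤ wordSpan n k' :=
  Submodule.span_mono fun _ ⟨l, hl, hb⟩ => ⟨l, hl.trans h, hb⟩

theorem grassWord_mem_wordSpan (l : List (FermIdx n)) : grassWord l ∈ wordSpan n l.length :=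
  Submodule.subset_span ⟨l, le_rfl, rfl⟩

theorem grassGen_mul_mem_wordSpan (a : FermIdx n) {k : ℕ} {b : Grass n} (hb : b ∈ wordSpan n k) :
    grassGen a * b ∈ wordSpan n (k + 1) := by
  suffices h : wordSpan n k ≤ (wordSpan n (k + 1)).comap (LinearMap.mulLeft ℝ (grassGen a)) from
    h hb
  refine Submodule.span_le.2 ?_
  rintro _ ⟨l, hl, rfl⟩
  exact Submodule.subset_span ⟨a :: l, by simpa using hl, grassWord_cons a l⟩

/-- A contraction in fact shortens words; for the induction it suffices that it does not lengthen
them, since a letter has already been split off. -/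
theorem grassContract_word_mem (d : Module.Dual ℝ (FermIdx n → ℝ)) (l : List (FermIdx n)) :
    grassContract d (grassWord l) ∈ wordSpan n l.length := by
  induction l with
  | nil =>
    have : grassContract d (grassWord ([] : List (FermIdx n))) = 0 := grassContract_one d
    rw [this]
    exact Submodule.zero_mem _
  | cons a l ih =>
    rw [grassWord_cons, grassContract_gen_mul]
    exact Submodule.sub_mem _ (Submodule.smul_mem _ _
      (wordSpan_mono (by simp) (grassWord_mem_wordSpan l))) (grassGen_mul_mem_wordSpan a ih)

/-- The ordinary functions in a submodule of superfunctions. -/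
def bosPart (N : Submodule ℝ (SuperFun n (⊤ : TopologicalSpace.Opens (Bos m)))) :
    Submodule ℝ (Smooth (⊤ : TopologicalSpace.Opens (Bos m))) :=
  N.comap ((SuperFun.tmulₗ n ⊤).flip 1)

theorem mem_bosPart {h : Smooth (⊤ : TopologicalSpace.Opens (Bos m))} :
    h ∈ bosPart N ↔ SuperFun.tmul h 1 ∈ N := Iff.rfl

/-- Modulo the image of `osp(m|2n)` every superfunction is an ordinary function. -/
theorem exists_sub_tmul_one_mem (hosp : ∀ i j f, ospGen i j f ∈ N) (i : Fin m)
    (f : SuperFun n (⊤ : TopologicalSpace.Opens (Bos m))) :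
    ∃ h, f - SuperFun.tmul h 1 ∈ N := by
  let Q := N ⊔ LinearMap.range ((SuperFun.tmulₗ n (⊤ : TopologicalSpace.Opens (Bos m))).flip 1)
  have hQ : ∀ h, SuperFun.tmul h 1 ∈ Q := fun h => Submodule.mem_sup_right ⟨h, rfl⟩
  have key : ∀ k, ∀ b ∈ wordSpan n k, ∀ h, SuperFun.tmul h b ∈ Q := by
    intro k
    induction k with
    | zero =>
      intro b hb h
      suffices hs : wordSpan n 0 ≤ Q.comap (SuperFun.tmulₗ n ⊤ h) from hs hb
      refine Submodule.span_le.2 ?_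
      rintro _ ⟨l, hl, rfl⟩
      obtain rfl : l = [] := by simpa using hl
      exact hQ h
    | succ k ih =>
      intro b hb h
      suffices hs : wordSpan n (k + 1) ≤ Q.comap (SuperFun.tmulₗ n ⊤ h) from hs hb
      refine Submodule.span_le.2 ?_
      rintro _ ⟨l, hl, rfl⟩
      cases l with
      | nil => exact hQ h
      | cons a l =>
        have hl' : l.length ≤ k := by simpa using hl
        -- With `h = ∂_i F`, the mixed generator trades `∂_i F ⊗ x̀_a w` for `x_i F ⊗ ∂^a w`, which
        -- removes the letter `x̀_a`.
        obtain ⟨F, rfl⟩ := exists_bosDeriv_eq i h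
        have h1 := ospGen_inl_inr i a F (grassWord l)
        have h2 : SuperFun.tmul (bosDeriv ⊤ i F) (grassGen a * grassWord l) =
            SuperFun.tmul (bosCoord ⊤ i * F) (grassDerivUp a (grassWord l)) -
              ospGen (.inl i) (.inr a) (SuperFun.tmul F (grassWord l)) := by
          rw [h1, sub_sub_cancel]
        change SuperFun.tmul (bosDeriv ⊤ i F) (grassWord (a :: l)) ∈ Q
        rw [grassWord_cons, h2]
        refine Q.sub_mem (ih _ ?_ _) (Submodule.mem_sup_left (hosp _ _ _))
        rw [grassDerivUp_eq]
        exact wordSpan_mono hl' (grassContract_word_mem _ l)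
  have hf : f ∈ Q := by
    induction f using SuperFun.induction with
    | h0 => exact Q.zero_mem
    | ht h b =>
      exact grassWord_induction (p := Q.comap (SuperFun.tmulₗ n ⊤ h))
        (fun l => key _ _ (grassWord_mem_wordSpan l) h) b
    | ha x y hx hy => exact Q.add_mem hx hy
  obtain ⟨y, hy, _, ⟨h, rfl⟩, rfl⟩ := Submodule.mem_sup.1 hf
  refine ⟨h, ?_⟩
  have : y + ((SuperFun.tmulₗ n (⊤ : TopologicalSpace.Opens (Bos m))).flip 1) h -
      SuperFun.tmul h 1 = y := add_sub_cancel_right _ _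
  rwa [this]

theorem bosRot_mem_bosPart (hosp : ∀ i j f, ospGen i j f ∈ N) (i j : Fin m)
    (h : Smooth (⊤ : TopologicalSpace.Opens (Bos m))) : bosRot ⊤ i j h ∈ bosPart N := by
  rw [mem_bosPart, ← ospGen_inl_inl]
  exact hosp _ _ _

variable {L : ℝ}

/-- Since `R² - L² = (r² - L²) + θ²`, multiplication by `θ²` equals multiplication by `-(r² - L²)`
modulo `N`. -/
theorem tmul_thetaSq_mul_add_mem (hR : ∀ f, RSq m n * f - L ^ 2 • f ∈ N)
    (h : Smooth (⊤ : TopologicalSpace.Opens (Bos m))) (b : Grass n) :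
    SuperFun.tmul h (thetaSq n * b) + SuperFun.tmul (sphereEq m L * h) b ∈ N := by
  have h1 := hR (SuperFun.tmul h b)
  have h2 : RSq m n * SuperFun.tmul h b - L ^ 2 • SuperFun.tmul h b =
      SuperFun.tmul h (thetaSq n * b) + SuperFun.tmul (sphereEq m L * h) b := by
    rw [RSq_eq, add_mul, SuperFun.tmul_mul_tmul, SuperFun.tmul_mul_tmul, one_mul, one_mul, sphereEq,
      sub_mul, SuperFun.sub_tmul, smul_mul_assoc, one_mul, SuperFun.smul_tmul]
    abel
  rwa [h2] at h1

theorem tmul_thetaSq_pow_sub_mem (hR : ∀ f, RSq m n * f - L ^ 2 • f ∈ N) (k : ℕ)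
    (h : Smooth (⊤ : TopologicalSpace.Opens (Bos m))) :
    SuperFun.tmul h (thetaSq n ^ k) -
      (-1 : ℝ) ^ k • SuperFun.tmul (sphereEq m L ^ k * h) 1 ∈ N := by
  induction k generalizing h with
  | zero => simp
  | succ k ih =>
    have h1 := tmul_thetaSq_mul_add_mem hR h (thetaSq n ^ k)
    have h2 := ih (sphereEq m L * h)
    have h3 := N.sub_mem h1 h2
    rw [← pow_succ', ← mul_assoc (sphereEq m L ^ k), ← pow_succ] at h3
    convert h3 using 1
    rw [pow_succ (-1 : ℝ)]
    module

theorem sphereEq_pow_mul_mem_bosPart (hR : ∀ f, RSq m n * f - L ^ 2 • f ∈ N)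
    (h : Smooth (⊤ : TopologicalSpace.Opens (Bos m))) :
    sphereEq m L ^ (n + 1) * h ∈ bosPart N := by
  have h1 := tmul_thetaSq_pow_sub_mem hR (n + 1) h
  rw [thetaSq_pow_eq_zero (Nat.lt_succ_self n), SuperFun.tmul_zero, zero_sub] at h1
  have h2 := N.smul_mem ((-1 : ℝ) ^ (n + 1)) (N.neg_mem h1)
  rw [neg_neg, smul_smul, ← mul_pow, neg_mul_neg, one_mul, one_pow, one_smul] at h2
  exact h2

theorem grassDerivUp_gen (j : Fin n) : grassDerivUp (j, 0) (grassGen (j, 1)) = (2 : ℝ) • (1 : Grass n) := by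
  have h1 := grassContract_gen_mul (upCovector (j, 0)) (j, 1) (1 : Grass n)
  rw [grassContract_one, mul_zero, sub_zero, mul_one] at h1
  rw [grassDerivUp_eq, h1, upCovector_single]
  simp [symplecticJInv]

/-- Applying the mixed generator for `(j, 0)` to `F x̀_{(j,1)}` relates `∂_i F` times a pair to `2
x_i F`. Summing over the `n` pairs produces `θ²`, which is then traded for `-(r² - L²)`. -/
theorem sphereEq_mul_bosDeriv_sub_mem (hosp : ∀ i j f, ospGen i j f ∈ N)
    (hR : ∀ f, RSq m n * f - L ^ 2 • f ∈ N) (i : Fin m)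
    (F : Smooth (⊤ : TopologicalSpace.Opens (Bos m))) :
    sphereEq m L * bosDeriv ⊤ i F - (2 * n : ℝ) • (bosCoord ⊤ i * F) ∈ bosPart N := by
  have h1 : ∀ j : Fin n, SuperFun.tmul (bosDeriv ⊤ i F) (grassPair j) -
      (2 : ℝ) • SuperFun.tmul (bosCoord ⊤ i * F) 1 ∈ N := fun j => by
    have h2 := N.neg_mem (hosp (.inl i) (.inr (j, 0)) (SuperFun.tmul F (grassGen (j, 1))))
    rw [ospGen_inl_inr, grassDerivUp_gen, SuperFun.tmul_smul, neg_sub] at h2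
    exact h2
  have h2 : SuperFun.tmul (bosDeriv ⊤ i F) (thetaSq n) +
      (2 * n : ℝ) • SuperFun.tmul (bosCoord ⊤ i * F) 1 ∈ N := by
    have h3 := N.neg_mem (N.sum_mem (t := Finset.univ) fun j _ => h1 j)
    rw [Finset.sum_sub_distrib, ← SuperFun.tmul_sum, Finset.sum_const, Finset.card_univ,
      Fintype.card_fin] at h3
    have h4 : ∑ j, grassPair j = -thetaSq n := by
      rw [thetaSq_eq, neg_neg, ← List.sum_toFinset _ (List.nodup_finRange n), List.toFinset_finRange]
    rw [h4] at h3
    convert h3 using 1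
    rw [← Nat.cast_smul_eq_nsmul ℝ, smul_smul, neg_sub, sub_eq_add_neg, add_comm, mul_comm]
    congr 1
    rw [← neg_one_smul ℝ (thetaSq n), SuperFun.tmul_smul, neg_one_smul, neg_neg]
  have h3 := N.sub_mem (tmul_thetaSq_mul_add_mem hR (bosDeriv ⊤ i F) 1) h2
  rw [mul_one, add_sub_add_left_eq_sub, ← SuperFun.smul_tmul, ← SuperFun.sub_tmul] at h3
  exact h3

theorem bosDeriv_sphereEq (i : Fin m) :
    bosDeriv ⊤ i (sphereEq m L) = (2 : ℝ) • bosCoord ⊤ i := by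
  rw [sphereEq, map_sub, map_smul, bosDeriv_bosSq]
  have : bosDeriv ⊤ i (1 : Smooth (⊤ : TopologicalSpace.Opens (Bos m))) = 0 := Smooth.deriv_one _
  rw [this, smul_zero, sub_zero]

theorem sphereEq_mul_bosDeriv_pow (i : Fin m) (k : ℕ) :
    sphereEq m L * bosDeriv ⊤ i (sphereEq m L ^ k) =
      (2 * k : ℝ) • (bosCoord ⊤ i * sphereEq m L ^ k) := by
  induction k with
  | zero =>
    have : bosDeriv ⊤ i (1 : Smooth (⊤ : TopologicalSpace.Opens (Bos m))) = 0 := Smooth.deriv_one _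
    rw [pow_zero, this]
    simp
  | succ k ih =>
    rw [pow_succ', bosDeriv_mul, bosDeriv_sphereEq, mul_add, mul_left_comm, mul_left_comm, ih]
    simp only [Algebra.smul_mul_assoc, Algebra.mul_smul_comm, Nat.cast_add, Nat.cast_one]
    have h1 : sphereEq m L * (bosCoord ⊤ i * sphereEq m L ^ k) =
      bosCoord ⊤ i * (sphereEq m L * sphereEq m L ^ k) := mul_left_comm _ _ _
    rw [h1]
    module

/-- The recursion for the powers of `r² - L²`. -/
theorem sphereEq_pow_recursion (hosp : ∀ i j f, ospGen i j f ∈ N)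
    (hR : ∀ f, RSq m n * f - L ^ 2 • f ∈ N) (k : ℕ) :
    ((m : ℝ) + 2 * k - 2 * n) • sphereEq m L ^ (k + 1) +
      (2 * ((k : ℝ) - n) * L ^ 2) • sphereEq m L ^ k ∈ bosPart N := by
  -- The relation is used for `F = x_i s^k` with `s = r² - L²` and summed over `i`, so that `∑ x_i²
  -- = s + L²` turns it into a relation between powers of `s`.
  have h1 := (bosPart N).sum_mem (t := Finset.univ) fun i _ =>
    sphereEq_mul_bosDeriv_sub_mem hosp hR i (bosCoord ⊤ i * sphereEq m L ^ k)
  convert h1 using 1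
  have h2 : ∀ i : Fin m, sphereEq m L * bosDeriv ⊤ i (bosCoord ⊤ i * sphereEq m L ^ k) -
      (2 * n : ℝ) • (bosCoord ⊤ i * (bosCoord ⊤ i * sphereEq m L ^ k)) =
      sphereEq m L ^ (k + 1) +
        (2 * ((k : ℝ) - n)) • (bosCoord ⊤ i * bosCoord ⊤ i * sphereEq m L ^ k) := fun i => by
    have h3 : bosDeriv ⊤ i (bosCoord ⊤ i) = (1 : Smooth (⊤ : TopologicalSpace.Opens (Bos m))) := by
      rw [bosDeriv_bosCoord]
      simp
    rw [bosDeriv_mul, h3, one_mul, mul_add, mul_left_comm, sphereEq_mul_bosDeriv_pow, ← pow_succ',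
      Algebra.mul_smul_comm, mul_assoc]
    module
  simp only [h2]
  rw [Finset.sum_add_distrib, ← Finset.smul_sum, ← Finset.sum_mul, Finset.sum_const,
    Finset.card_univ, Fintype.card_fin, ← Nat.cast_smul_eq_nsmul ℝ]
  have h4 : (∑ i, bosCoord ⊤ i * bosCoord ⊤ i) * sphereEq m L ^ k =
      sphereEq m L ^ (k + 1) + L ^ 2 • sphereEq m L ^ k := by
    have h5 : (∑ i, bosCoord ⊤ i * bosCoord ⊤ i) = sphereEq m L + L ^ 2 • 1 := by
      rw [sphereEq, sub_add_cancel]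
      rfl
    rw [h5, add_mul, ← pow_succ', Algebra.smul_mul_assoc, one_mul]
  rw [h4]
  module

/-- A submodule that contains the images of `osp(m|2n)` and of `R² - L²` has codimension at most one
if it contains enough functions to make every function radial. -/
theorem exists_sub_smul_thetaSq_pow_mem (hm : m ≠ 0) (hL : 0 < L)
    (hosp : ∀ i j f, ospGen i j f ∈ N) (hR : ∀ f, RSq m n * f - L ^ 2 • f ∈ N)
    (hrad : ∀ h, ∃ g, IsRadial g ∧ h - g ∈ bosPart N)
    (f : SuperFun n (⊤ : TopologicalSpace.Opens (Bos m))) :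
    ∃ c : ℝ, f - c • SuperFun.tmul 1 (thetaSq n ^ n) ∈ N := by
  let i : Fin m := ⟨0, Nat.pos_of_ne_zero hm⟩
  let W := bosPart N ⊔ (ℝ ∙ sphereEq m L ^ n)
  -- The recursion is run downwards from `n`. It divides by `2(k - n)L²`, nonzero for `k < n`; the
  -- other coefficient `m + 2k - 2n` may vanish without harm.
  have hpow : ∀ d k, k + d = n → sphereEq m L ^ k ∈ W := fun d => by
    induction d with
    | zero =>
      rintro k rfl
      exact Submodule.mem_sup_right (Submodule.mem_span_singleton_self _)
    | succ d ih =>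
      intro k hk
      have h1 := ih (k + 1) (by omega)
      have h2 : _ ∈ W := Submodule.mem_sup_left (sphereEq_pow_recursion hosp hR k)
      have h3 := W.sub_mem h2 (W.smul_mem ((m : ℝ) + 2 * k - 2 * n) h1)
      rw [add_sub_cancel_left] at h3
      have hkn : (k : ℝ) - n ≠ 0 := by
        rw [sub_ne_zero]
        exact_mod_cast (by omega : k ≠ n)
      have hc : 2 * ((k : ℝ) - n) * L ^ 2 ≠ 0 := mul_ne_zero (mul_ne_zero two_ne_zero hkn)
        (pow_ne_zero 2 hL.ne')
      exact (W.smul_mem_iff hc).1 h3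
  -- Each division by `r² - L²` gains a power and leaves a constant remainder; at exponent `n + 1`
  -- the product already lies in `N`.
  have hradial : ∀ d k, k + d = n + 1 → ∀ g, IsRadial g → sphereEq m L ^ k * g ∈ W := fun d => by
    induction d with
    | zero =>
      rintro k hk g -
      obtain rfl : k = n + 1 := by omega
      exact Submodule.mem_sup_left (sphereEq_pow_mul_mem_bosPart hR g)
    | succ d ih =>
      intro k hk g hg
      obtain ⟨c, g', hg', rfl⟩ := hg.exists_eq_add_sphereEq_mul i hL
      rw [mul_add, Algebra.mul_smul_comm, mul_one, ← mul_assoc, ← pow_succ]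
      exact W.add_mem (W.smul_mem c (hpow d k (by omega))) (ih (k + 1) (by omega) g' hg')
  obtain ⟨h, hh⟩ := exists_sub_tmul_one_mem hosp i f
  obtain ⟨g, hg, hgN⟩ := hrad h
  have hgW := hradial (n + 1) 0 (by omega) g hg
  rw [pow_zero, one_mul] at hgW
  obtain ⟨y, hy, _, hz, hyz⟩ := Submodule.mem_sup.1 hgW
  obtain ⟨c, rfl⟩ := Submodule.mem_span_singleton.1 hz
  -- The sign comes from `s^n ≡ (-1)^n θ^{2n}` modulo `N`.
  refine ⟨c * (-1) ^ n, ?_⟩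
  have h1 := tmul_thetaSq_pow_sub_mem hR n (1 : Smooth (⊤ : TopologicalSpace.Opens (Bos m)))
  rw [mul_one] at h1
  have h2 := N.sub_mem (N.add_mem (N.add_mem hh hgN) hy) (N.smul_mem (c * (-1) ^ n) h1)
  convert h2 using 1
  have h3 : SuperFun.tmul g (1 : Grass n) = SuperFun.tmul y 1 + c • SuperFun.tmul (sphereEq m L ^ n) 1 := by
    rw [← hyz, SuperFun.add_tmul, SuperFun.smul_tmul]
  have h4 : ((SuperFun.tmulₗ n (⊤ : TopologicalSpace.Opens (Bos m))).flip 1) (h - g) =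
    SuperFun.tmul h 1 - SuperFun.tmul g 1 := SuperFun.sub_tmul _ _ _
  have h5 : ((SuperFun.tmulₗ n (⊤ : TopologicalSpace.Opens (Bos m))).flip 1) y =
    SuperFun.tmul y 1 := rfl
  rw [h4, h5, h3, smul_sub, smul_smul, mul_assoc, ← mul_pow, neg_mul_neg, one_mul, one_pow, mul_one]
  abel

end Reduction

/-! ### Uniqueness of the supersphere integral -/

section Uniqueness

variable {m n : ℕ}

theorem bosPullback_apply (A : Matrix (Fin m) (Fin m) ℝ)
    (h : Smooth (⊤ : TopologicalSpace.Opens (Bos m))) (x : Bos m) :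
    extendZero ⊤ (bosPullback A h).1 x =
      extendZero ⊤ h.1 (Matrix.toEuclideanCLM (𝕜 := ℝ) A x) :=
  extendZero_apply ⊤ _ ⟨x, trivial⟩

theorem groupAct_one_one : (groupAct 1 1 :
    Module.End ℝ (SuperFun n (⊤ : TopologicalSpace.Opens (Bos m)))) = 1 := by
  refine SuperFun.linearMap_ext fun h b => ?_
  have h1 : bosPullback (1 : Matrix (Fin m) (Fin m) ℝ) h = h := by
    refine Smooth.ext_extendZero fun x hx => ?_
    rw [bosPullback_apply, map_one]
    rfl
  have h2 : grassPullback (1 : Matrix (FermIdx n) (FermIdx n) ℝ) = AlgHom.id ℝ (Grass n) := by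
    rw [grassPullback]
    have : (1 : Matrix (FermIdx n) (FermIdx n) ℝ).vecMulLinear = LinearMap.id := by
      ext
      simp
    rw [this, ExteriorAlgebra.map_id]
  rw [groupAct, SuperFun.map_tmul, inv_one, inv_one, h1, h2]
  rfl

theorem one_mem_Sp : (1 : Matrix (FermIdx n) (FermIdx n) ℝ) ∈ Sp n := by
  simp [Sp]

theorem IsInvariant.apply_ospGen {V : Type*} [AddCommGroup V] [Module ℝ V]
    {K : Set (Matrix (Fin m) (Fin m) ℝ)} (hK : 1 ∈ K)
    {T : SuperFun n (⊤ : TopologicalSpace.Opens (Bos m)) →ₗ[ℝ] V} (hT : IsInvariant K T)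
    (i j : Idx m n) (f : SuperFun n (⊤ : TopologicalSpace.Opens (Bos m))) :
    T (ospGen i j f) = 0 := by
  have h := hT 1 hK 1 one_mem_Sp [ospGen i j] (fun X hX => by
    rw [List.mem_singleton.1 hX]
    exact Submodule.subset_span ⟨(i, j), rfl⟩) f
  simpa [groupAct_one_one] using h

theorem IsInvariant.apply_groupAct {V : Type*} [AddCommGroup V] [Module ℝ V]
    {K : Set (Matrix (Fin m) (Fin m) ℝ)} {A : Matrix (Fin m) (Fin m) ℝ} (hA : A ∈ K)
    {T : SuperFun n (⊤ : TopologicalSpace.Opens (Bos m)) →ₗ[ℝ] V} (hT : IsInvariant K T)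
    (f : SuperFun n (⊤ : TopologicalSpace.Opens (Bos m))) : T (groupAct A 1 f) = T f := by
  simpa using hT A hA 1 one_mem_Sp [] (by simp) f

/-- On the line the even part of a function is radial. -/
theorem exists_radial_sub_mem_one
    {N : Submodule ℝ (SuperFun n (⊤ : TopologicalSpace.Opens (Bos 1)))}
    (hN : ∀ f, groupAct (-1) 1 f - f ∈ N) (h : Smooth (⊤ : TopologicalSpace.Opens (Bos 1))) :
    ∃ g, IsRadial g ∧ h - g ∈ bosPart N := by
  let k := bosPullback (-1 : Matrix (Fin 1) (Fin 1) ℝ) h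
  have hinv : (-1 : Matrix (Fin 1) (Fin 1) ℝ)⁻¹ = -1 := Matrix.inv_eq_right_inv (by simp)
  have hk : ∀ x, extendZero ⊤ k.1 x = extendZero ⊤ h.1 (-x) := fun x => by
    rw [bosPullback_apply, map_neg, map_one]
    rfl
  have hg : ∀ x : Bos 1, extendZero ⊤ ((1 / 2 : ℝ) • (h + k)).1 x =
      1 / 2 * (extendZero ⊤ h.1 x + extendZero ⊤ h.1 (-x)) := fun x => by
    rw [← hk]
    have h1 := fun f : Smooth (⊤ : TopologicalSpace.Opens (Bos 1)) =>
      extendZero_apply ⊤ f.1 ⟨x, trivial⟩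
    rw [h1 h, h1 k, h1]
    rfl
  refine ⟨(1 / 2 : ℝ) • (h + k), fun x y hxy => ?_, ?_⟩
  · have h1 : x = y ∨ x = -y := by
      have h2 : |x 0| = |y 0| := by simpa [EuclideanSpace.norm_eq, Real.sqrt_sq_eq_abs] using hxy
      rcases abs_eq_abs.1 h2 with h3 | h3
      · left
        ext i
        rwa [Subsingleton.elim i 0]
      · right
        ext i
        rw [Subsingleton.elim i 0]
        exact h3
    rw [hg, hg]
    rcases h1 with rfl | rfl
    · rfl
    · rw [neg_neg, add_comm]
  · have h1 := N.smul_mem (-(1 / 2) : ℝ) (hN (SuperFun.tmul h 1))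
    rw [groupAct, SuperFun.map_tmul, hinv, AlgHom.toLinearMap_apply, map_one, ← SuperFun.sub_tmul,
      ← SuperFun.smul_tmul] at h1
    have h2 : h - (1 / 2 : ℝ) • (h + k) = (-(1 / 2) : ℝ) • (k - h) := by module
    rw [h2]
    exact h1

/-- An invariant functional that is compatible with `R²` is a multiple of the supersphere
integral. -/
theorem exists_eq_mul_superInt (hm : m ≠ 0) {K : Set (Matrix (Fin m) (Fin m) ℝ)}
    (hK : K ⊆ Matrix.orthogonalGroup (Fin m) ℝ) (hK1 : 1 ∈ K) (hKm : 2 ≤ m ∨ m = 1 ∧ -1 ∈ K)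
    {T : SuperFun n (⊤ : TopologicalSpace.Opens (Bos m)) →ₗ[ℝ] Smooth posReals}
    (hT : IsInvariant K T) (hTR : IsModRSq T) : ∃ α, ∀ f, T f = α * superInt m n f := by
  have hI : IsInvariant K (superInt m n) := superInt_isInvariant hK
  have hIR : IsModRSq (superInt m n) := superInt_isModRSq
  let t : SuperFun n (⊤ : TopologicalSpace.Opens (Bos m)) := SuperFun.tmul 1 (thetaSq n ^ n)
  have ht : ∀ L, (superInt m n t).1 L ≠ 0 := superInt_thetaSq_pow hm
  have key : ∀ L f, (T f).1 L * (superInt m n t).1 L = (superInt m n f).1 L * (T t).1 L :=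
    fun L f => by
    let ev : Smooth posReals →ₗ[ℝ] ℝ := LinearMap.proj L ∘ₗ (Smooth posReals).val.toLinearMap
    -- Using the common kernel gives one constant `c` for both functionals, so they are compared
    -- without knowing their values.
    let N := LinearMap.ker (ev ∘ₗ T) ⊓ LinearMap.ker (ev ∘ₗ superInt m n)
    have hmem : ∀ g, g ∈ N ↔ (T g).1 L = 0 ∧ (superInt m n g).1 L = 0 := fun g => Iff.rfl
    have hosp : ∀ i j g, ospGen i j g ∈ N := fun i j g => by
      rw [hmem, hT.apply_ospGen hK1, hI.apply_ospGen hK1]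
      exact ⟨rfl, rfl⟩
    have hR : ∀ g, RSq m n * g - (L : ℝ) ^ 2 • g ∈ N := fun g => by
      rw [hmem, map_sub, map_sub, map_smul, map_smul]
      exact ⟨sub_eq_zero.2 (hTR g L), sub_eq_zero.2 (hIR g L)⟩
    have hrad : ∀ h, ∃ g, IsRadial g ∧ h - g ∈ bosPart N := by
      rcases hKm with hm2 | ⟨rfl, hneg⟩
      · exact exists_radial_sub_mem (bosRot_mem_bosPart hosp) hm2
      · refine exists_radial_sub_mem_one fun g => ?_
        rw [hmem, map_sub, map_sub, hT.apply_groupAct hneg, hI.apply_groupAct hneg, sub_self,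
          sub_self]
        exact ⟨rfl, rfl⟩
    obtain ⟨c, hc⟩ := exists_sub_smul_thetaSq_pow_mem hm L.2 hosp hR hrad f
    rw [hmem, map_sub, map_sub, map_smul, map_smul] at hc
    have h1 : (T f).1 L = c * (T t).1 L := sub_eq_zero.1 hc.1
    have h2 : (superInt m n f).1 L = c * (superInt m n t).1 L := sub_eq_zero.1 hc.2
    rw [h1, h2]
    ring
  -- As the test element `t` does not depend on `L`, the pointwise ratio is a quotient of two smooth
  -- functions with nonvanishing denominator.
  have hα : ContDiffOn ℝ ∞ (fun L => extendZero posReals (T t).1 L /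
      extendZero posReals (superInt m n t).1 L) posReals :=
    (T t).2.div (superInt m n t).2 fun L hL => by
      rw [extendZero_apply posReals (superInt m n t).1 ⟨L, hL⟩]
      exact ht _
  refine ⟨Smooth.mk posReals _ hα, fun f => ?_⟩
  ext L
  change (T f).1 L = extendZero posReals (T t).1 L / extendZero posReals (superInt m n t).1 L *
    (superInt m n f).1 L
  rw [extendZero_apply, extendZero_apply, div_mul_eq_mul_div, eq_div_iff (ht L), key, mul_comm]

/-- The factor is unique because the integral of `θ^{2n}` vanishes at no radius. Treating a general
`K` covers both cases of the theorem: rotations make functions radial for `m ≥ 2`, the reflection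
does so for `m = 1`. -/
theorem isInvariant_and_isModRSq_iff (hm : m ≠ 0) {K : Set (Matrix (Fin m) (Fin m) ℝ)}
    (hK : K ⊆ Matrix.orthogonalGroup (Fin m) ℝ) (hK1 : 1 ∈ K) (hKm : 2 ≤ m ∨ m = 1 ∧ -1 ∈ K)
    (T : SuperFun n (⊤ : TopologicalSpace.Opens (Bos m)) →ₗ[ℝ] Smooth posReals) :
    (IsInvariant K T ∧ IsModRSq T) ↔ ∃! α, ∀ f, T f = α * superInt m n f := by
  constructor
  · rintro ⟨hT, hTR⟩
    obtain ⟨α, hα⟩ := exists_eq_mul_superInt hm hK hK1 hKm hT hTR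
    refine ⟨α, hα, fun β hβ => ?_⟩
    ext L
    have h1 := congrArg (fun g : Smooth posReals => g.1 L)
      ((hβ (SuperFun.tmul 1 (thetaSq n ^ n))).symm.trans (hα _))
    exact mul_right_cancel₀ (superInt_thetaSq_pow hm L) h1
  · rintro ⟨α, hα, -⟩
    refine ⟨fun A hA B hB w hw f => ?_, fun f L => ?_⟩
    · rw [hα, superInt_isInvariant hK A hA B hB w hw f, hα]
      split_ifs <;> simp
    · have h1 := superInt_isModRSq (m := m) (n := n) f L
      rw [hα, hα]
      change α.1 L * (superInt m n (RSq m n * f)).1 L = _ * (α.1 L * (superInt m n f).1 L)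
      rw [h1]
      ring

end Uniqueness

end Superspace

end

/-! ### The main theorem -/

theorem mainTheorem4 (m n : ℕ) (hm : m ≠ 0) :
    ∃ I : Superspace.SuperFun n (⊤ : TopologicalSpace.Opens (Superspace.Bos m)) →ₗ[ℝ]
        Superspace.Smooth Superspace.posReals,
      (∀ f L, (I f).1 L = Superspace.supersphereIntegral f L) ∧
      (∀ f L, (I f).1 L = Superspace.supersphereIntegral' f L) ∧
      Superspace.IsSOSpInvariant I ∧
      Superspace.IsModRSq I ∧
      (2 ≤ m →
        ∀ T : Superspace.SuperFun n (⊤ : TopologicalSpace.Opens (Superspace.Bos m)) →ₗ[ℝ]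
            Superspace.Smooth Superspace.posReals,
          (Superspace.IsSOSpInvariant T ∧ Superspace.IsModRSq T) ↔
            ∃! α : Superspace.Smooth Superspace.posReals, ∀ f, T f = α * I f) ∧
      (m = 1 →
        ∀ T : Superspace.SuperFun n (⊤ : TopologicalSpace.Opens (Superspace.Bos m)) →ₗ[ℝ]
            Superspace.Smooth Superspace.posReals,
          (Superspace.IsOSpInvariant T ∧ Superspace.IsModRSq T) ↔
            ∃! α : Superspace.Smooth Superspace.posReals, ∀ f, T f = α * I f) := by
  have hSO : (Matrix.specialOrthogonalGroup (Fin m) ℝ : Set (Matrix (Fin m) (Fin m) ℝ)) ⊆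
      Matrix.orthogonalGroup (Fin m) ℝ :=
    fun _ hA => (Matrix.mem_specialOrthogonalGroup_iff.1 hA).1
  refine ⟨Superspace.superInt m n, fun f L => ?_, Superspace.superInt_eq_supersphereIntegral' hm,
    Superspace.superInt_isInvariant hSO, Superspace.superInt_isModRSq, fun hm2 T => ?_,
    fun hm1 T => ?_⟩
  · rw [Superspace.supersphereIntegral_eq, Superspace.superInt_eq_supersphereIntegral' hm]
  · exact Superspace.isInvariant_and_isModRSq_iff hm hSO (one_mem _) (Or.inl hm2) T
  -- On the line `SO(1)` is trivial and there are no rotation fields; the element `-1` of `O(1)`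
  -- takes their place.
  · exact Superspace.isInvariant_and_isModRSq_iff hm subset_rfl (one_mem _)
      (Or.inr ⟨hm1, by simp [Matrix.mem_orthogonalGroup_iff]⟩) T
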